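/- Let $A$ be a finite totally ordered alphabet, $\iota:A\to A$ an involution, and $R$ a finite set of equalities between strings over $A$ that contains $x\iota(x)=\epsilon$ and $\iota(x)x=\epsilon$ for every $x\in A$. Write $A^*$ for the set of strings, $<$ for the shortlex order on $A^*$ (shorter strings first, then lexicographic order), $w^{-1}$ for the formal inverse of a string, and let the Thue congruence be the congruence on $A^*$ generated by $R$. A rule is a pair $(\lambda,\rho)\in A^*\times A^*$; it rewrites $s_1\lambda s_2$ to $s_1\rho s_2$. Let $\mathrm{SL2}$ be the set of pairs $(u,v)$ with $u>v$, $|v|\le|u|\le|v|+2$ and no common first letter. Consider the following Knuth--Bendix procedure, run for ever (all choices of order being arbitrary); $S(t)$ denotes the finite set $S$ of rules stored after $t$ operations. **Automata.** A rule $(u,v)$ with $|u|\ge|v|$ is read as a string of pairs $(u_i,v_i)$, $v$ being padded at its end by a symbol that counts as the empty string. The automata used read such pairs, have one initial state, which is the only final state, and every state has a string as label, distinct states having distinct labels; the initial label is $\epsilon$. For such an automaton $M$, let $\mathcal R(M)$ be the set of pairs in $\mathrm{SL2}$ accepted by $M$. *Welding* $M$ means making the least identification of states such that, for each letter, arrows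 with that letter and the same source have the same target and arrows with that letter and the same target have the same source, and such that the two ends of every arrow labelled $(x,x)$, $x\in A$, which starts or ends at the initial state coincide; an amalgamated state takes the least label, and afterwards arrows $(x,x)$ at the initial state are omitted. Two automata are kept: $\mathrm{Rules}$, constant during a pass, and $\mathrm{WDiff}$, some of whose arrows and states are marked *needed* (an identification of something with something needed is needed). **Rapid reduction** of $w$ with respect to $T=\mathcal R(M)$ (with $M=\mathrm{Rules}$ unless stated otherwise): while $w$ contains a left-hand side of $T$, let $p\lambda$ be the shortest prefix of $w$ that contains one, with $\lambda$ its shortest suffix that is one; let $\rho$ be the least string with $(\lambda,\rho)\in S$ or, if there is none, the least with $(\lambda,\rho)\in T$, in which case $(\lambda,\rho)$ is inserted into $\mathrm{New}$; replace this $\lambda$ in $w$ by $\rho$. **Start.** $S$ is the disjoint union of parts $\mathrm{Considered}$, $\mathrm{This}$, $\mathrm{New}$, $\mathrm{Delete}$. Each $(a,b)\in R$ is turned into a relator $ab^{-1}$, which is freely and cyclically reduced; if it is not empty it is written as $lr^{-1}$ with $(l,r)\in\mathrm{SL2}$. Initially $\mathrm{This}$ consists of these rules $(l,r)$ and of all $(x\iota(x),\epsilon)$,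 and the other parts are empty. For each of these rules one takes an automaton that is a single closed path at the initial state reading the rule, the state reached after a prefix $(u',v')$ being labelled by some string that represents $u'^{-1}v'$ modulo the Thue congruence. These are welded together; the result is $\mathrm{Rules}=\mathrm{WDiff}$, with everything marked needed. **A pass.** (1) Empty $\mathrm{Delete}$. (2) Minimize each rule in $\mathrm{Considered}$ and handle the output; then do the same with rules in $\mathrm{New}$ until $\mathrm{New}$ is empty. (3) While $\mathrm{This}$ is non-empty, move a rule $r=(\lambda,\rho)$ from it to $\mathrm{Considered}$ and, for each $r'=(\lambda',\rho')$ in $\mathrm{Considered}$ (including $r$) and each overlap $\lambda=s_1z$, $\lambda'=zs_2$ with $z\ne\epsilon$, or vice versa, rapidly reduce $\rho s_2$ and $s_1\rho'$ (respectively $\rho' s_2$ and $s_1\rho$); if the results differ, insert the rule with the larger as left-hand side and the smaller as right-hand side into $\mathrm{New}$, unless it is in $S$ already. (4) While some label in $\mathrm{WDiff}$ is reducible with respect to $\mathcal R(\mathrm{WDiff})$, rapidly reduce all labels with respect to that set, identify states with equal labels, and weld. Then delete all that is not needed from $\mathrm{WDiff}$, let $\mathrm{Rules}$ for the next pass be a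 copy of $\mathrm{WDiff}$, and mark everything in $\mathrm{WDiff}$ as not needed. **Minimizing** $(u,v)$. (i) Rapidly reduce the longest proper prefix of $u$. If that changes $u$, rapidly reduce the new $u$; otherwise rapidly reduce the longest proper suffix of $u$ and, if that changes $u$, rapidly reduce the new $u$. (ii) With $u=u_1\cdots u_p$, $v=v_1\cdots v_q$: while $p>q+2$, or $p=q+2$, $q>0$ and $u_1>v_1$, replace $(u,v)$ by $(u_1\cdots u_{p-1},v\iota(u_p))$; then, if $p=q+2$ and $u_2>\iota(u_1)$, replace it by $(u_2\cdots u_p,\iota(u_1)v)$; cancel common first letters, then common last letters, as long as possible; rapidly reduce $v$; interchange $u$ and $v$ if $v>u$. Repeat (ii) until it changes nothing. **Handling** the output $r_1$ of an input $r$. If $r_1\ne(\epsilon,\epsilon)$, sew $r_1$ into $\mathrm{WDiff}$: read it from the initial state as far as possible, read the rest backwards from the final state as far as possible, and create arrows for what remains, the arrow $(x,y)$ from the state labelled $w$ going to the state (new, if necessary) labelled by the reduced form of $\iota(x)wy$ (this last reduction leaves $S$ unchanged); join the two states where forward and backward reading meet, mark all arrows and states used as needed, and weld. If $r_1=r$ and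 $r$ is in $\mathrm{New}$, move $r$ to $\mathrm{This}$. If $r_1\ne r$, insert $r_1$ into $\mathrm{This}$ unless it is $(\epsilon,\epsilon)$ or already in $S$; then delete $r$ if step (i) changed its left-hand side, and otherwise move $r$ to $\mathrm{Delete}$. A string is *$S(t)$-irreducible* if no rule of $S(t)$ rewrites it, and *permanently irreducible* if it is $S(t)$-irreducible for arbitrarily large $t$. A rule $(\lambda,\rho)$ that belongs to $S(t)$ for some $t$ is *permanent* if $\rho$ and every proper substring of $\lambda$ are permanently irreducible. **Claim.** For every run of the procedure: 1. the set of permanent rules is confluent: if it rewrites $u$, in finitely many steps, to $v$ and to $w$, then it rewrites $v$ and $w$ to a common string; 2. the set of permanent rules is equal to $P=\bigcap_{t}\bigcup_{s\ge t}S(s)$; 3. a string $u\in A^*$ is the shortlex-least element of its Thue congruence class if and only if it is permanently irreducible. -/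

import Mathlib

namespace RapidKB

/-! ### Strings, rewriting systems, the shortlex order -/

/-- A rule is a pair of strings `(left-hand side, right-hand side)`. -/
abbrev Rule (A : Type*) := List A × List A

/-- `u` rewrites to `v` in one elementary reduction by a rule of `R`. -/
def Rewrites {A : Type*} (R : Set (Rule A)) (u v : List A) : Prop :=
  ∃ x y : List A, ∃ r ∈ R, u = x ++ r.1 ++ y ∧ v = x ++ r.2 ++ y

/-- The Thue congruence generated by `R`. -/
def Thue {A : Type*} (R : Set (Rule A)) : List A → List A → Prop :=
  Relation.EqvGen (Rewrites R)

/-- No elementary reduction by a rule of `R` starts at `u`. -/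
def IsIrred {A : Type*} (R : Set (Rule A)) (u : List A) : Prop :=
  ∀ v, ¬ Rewrites R u v

/-- Confluence of a rewriting system. -/
def Confluent {A : Type*} (R : Set (Rule A)) : Prop :=
  ∀ u v w, Relation.ReflTransGen (Rewrites R) u v → Relation.ReflTransGen (Rewrites R) u w →
    ∃ z, Relation.ReflTransGen (Rewrites R) v z ∧ Relation.ReflTransGen (Rewrites R) w z

/-- Shortlex order: shorter strings first, then lexicographically. -/
def SLt {A : Type*} [LinearOrder A] (u v : List A) : Prop :=
  List.Shortlex (· < ·) u v

theorem sLt_wf (A : Type*) [LinearOrder A] [Finite A] :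
    WellFounded (SLt : List A → List A → Prop) :=
  List.Shortlex.wf (wellFounded_lt (α := A))

/-- `Exhaust r a b`: apply `r` repeatedly to `a`, until this is no longer possible, ending at `b`. -/
def Exhaust {α : Type*} (r : α → α → Prop) (a b : α) : Prop :=
  Relation.ReflTransGen r a b ∧ ∀ c, ¬ r b c

/-- `Once r a b`: apply `r` to `a` if this is possible, and otherwise do nothing. -/
def Once {α : Type*} (r : α → α → Prop) (a b : α) : Prop :=
  r a b ∨ ((∀ c, ¬ r a c) ∧ b = a)

/-- The formal inverse of a string, for the involution `ι` on letters. -/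
def inv {A : Type*} (ι : A → A) (w : List A) : List A := (w.map ι).reverse

/-! ### Two-variable automata

Letters of a two-variable automaton are pairs `(x, y)` with `x` in the alphabet and `y` in the
padded alphabet (`none` is the padding symbol).  The automata of the procedure have one initial
state, which is also the only final state.  Each state carries a string (its label), and distinct
states carry distinct strings, so states are represented by their labels; the initial state is the
empty string.  The automata are trim, so that the states other than the initial one are exactly
the end points of the arrows, and an automaton is given by its arrows. -/

abbrev Letter (A : Type*) := A × Option A

/-- `(source, letter, target)` -/
abbrev Arrow (A : Type*) := List A × Letter A × List A

/-- The padded string of pairs of `(u, v)` (used when `v` is not longer than `u`). -/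
def pad {A : Type*} : List A → List A → List (Letter A)
  | [], _ => []
  | a :: u, [] => (a, none) :: pad u []
  | a :: u, b :: v => (a, some b) :: pad u v

/-- The arrows of the path that starts at `s` and then reads letters and visits states as listed. -/
def trail {A : Type*} : List A → List (Letter A × List A) → List (Arrow A)
  | _, [] => []
  | s, (x, t) :: p => (s, x, t) :: trail t p

/-- The last state of the path that starts at `s`. -/
def endpt {A : Type*} : List A → List (Letter A × List A) → List A
  | s, [] => s
  | _, (_, t) :: p => endpt t p

/-- The language of the automaton `SL2`: no common first letter, shortlex decreasing, and a
difference of lengths of at most two. -/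
def SL2 {A : Type*} [LinearOrder A] (r : Rule A) : Prop :=
  (∀ x u v, ¬ (r.1 = x :: u ∧ r.2 = x :: v)) ∧ SLt r.2 r.1 ∧
    r.2.length ≤ r.1.length ∧ r.1.length ≤ r.2.length + 2

/-- The (possibly infinite) set of rules given by an automaton: the pairs accepted both by the
automaton and by `SL2`. -/
def ruleSet {A : Type*} [LinearOrder A] (E : Finset (Arrow A)) : Set (Rule A) :=
  {r | SL2 r ∧ ∃ p : List (Letter A × List A), p.map Prod.fst = pad r.1 r.2 ∧
    (∀ a ∈ trail [] p, a ∈ E) ∧ endpt [] p = []}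

/-- The states of an automaton. -/
def states {A : Type*} [LinearOrder A] (E : Finset (Arrow A)) : Finset (List A) :=
  insert [] (E.image (fun a => a.1) ∪ E.image (fun a => a.2.2))

/-- The automaton `WDiff`: its arrows, and those of its arrows that are marked as needed (the
needed states are the initial state and the end points of the needed arrows). -/
structure WDiff (A : Type*) where
  arrows : Finset (Arrow A)
  needed : Finset (Arrow A)

/-- The identifications of states made when welding: those prescribed by `J`, those forced by
forward and backward determinism, and the identification with the initial state of the other end
of every arrow labelled `(x, x)` which starts or ends at the initial state. -/
inductive WeldEq {A : Type*} (E : Finset (Arrow A)) (J : List A → List A → Prop) :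
    List A → List A → Prop
  | join {s t} : J s t → WeldEq E J s t
  | refl (s) : WeldEq E J s s
  | symm {s t} : WeldEq E J s t → WeldEq E J t s
  | trans {s t u} : WeldEq E J s t → WeldEq E J t u → WeldEq E J s u
  | fwd {s x t s' t'} : (s, x, t) ∈ E → (s', x, t') ∈ E → WeldEq E J s s' → WeldEq E J t t'
  | bwd {s x t s' t'} : (s, x, t) ∈ E → (s', x, t') ∈ E → WeldEq E J t t' → WeldEq E J s s'
  | diag_src {s x t} : (s, (x, some x), t) ∈ E → WeldEq E J s [] → WeldEq E J t []
  | diag_tgt {s x t} : (s, (x, some x), t) ∈ E → WeldEq E J t [] → WeldEq E J s []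

/-- The label of an amalgamated state: the shortlex least of the labels of its members. -/
noncomputable def weldRep {A : Type*} [LinearOrder A] [Finite A] (E : Finset (Arrow A))
    (J : List A → List A → Prop) (s : List A) : List A :=
  (sLt_wf A).min {t | WeldEq E J s t} ⟨s, WeldEq.refl s⟩

/-- Rename the states of a set of arrows. -/
def renameArrows {A : Type*} [LinearOrder A] (f : List A → List A) (E : Finset (Arrow A)) :
    Finset (Arrow A) :=
  E.image (fun a => (f a.1, a.2.1, f a.2.2))

/-- Omit the arrows labelled `(x, x)` at the initial state. -/
def dropLoops {A : Type*} [LinearOrder A] (E : Finset (Arrow A)) : Finset (Arrow A) :=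
  E.filter (fun a => ¬ (a.2.1.2 = some a.2.1.1 ∧ (a.1 = [] ∨ a.2.2 = [])))

/-- Weld an automaton after joining the pairs of states in `J` by epsilon-arrows, and omit the
arrows labelled `(x, x)` at the initial state.  The result of identifying something with something
needed is needed. -/
noncomputable def weld {A : Type*} [LinearOrder A] [Finite A] (M : WDiff A)
    (J : List A → List A → Prop) : WDiff A where
  arrows := dropLoops (renameArrows (weldRep M.arrows J) M.arrows)
  needed := dropLoops (renameArrows (weldRep M.arrows J) M.needed)

/-! ### The finite set of rules and rapid reduction -/

/-- The finite set of explicit rules, in its four parts. -/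
structure Store (A : Type*) where
  considered : Finset (Rule A)
  thisPass : Finset (Rule A)
  newRules : Finset (Rule A)
  toDelete : Finset (Rule A)

/-- All rules of the store. -/
def Store.all {A : Type*} [LinearOrder A] (S : Store A) : Finset (Rule A) :=
  S.considered ∪ S.thisPass ∪ S.newRules ∪ S.toDelete

/-- Insert a rule into the part `New`, unless it is already in the store. -/
def Store.record {A : Type*} [LinearOrder A] (S : Store A) (r : Rule A) : Store A :=
  if r ∈ S.all then S else { S with newRules := insert r S.newRules }

/-- `ρ` is the shortlex least right-hand side of a rule of `T` with left-hand side `l`. -/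
def LeastRhs {A : Type*} [LinearOrder A] (T : Set (Rule A)) (l ρ : List A) : Prop :=
  (l, ρ) ∈ T ∧ ∀ σ, (l, σ) ∈ T → ¬ SLt σ ρ

/-- One step of rapid reduction with respect to the rules `T`.  The prefix `p ++ l` is the
shortest reducible prefix of the string, and `l` is its shortest suffix which is a left-hand side
of a rule of `T`.  The right-hand side is the least one offered by the store and, if the store
offers none, the least one offered by `T`; in the latter case the rule is inserted into `New`. -/
def RStep {A : Type*} [LinearOrder A] (T : Set (Rule A)) (c c' : Store A × List A) : Prop :=
  ∃ p l q ρ : List A, c.2 = p ++ l ++ q ∧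
    (∃ σ, (l, σ) ∈ T) ∧
    (∀ p', p' <+: p ++ l → p' ≠ p ++ l → IsIrred T p') ∧
    (∀ l', l' <:+ l → l' ≠ l → ¬ ∃ σ, (l', σ) ∈ T) ∧
    (LeastRhs (c.1.all : Set (Rule A)) l ρ ∨
      ((¬ ∃ σ, (l, σ) ∈ c.1.all) ∧ LeastRhs T l ρ)) ∧
    c' = (c.1.record (l, ρ), p ++ ρ ++ q)

/-- Rapid reduction: from the string `w` and the store `S` we obtain the irreducible string `w'`
and the store `S'`. -/
def RReduce {A : Type*} [LinearOrder A] (T : Set (Rule A)) (S : Store A) (w : List A)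
    (S' : Store A) (w' : List A) : Prop :=
  Exhaust (RStep T) (S, w) (S', w')

/-! ### Minimizing a rule -/

/-- The first three steps: they reduce the left-hand side, unless all its proper substrings are
irreducible. -/
inductive Prepare {A : Type*} [LinearOrder A] (T : Set (Rule A)) :
    Store A → List A → Store A → List A → Prop
  | pre {S i y S₁ i' S₂ u} : RReduce T S i S₁ i' → i' ≠ i → RReduce T S₁ (i' ++ [y]) S₂ u →
      Prepare T S (i ++ [y]) S₂ u
  | suf {S i y x t S₁ S₂ t' S₃ u} : x :: t = i ++ [y] → RReduce T S i S₁ i →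
      RReduce T S₁ t S₂ t' → t' ≠ t → RReduce T S₂ (x :: t') S₃ u →
      Prepare T S (x :: t) S₃ u
  | same {S i y x t S₁ S₂} : x :: t = i ++ [y] → RReduce T S i S₁ i →
      RReduce T S₁ t S₂ t → Prepare T S (x :: t) S₂ (x :: t)

/-- Move the last letter of the left-hand side to the right-hand side. -/
def MoveLast {A : Type*} [LinearOrder A] (ι : A → A) (r r' : Rule A) : Prop :=
  ∃ x, r.1 = r'.1 ++ [x] ∧ r'.2 = r.2 ++ [ι x] ∧
    (r.1.length > r.2.length + 2 ∨
      (r.1.length = r.2.length + 2 ∧ ∃ a u b v, r.1 = a :: u ∧ r.2 = b :: v ∧ b < a))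

/-- Move the first letter of the left-hand side to the right-hand side. -/
def MoveFirst {A : Type*} [LinearOrder A] (ι : A → A) (r r' : Rule A) : Prop :=
  ∃ a b u, r.1 = a :: b :: u ∧ r.1.length = r.2.length + 2 ∧ ι a < b ∧
    r' = (b :: u, ι a :: r.2)

def CancelFirst {A : Type*} (r r' : Rule A) : Prop :=
  ∃ x, r.1 = x :: r'.1 ∧ r.2 = x :: r'.2

def CancelLast {A : Type*} (r r' : Rule A) : Prop :=
  ∃ x, r.1 = r'.1 ++ [x] ∧ r.2 = r'.2 ++ [x]

open Classical in
/-- Interchange the two sides if the right-hand side is the larger one. -/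
noncomputable def orient {A : Type*} [LinearOrder A] (u v : List A) : Rule A :=
  if SLt u v then (v, u) else (u, v)

/-- One round of the loop of the minimization routine. -/
def MinRound {A : Type*} [LinearOrder A] (ι : A → A) (T : Set (Rule A)) (S : Store A)
    (r : Rule A) (S' : Store A) (r' : Rule A) : Prop :=
  ∃ r₁ r₂ r₃ r₄ v, Exhaust (MoveLast ι) r r₁ ∧ Once (MoveFirst ι) r₁ r₂ ∧
    Exhaust CancelFirst r₂ r₃ ∧ Exhaust CancelLast r₃ r₄ ∧
    RReduce T S r₄.2 S' v ∧ r' = orient r₄.1 v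

/-- The loop of the minimization routine: repeat until nothing changes. -/
inductive MinLoop {A : Type*} [LinearOrder A] (ι : A → A) (T : Set (Rule A)) :
    Store A → Rule A → Store A → Rule A → Prop
  | halt {S r S'} : MinRound ι T S r S' r → MinLoop ι T S r S' r
  | again {S r S₁ r₁ S₂ r₂} : MinRound ι T S r S₁ r₁ → r₁ ≠ r → MinLoop ι T S₁ r₁ S₂ r₂ →
      MinLoop ι T S r S₂ r₂

/-! ### Handling the output of minimization -/

/-- New arrows, with labels calculated by reduction, made when a rule is sewn into `WDiff`. -/
inductive Created {A : Type*} [LinearOrder A] (ι : A → A) (T : Set (Rule A)) (S : Store A) :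
    List A → List (Letter A × List A) → Prop
  | nil (s) : Created ι T S s []
  | cons {s x t p S'} : RReduce T S (ι x.1 :: s ++ x.2.toList) S' t → Created ι T S t p →
      Created ι T S s ((x, t) :: p)

/-- Sewing a rule into `WDiff`.  The part `p` of the rule is read from the initial state as far as
possible, the part `q` is read backwards from the final state as far as possible, arrows are
created for the part `b` in between, the two resulting states are joined and the automaton is
welded.  All arrows that are used are marked as needed. -/
def Sew {A : Type*} [LinearOrder A] [Finite A] (ι : A → A) (T : Set (Rule A)) (S : Store A)
    (M : WDiff A) (r : Rule A) (M' : WDiff A) : Prop :=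
  ∃ (p b q : List (Letter A × List A)) (t : List A),
    (p ++ b ++ q).map Prod.fst = pad r.1 r.2 ∧
    (∀ a ∈ trail [] p, a ∈ M.arrows) ∧
    (∀ x l, (b ++ q).map Prod.fst = x :: l → ∀ s', (endpt [] p, x, s') ∉ M.arrows) ∧
    (∀ a ∈ trail t q, a ∈ M.arrows) ∧ endpt t q = [] ∧
    (∀ x l, b.map Prod.fst = l ++ [x] → ∀ s', (s', x, t) ∉ M.arrows) ∧
    Created ι T S (endpt [] p) b ∧
    M' = weld
      ⟨M.arrows ∪ (trail (endpt [] p) b).toFinset,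
        M.needed ∪ (trail [] p ++ trail (endpt [] p) b ++ trail t q).toFinset⟩
      (fun s s' => s = endpt (endpt [] p) b ∧ s' = t)

/-- What happens to the store when the input `r` to minimization has produced the output `out`;
`affected` says that some proper substring of the left-hand side of `r` was reducible. -/
def handle {A : Type*} [LinearOrder A] (S : Store A) (r out : Rule A) (affected : Bool) :
    Store A :=
  if out = r then
    if r ∈ S.considered then S
    else { S with newRules := S.newRules.erase r, thisPass := insert r S.thisPass }
  else
    { considered := S.considered.erase r
      newRules := S.newRules.erase r
      thisPass := if out = ([], []) ∨ out ∈ S.all then S.thisPass else insert out S.thisPass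
      toDelete := if affected then S.toDelete else insert r S.toDelete }

/-- Minimize the rule `r` and handle the output. -/
def MinimizeAndHandle {A : Type*} [LinearOrder A] [Finite A] (ι : A → A) (T : Set (Rule A)) (S : Store A)
    (M : WDiff A) (r : Rule A) (S' : Store A) (M' : WDiff A) : Prop :=
  ∃ S₁ u S₂ out, Prepare T S r.1 S₁ u ∧ MinLoop ι T S₁ (u, r.2) S₂ out ∧
    ((out = ([], []) ∧ M' = M) ∨ (out ≠ ([], []) ∧ Sew ι T S₂ M out M')) ∧
    S' = handle S₂ r out (decide (u ≠ r.1))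

/-! ### The end of a pass -/

/-- Reduce the strings of a list one after the other. -/
inductive ReduceList {A : Type*} [LinearOrder A] (T : Set (Rule A)) :
    Store A → List (List A) → Store A → List (List A) → Prop
  | nil (S) : ReduceList T S [] S []
  | cons {S w S₁ w' l S₂ l'} : RReduce T S w S₁ w' → ReduceList T S₁ l S₂ l' →
      ReduceList T S (w :: l) S₂ (w' :: l')

/-- If some state label of `WDiff` is reducible with respect to the rules given by `WDiff`:
reduce all labels with respect to these rules, identify states with equal labels and weld. -/
def RelabelRound {A : Type*} [LinearOrder A] [Finite A] (c c' : Store A × WDiff A) : Prop :=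
  (∃ s ∈ states c.2.arrows, ¬ IsIrred (ruleSet c.2.arrows) s) ∧
  ∃ (l : List (List A)) (f : List A → List A), l.Nodup ∧ l.toFinset = states c.2.arrows ∧
    ReduceList (ruleSet c.2.arrows) c.1 l c'.1 (l.map f) ∧
    c'.2 = weld ⟨renameArrows f c.2.arrows, renameArrows f c.2.needed⟩ (fun _ _ => False)

/-! ### The main loop -/

/-- The pairs of strings `(ρ₁ s₂, s₁ ρ₂)` that arise from the overlaps of the left-hand side of
`r` with the left-hand sides of the rules in `C`, in either order. -/
def criticalPairs {A : Type*} (r : Rule A) (C : Set (Rule A)) : Set (List A × List A) :=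
  {c | ∃ r' ∈ C, ∃ s₁ z s₂ : List A, z ≠ [] ∧
    ((r.1 = s₁ ++ z ∧ r'.1 = z ++ s₂ ∧ c = (r.2 ++ s₂, s₁ ++ r'.2)) ∨
     (r'.1 = s₁ ++ z ∧ r.1 = z ++ s₂ ∧ c = (r'.2 ++ s₂, s₁ ++ r.2)))}

/-- The point that a pass has reached. -/
inductive Phase (A : Type*) where
  /-- at the start of a pass -/
  | start
  /-- minimizing the rules in `Considered`; `todo` remain -/
  | minimizeConsidered (todo : Finset (Rule A))
  /-- minimizing the rules in `New` -/
  | minimizeNew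
  /-- taking the rules of `This` one by one -/
  | takeThis
  /-- comparing a rule taken from `This` with those in `Considered`; `todo` remain -/
  | compare (todo : Set (List A × List A))

/-- The state of the procedure.  `rules` is the automaton `Rules[n]` of the current pass. -/
structure Config (A : Type*) where
  rules : Finset (Arrow A)
  wdiff : WDiff A
  store : Store A
  phase : Phase A

/-- One operation of the procedure. -/
inductive Step {A : Type*} [LinearOrder A] [Finite A] (ι : A → A) : Config A → Config A → Prop
  /-- delete the rules in `Delete` and turn to the rules in `Considered` -/
  | start {E M S} :
      Step ι ⟨E, M, S, .start⟩ ⟨E, M, { S with toDelete := ∅ }, .minimizeConsidered S.considered⟩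
  | minimizeConsidered {E M S todo r S' M'} : r ∈ todo → MinimizeAndHandle ι (ruleSet E) S M r S' M' →
      Step ι ⟨E, M, S, .minimizeConsidered todo⟩ ⟨E, M', S', .minimizeConsidered (todo.erase r)⟩
  | consideredDone {E M S} :
      Step ι ⟨E, M, S, .minimizeConsidered ∅⟩ ⟨E, M, S, .minimizeNew⟩
  | minimizeNew {E M S r S' M'} : r ∈ S.newRules → MinimizeAndHandle ι (ruleSet E) S M r S' M' →
      Step ι ⟨E, M, S, .minimizeNew⟩ ⟨E, M', S', .minimizeNew⟩
  | newDone {E M S} : S.newRules = ∅ →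
      Step ι ⟨E, M, S, .minimizeNew⟩ ⟨E, M, S, .takeThis⟩
  /-- move a rule from `This` to `Considered`, and compare it with all rules in `Considered` -/
  | takeThis {E M S r} : r ∈ S.thisPass →
      Step ι ⟨E, M, S, .takeThis⟩
        ⟨E, M, { S with thisPass := S.thisPass.erase r, considered := insert r S.considered },
          .compare (criticalPairs r (insert r S.considered : Finset (Rule A)))⟩
  /-- reduce both sides of a critical pair; a nontrivial outcome is inserted into `New` -/
  | compare {E M S todo c S₁ v S₂ w} : c ∈ todo →
      RReduce (ruleSet E) S c.1 S₁ v → RReduce (ruleSet E) S₁ c.2 S₂ w →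
      Step ι ⟨E, M, S, .compare todo⟩
        ⟨E, M, if v = w then S₂ else S₂.record (orient v w), .compare (todo \ {c})⟩
  | compareDone {E M S} :
      Step ι ⟨E, M, S, .compare ∅⟩ ⟨E, M, S, .takeThis⟩
  /-- end of a pass: reduce the labels of `WDiff` until they are irreducible, delete what is not
  needed, copy `WDiff` to the next `Rules`, and mark everything as not needed -/
  | finish {E M S S' M'} : S.thisPass = ∅ →
      Relation.ReflTransGen RelabelRound (S, M) (S', M') →
      (∀ s ∈ states M'.arrows, IsIrred (ruleSet M'.arrows) s) →
      Step ι ⟨E, M, S, .takeThis⟩ ⟨M'.needed, ⟨M'.needed, ∅⟩, S', .start⟩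

/-! ### Initial arrangements and runs -/

/-- Free and cyclic cancellation of a pair of inverse letters. -/
def CyclicCancel {A : Type*} (ι : A → A) (w w' : List A) : Prop :=
  (∃ x y a, w = x ++ [a, ι a] ++ y ∧ w' = x ++ y) ∨ (∃ a, w = [a] ++ w' ++ [ι a])

/-- Rewriting a defining equality `e` as a rule `(l, r)` of `SL2` such that `l r⁻¹` is the
cyclically reduced relator; a trivial relator gives no rule. -/
def Normalizes {A : Type*} [LinearOrder A] (ι : A → A) (e : Rule A) : Option (Rule A) → Prop
  | none => Exhaust (CyclicCancel ι) (e.1 ++ inv ι e.2) []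
  | some r => r.1 ++ inv ι r.2 ≠ [] ∧ SL2 r ∧
      Exhaust (CyclicCancel ι) (e.1 ++ inv ι e.2) (r.1 ++ inv ι r.2)

/-- The special rules, which make `ι x` the inverse of `x`. -/
def specialRules {A : Type*} [LinearOrder A] [Fintype A] (ι : A → A) : Finset (Rule A) :=
  Finset.univ.image (fun x => ([x, ι x], []))

/-- `p` is the path of the rule automaton of `r` alone, for some choice of state labels: the state
reached after reading a prefix `(u, v)` is labelled by some string which represents `u⁻¹ v`. -/
def IsRuleAutomaton {A : Type*} (ι : A → A) (R : Set (Rule A)) (r : Rule A)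
    (p : List (Letter A × List A)) : Prop :=
  p.map Prod.fst = pad r.1 r.2 ∧ endpt [] p = [] ∧
    ∀ a ∈ trail [] p, Thue R (ι a.2.1.1 :: a.1 ++ a.2.1.2.toList) a.2.2

/-- The configurations in which the procedure may start, for the defining equalities `R`. -/
def IsInitial {A : Type*} [LinearOrder A] [Fintype A] (ι : A → A) (R : Finset (Rule A))
    (c : Config A) : Prop :=
  ∃ (g : Rule A → Option (Rule A)) (p : Rule A → List (Letter A × List A))
    (R₀ : Finset (Rule A)) (E : Finset (Arrow A)),
    (∀ e ∈ R, Normalizes ι e (g e)) ∧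
    R₀ = specialRules ι ∪ R.biUnion (fun e => (g e).toFinset) ∧
    (∀ r ∈ R₀, IsRuleAutomaton ι (R : Set (Rule A)) r (p r)) ∧
    E = (weld ⟨R₀.biUnion (fun r => (trail [] (p r)).toFinset), ∅⟩ (fun _ _ => False)).arrows ∧
    c = ⟨E, ⟨E, E⟩, ⟨∅, R₀, ∅, ∅⟩, .start⟩

/-- A run of the procedure. -/
def IsRun {A : Type*} [LinearOrder A] [Fintype A] (ι : A → A) (R : Finset (Rule A))
    (run : ℕ → Config A) : Prop :=
  IsInitial ι R (run 0) ∧ ∀ t, Step ι (run t) (run (t + 1))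

/-! ### Permanence -/

/-- The set `S(t)` of the rules stored at time `t`. -/
def rulesAt {A : Type*} [LinearOrder A] (run : ℕ → Config A) (t : ℕ) : Set (Rule A) :=
  ((run t).store.all : Set (Rule A))

/-- `u` is irreducible at arbitrarily large times. -/
def PermanentlyIrreducible {A : Type*} [LinearOrder A] (run : ℕ → Config A) (u : List A) :
    Prop :=
  ∀ t, ∃ s, t ≤ s ∧ IsIrred (rulesAt run s) u

/-- The permanent rules: rules, stored at some time, whose right-hand side and all proper
substrings of whose left-hand side are permanently irreducible. -/
def permanentRules {A : Type*} [LinearOrder A] (run : ℕ → Config A) : Set (Rule A) :=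
  {r | (∃ t, r ∈ rulesAt run t) ∧ PermanentlyIrreducible run r.2 ∧
    ∀ w, w <:+: r.1 → w ≠ r.1 → PermanentlyIrreducible run w}

end RapidKB

/-! Reducibility is never lost. Whenever a rule leaves the store, some stored rule has its left-hand
side inside the lost one (`Step.infix`): a rule with a reducible proper substring in its left-hand
side is dropped in favour of the rule that reduced the substring, any other replaced rule waits in
`Delete` while its minimal replacement is stored. Hence permanent irreducibility is irreducibility
with respect to `everStored`, the set of all rules ever stored.

The link between explicit rules and automata is reading. Rules treated in a pass are sewn into the
needed part of `WDiff`. Welding and relabelling preserve readings, except that arrows `(x, x)` at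
the initial state are dropped. So readings are followed with these loops added (`WRead`); a
decreasing pair read in this weak sense, with lengths differing by at most two, still contains the
left-hand side of an accepted rule (`WRead.not_isIrred`). Since every pass ends
(`exists_phase_start`), each string that is ever reducible is reducible by `Rules` from some time on
(`GoodRun.exists_covered`).

Consequently, a rule whose right-hand side, or a proper substring of whose left-hand side, is ever
reducible eventually ceases to be minimal for `Rules`. It is then thrown out and cannot come back.
This yields claim 2, and identifies the permanent rules with the stored rules that minimization
never changes. Taking a minimal reducible substring and the least right-hand side ever stored for it
produces such a rule, so permanent rules reduce every string that is ever reducible.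

For confluence, each rule ever stored follows from permanent rules through strings not exceeding its
left-hand side (`GoodRun.follows`). This is an induction on the rule, because minimization replaces
it by a smaller one and uses only rules with smaller left-hand sides. Two permanent rules eventually
lie together in `Considered`, and at the first such time their critical pairs are put on the list to
be reduced. Thus every critical pair is connected below its overlap, and well-founded induction
gives confluence (`conn_of_peak`, `confluent_of_peaks`).

For claim 3 the Thue congruence is the kernel of a map to a group. All labels and rules are sound
for it, so permanent rules stay within congruence classes; conversely the defining equalities can be
recovered from the initial rules, so the permanent rules generate the congruence. Confluence then
makes the irreducible strings the least representatives. -/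

namespace RapidKB

/-! ### The shortlex order -/

section Order

variable {A : Type*} [LinearOrder A]

/-- The reflexive closure of the shortlex order. -/
def SLe (u v : List A) : Prop := u = v ∨ SLt u v

theorem sLt_trans {u v w : List A} (h₁ : SLt u v) (h₂ : SLt v w) : SLt u w := by
  unfold SLt at *
  rw [List.shortlex_def] at *
  rcases h₁ with h₁ | ⟨e₁, h₁⟩ <;> rcases h₂ with h₂ | ⟨e₂, h₂⟩
  · left; omega
  · left; omega
  · left; omega
  · exact Or.inr ⟨e₁.trans e₂, List.lt_trans (α := A) h₁ h₂⟩

theorem sLt_irrefl (u : List A) : ¬ SLt u u := by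
  intro h
  unfold SLt at h
  rw [List.shortlex_def] at h
  rcases h with h | ⟨_, h⟩
  · exact lt_irrefl _ h
  · exact lt_irrefl (α := List A) u h

theorem sLt_trichotomy (u v : List A) : SLt u v ∨ u = v ∨ SLt v u := by
  unfold SLt
  rw [List.shortlex_def, List.shortlex_def]
  rcases lt_trichotomy u.length v.length with h | h | h
  · exact Or.inl (Or.inl h)
  · rcases lt_trichotomy (α := List A) u v with h' | h' | h'
    · exact Or.inl (Or.inr ⟨h, h'⟩)
    · exact Or.inr (Or.inl h')
    · exact Or.inr (Or.inr (Or.inr ⟨h.symm, h'⟩))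
  · exact Or.inr (Or.inr (Or.inl h))

theorem not_sLt {u v : List A} : ¬ SLt u v ↔ SLe v u := by
  constructor
  · intro h
    rcases sLt_trichotomy u v with h' | h' | h'
    · exact absurd h' h
    · exact Or.inl h'.symm
    · exact Or.inr h'
  · rintro (rfl | h) h'
    · exact sLt_irrefl _ h'
    · exact sLt_irrefl _ (sLt_trans h h')

theorem SLe.refl (u : List A) : SLe u u := Or.inl rfl

theorem SLe.trans_lt {u v w : List A} (h₁ : SLe u v) (h₂ : SLt v w) : SLt u w := by
  rcases h₁ with rfl | h₁
  · exact h₂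
  · exact sLt_trans h₁ h₂

theorem sLt_of_lt_of_le {u v w : List A} (h₁ : SLt u v) (h₂ : SLe v w) : SLt u w := by
  rcases h₂ with rfl | h₂
  · exact h₁
  · exact sLt_trans h₁ h₂

theorem SLe.trans {u v w : List A} (h₁ : SLe u v) (h₂ : SLe v w) : SLe u w := by
  rcases h₁ with rfl | h₁
  · exact h₂
  · exact Or.inr (sLt_of_lt_of_le h₁ h₂)

theorem SLt.ne {u v : List A} (h : SLt u v) : u ≠ v := by
  rintro rfl; exact sLt_irrefl _ h

theorem SLt.asymm {u v : List A} (h : SLt u v) : ¬ SLt v u := fun h' =>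
  sLt_irrefl _ (sLt_trans h h')

theorem sLt_of_length_lt {u v : List A} (h : u.length < v.length) : SLt u v :=
  List.Shortlex.of_length_lt h

theorem SLt.length_le {u v : List A} (h : SLt u v) : u.length ≤ v.length := by
  unfold SLt at h
  rw [List.shortlex_def] at h
  rcases h with h | ⟨h, _⟩ <;> omega

theorem SLe.length_le {u v : List A} (h : SLe u v) : u.length ≤ v.length := by
  rcases h with rfl | h
  · exact le_rfl
  · exact h.length_le

theorem not_sLt_nil (u : List A) : ¬ SLt u [] := fun h =>
  List.not_shortlex_nil_right h

theorem sLt_cons_cons {a b : A} {u v : List A} (hl : u.length = v.length) (h : a < b) :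
    SLt (a :: u) (b :: v) :=
  List.Shortlex.of_lex (by simp [hl]) (List.Lex.rel h)

theorem sLt_cons_iff {a : A} {u v : List A} : SLt (a :: u) (a :: v) ↔ SLt u v :=
  List.shortlex_cons_iff

theorem sLt_append_left_iff {u v : List A} (x : List A) : SLt (x ++ u) (x ++ v) ↔ SLt u v := by
  induction x with
  | nil => rfl
  | cons a x ih => rw [List.cons_append, List.cons_append, sLt_cons_iff, ih]

/-- Different lengths decide the order and stay different. For equal lengths the lexicographic
comparison is decided at a letter, never by a proper prefix, so an appended string cannot disturb
it. -/
theorem SLt.append_right {u v : List A} (h : SLt u v) (y : List A) : SLt (u ++ y) (v ++ y) := by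
  unfold SLt at *
  rw [List.shortlex_def] at *
  rcases h with h | ⟨hl, h⟩
  · left; simp [h]
  · right
    refine ⟨by simp [hl], ?_⟩
    induction h with
    | nil => simp at hl
    | cons _ ih => exact List.Lex.cons (ih (by simpa using hl))
    | rel h => exact List.Lex.rel h

theorem SLt.context {u v : List A} (h : SLt u v) (x y : List A) :
    SLt (x ++ u ++ y) (x ++ v ++ y) :=
  ((sLt_append_left_iff x).2 h).append_right y

theorem SLe.context {u v : List A} (h : SLe u v) (x y : List A) :
    SLe (x ++ u ++ y) (x ++ v ++ y) := by
  rcases h with rfl | h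
  · exact Or.inl rfl
  · exact Or.inr (h.context x y)

theorem sLt_append_right_iff {u v : List A} (y : List A) : SLt (u ++ y) (v ++ y) ↔ SLt u v := by
  refine ⟨fun h => ?_, fun h => h.append_right y⟩
  rcases sLt_trichotomy u v with h' | rfl | h'
  · exact h'
  · exact absurd h (sLt_irrefl _)
  · exact absurd (h'.append_right y) h.asymm

theorem sLe_of_isInfix {u v : List A} (h : u <:+: v) : SLe u v := by
  rcases h.length_le.lt_or_eq with h' | h'
  · exact Or.inr (sLt_of_length_lt h')
  · exact Or.inl (h.eq_of_length h')

theorem sLt_of_isInfix {u v : List A} (h : u <:+: v) (hne : u ≠ v) : SLt u v :=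
  (sLe_of_isInfix h).resolve_left hne

theorem SLt.cons_of_same_length {a b : A} {u v : List A} (hl : u.length = v.length)
    (h : SLt (a :: u) (b :: v)) : a < b ∨ (a = b ∧ SLt u v) := by
  unfold SLt at *
  rw [List.shortlex_def] at *
  rcases h with h | ⟨_, h⟩
  · simp [hl] at h
  · cases h with
    | cons h => exact Or.inr ⟨rfl, Or.inr ⟨hl, h⟩⟩
    | rel h => exact Or.inl h

end Order

/-! ### Rewriting -/

section Rewriting

variable {A : Type*}

theorem reflTransGen_imp {α : Type*} {r p : α → α → Prop} (h : ∀ a b, r a b → p a b) {a b : α}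
    (hab : Relation.ReflTransGen r a b) : Relation.ReflTransGen p a b := by
  induction hab with
  | refl => exact .refl
  | tail _ h' ih => exact ih.tail (h _ _ h')

theorem Rewrites.mono {R R' : Set (Rule A)} (h : R ⊆ R') {u v : List A} (hr : Rewrites R u v) :
    Rewrites R' u v := by
  obtain ⟨x, y, r, hr, h₁, h₂⟩ := hr
  exact ⟨x, y, r, h hr, h₁, h₂⟩

theorem Rewrites.context {R : Set (Rule A)} {u v : List A} (hr : Rewrites R u v) (p q : List A) :
    Rewrites R (p ++ u ++ q) (p ++ v ++ q) := by
  obtain ⟨x, y, r, hr, rfl, rfl⟩ := hr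
  exact ⟨p ++ x, y ++ q, r, hr, by simp, by simp⟩

theorem rewrites_of_mem {R : Set (Rule A)} {r : Rule A} (hr : r ∈ R) : Rewrites R r.1 r.2 :=
  ⟨[], [], r, hr, by simp, by simp⟩

theorem isIrred_iff {R : Set (Rule A)} {u : List A} :
    IsIrred R u ↔ ∀ r ∈ R, ¬ r.1 <:+: u := by
  constructor
  · rintro h r hr ⟨x, y, rfl⟩
    exact h _ ⟨x, y, r, hr, rfl, rfl⟩
  · rintro h v ⟨x, y, r, hr, rfl, rfl⟩
    exact h r hr ⟨x, y, rfl⟩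

theorem not_isIrred_iff {R : Set (Rule A)} {u : List A} :
    ¬ IsIrred R u ↔ ∃ r ∈ R, r.1 <:+: u := by
  rw [isIrred_iff]; push Not; rfl

theorem IsIrred.of_isInfix {R : Set (Rule A)} {u v : List A} (h : IsIrred R v) (huv : u <:+: v) :
    IsIrred R u := by
  rw [isIrred_iff] at *
  exact fun r hr hu => h r hr (hu.trans huv)

theorem IsIrred.mono {R R' : Set (Rule A)} (hR : R ⊆ R') {u : List A} (h : IsIrred R' u) :
    IsIrred R u := fun v hv => h v (hv.mono hR)

/-- All proper substrings of `l` are irreducible. -/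
def ProperIrr (R : Set (Rule A)) (l : List A) : Prop :=
  ∀ w, w <:+: l → w ≠ l → IsIrred R w

theorem ProperIrr.of_isInfix {R : Set (Rule A)} {u v : List A} (h : ProperIrr R v)
    (huv : u <:+: v) : ProperIrr R u := by
  intro w hw hne
  refine h w (hw.trans huv) ?_
  rintro rfl
  exact hne (hw.eq_of_length (le_antisymm hw.length_le huv.length_le))

theorem IsIrred.properIrr {R : Set (Rule A)} {u : List A} (h : IsIrred R u) : ProperIrr R u :=
  fun _ hw _ => h.of_isInfix hw

/-- A proper substring misses the last or the first letter. This is why step (i) of minimization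
needs only the longest proper prefix and the longest proper suffix. -/
theorem proper_isInfix_cons_append {l w i t : List A} {x y : A} (h₁ : l = i ++ [y])
    (h₂ : l = x :: t) (hw : w <:+: l) (hne : w ≠ l) : w <:+: i ∨ w <:+: t := by
  obtain ⟨p, q, hpq⟩ := hw
  rcases List.eq_nil_or_concat q with rfl | ⟨q', b, rfl⟩
  · cases p with
    | nil => simp at hpq; exact absurd hpq hne
    | cons a p =>
      right
      rw [h₂] at hpq
      simp only [List.cons_append, List.cons.injEq] at hpq
      exact ⟨p, [], hpq.2⟩
  · left
    rw [h₁, List.concat_eq_append, ← List.append_assoc] at hpq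
    exact ⟨p, q', (List.append_inj' hpq rfl).1⟩

/-- Every rule of `R` decreases the shortlex order. -/
def Decreasing [LinearOrder A] (R : Set (Rule A)) : Prop := ∀ r ∈ R, SLt r.2 r.1

theorem Rewrites.sLt [LinearOrder A] {R : Set (Rule A)} (hR : Decreasing R) {u v : List A}
    (h : Rewrites R u v) : SLt v u := by
  obtain ⟨x, y, r, hr, rfl, rfl⟩ := h
  exact (hR r hr).context x y

theorem sLe_of_reflTransGen [LinearOrder A] {R : Set (Rule A)} (hR : Decreasing R)
    {u v : List A} (h : Relation.ReflTransGen (Rewrites R) u v) : SLe v u := by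
  induction h with
  | refl => exact SLe.refl _
  | tail _ h ih => exact Or.inr (sLt_of_lt_of_le (h.sLt hR) ih)

theorem reflTransGen_context {R : Set (Rule A)} {u v : List A}
    (h : Relation.ReflTransGen (Rewrites R) u v) (p q : List A) :
    Relation.ReflTransGen (Rewrites R) (p ++ u ++ q) (p ++ v ++ q) := by
  induction h with
  | refl => exact .refl
  | tail _ h ih => exact ih.tail (h.context p q)

theorem IsIrred.eq_of_reflTransGen {R : Set (Rule A)} {u v : List A} (hu : IsIrred R u)
    (h : Relation.ReflTransGen (Rewrites R) u v) : v = u := by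
  rcases h.cases_head with h | ⟨c, h, _⟩
  · exact h.symm
  · exact absurd h (hu c)

theorem not_isIrred_of_reflTransGen {R : Set (Rule A)} {u v : List A}
    (h : Relation.ReflTransGen (Rewrites R) u v) (hne : v ≠ u) : ¬ IsIrred R u :=
  fun hu => hne (hu.eq_of_reflTransGen h)

/-! ### The Thue congruence -/

theorem Thue.context {R : Set (Rule A)} {u v : List A} (h : Thue R u v) (p q : List A) :
    Thue R (p ++ u ++ q) (p ++ v ++ q) := by
  induction h with
  | rel _ _ h => exact .rel _ _ (h.context p q)
  | refl => exact .refl _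
  | symm _ _ _ ih => exact ih.symm
  | trans _ _ _ _ _ h₁ h₂ => exact h₁.trans _ _ _ h₂

theorem Thue.refl {R : Set (Rule A)} (u : List A) : Thue R u u := Relation.EqvGen.refl u

theorem Thue.append {R : Set (Rule A)} {u v u' v' : List A} (h : Thue R u v) (h' : Thue R u' v') :
    Thue R (u ++ u') (v ++ v') := by
  have h₁ := h.context [] u'
  have h₂ := h'.context v []
  simp only [List.nil_append, List.append_nil] at h₁ h₂
  exact h₁.trans _ _ _ h₂

theorem Thue.of_subset {R R' : Set (Rule A)} (h : ∀ r ∈ R, Thue R' r.1 r.2) {u v : List A}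
    (huv : Thue R u v) : Thue R' u v := by
  induction huv with
  | rel _ _ h' =>
    obtain ⟨x, y, r, hr, rfl, rfl⟩ := h'
    exact (h r hr).context x y
  | refl => exact .refl _
  | symm _ _ _ ih => exact ih.symm
  | trans _ _ _ _ _ h₁ h₂ => exact h₁.trans _ _ _ h₂

theorem thue_append_inv {R : Set (Rule A)} {ι : A → A} (h : ∀ x, Thue R [x, ι x] [])
    (w : List A) : Thue R (w ++ inv ι w) [] := by
  induction w using List.reverseRecOn with
  | nil => exact .refl _
  | append_singleton w x ih =>
    have := (h x).context w (inv ι w)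
    rw [List.append_nil] at this
    have e : w ++ [x] ++ inv ι (w ++ [x]) = w ++ [x, ι x] ++ inv ι w := by simp [inv]
    rw [e]
    exact this.trans _ _ _ ih

theorem inv_inv {ι : A → A} (hι : Function.Involutive ι) (w : List A) : inv ι (inv ι w) = w := by
  simp [inv, hι.comp_self]

theorem thue_inv_append {R : Set (Rule A)} {ι : A → A} (hι : Function.Involutive ι)
    (h : ∀ x, Thue R [x, ι x] []) (w : List A) : Thue R (inv ι w ++ w) [] := by
  have := thue_append_inv h (inv ι w)
  rwa [inv_inv hι] at this

/-- Uniqueness of inverses: `u⁻¹`, `u⁻¹ v v⁻¹`, `u⁻¹ u v⁻¹` and `v⁻¹` are congruent in turn. The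
generating rules need not be closed under inversion. -/
theorem Thue.inv {R : Set (Rule A)} {ι : A → A} (hι : Function.Involutive ι)
    (h : ∀ x, Thue R [x, ι x] []) {u v : List A} (huv : Thue R u v) :
    Thue R (inv ι u) (inv ι v) := by
  have h₁ : Thue R (RapidKB.inv ι u ++ (v ++ RapidKB.inv ι v)) (RapidKB.inv ι u) := by
    simpa using (Thue.refl (RapidKB.inv ι u)).append (thue_append_inv h v)
  have h₂ : Thue R (RapidKB.inv ι u ++ u ++ RapidKB.inv ι v) (RapidKB.inv ι v) := by
    simpa using (thue_inv_append hι h u).append (Thue.refl (RapidKB.inv ι v))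
  have h₃ : Thue R (RapidKB.inv ι u ++ u ++ RapidKB.inv ι v)
      (RapidKB.inv ι u ++ v ++ RapidKB.inv ι v) := huv.context _ _
  rw [← List.append_assoc] at h₁
  exact (h₁.symm.trans _ _ _ h₃.symm).trans _ _ _ h₂

/-- The value of a string in a group. -/
def val {G : Type*} [Group G] (g : A → G) (w : List A) : G := (w.map g).prod

section val
variable {G : Type*} [Group G] (g : A → G)

@[simp] theorem val_nil : val g [] = 1 := by simp [val]
@[simp] theorem val_cons (a : A) (w : List A) : val g (a :: w) = g a * val g w := by simp [val]
@[simp] theorem val_append (u v : List A) : val g (u ++ v) = val g u * val g v := by simp [val]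

theorem val_inv {ι : A → A} (hg : ∀ x, g (ι x) = (g x)⁻¹) (w : List A) :
    val g (inv ι w) = (val g w)⁻¹ := by
  induction w with
  | nil => simp [inv]
  | cons a w ih =>
    have : inv ι (a :: w) = inv ι w ++ [ι a] := by simp [inv]
    simp [this, ih, hg]

theorem val_eq_of_reflTransGen {R : Set (Rule A)} (h : ∀ r ∈ R, val g r.1 = val g r.2)
    {u v : List A} (huv : Relation.ReflTransGen (Rewrites R) u v) : val g u = val g v := by
  induction huv with
  | refl => rfl
  | tail _ h' ih =>
    obtain ⟨x, y, r, hr, rfl, rfl⟩ := h'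
    simp [ih, h r hr]

end val

/-- A Thue congruence for which `ι x` is an inverse of `x` is the kernel of a map to a group. -/
theorem exists_group.{u} {A : Type u} {R : Set (Rule A)} {ι : A → A} (hι : Function.Involutive ι)
    (h : ∀ x, Thue R [x, ι x] []) :
    ∃ (G : Type u) (_ : Group G) (g : A → G), (∀ x, g (ι x) = (g x)⁻¹) ∧
      ∀ u v, val g u = val g v ↔ Thue R u v := by
  let s : Setoid (List A) := ⟨Thue R, Relation.EqvGen.is_equivalence _⟩
  let G := Quotient s
  let instMul : Mul G := ⟨Quotient.map₂ (· ++ ·) (fun _ _ h₁ _ _ h₂ => Thue.append h₁ h₂)⟩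
  let instOne : One G := ⟨Quotient.mk s []⟩
  let instInv : Inv G := ⟨Quotient.map (inv ι) (fun _ _ h₁ => Thue.inv hι h h₁)⟩
  let instGroup : Group G := Group.ofLeftAxioms
    (by
      rintro ⟨a⟩ ⟨b⟩ ⟨c⟩
      exact congrArg (Quotient.mk s) (List.append_assoc a b c))
    (by
      rintro ⟨a⟩
      exact congrArg (Quotient.mk s) (List.nil_append a))
    (by
      rintro ⟨a⟩
      exact Quotient.sound (thue_inv_append hι h a))
  have hval : ∀ w : List A, val (fun x => (Quotient.mk s [x] : G)) w = Quotient.mk s w := by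
    intro w
    induction w with
    | nil => rfl
    | cons a w ih => rw [val_cons, ih]; rfl
  refine ⟨G, instGroup, fun x => Quotient.mk s [x], fun x => rfl, fun u v => ?_⟩
  rw [hval, hval]
  exact Quotient.eq (r := s)

/-! ### Connections with bounded nodes -/

/-- `Conn P B a b`: the strings `a` and `b` are connected by elementary reductions by rules of
`P`, in either direction, each of which starts at a string satisfying `B`. -/
def Conn (P : Set (Rule A)) (B : List A → Prop) : List A → List A → Prop :=
  Relation.EqvGen (fun a b => Rewrites P a b ∧ B a)

theorem Conn.mono {P : Set (Rule A)} {B B' : List A → Prop} (h : ∀ a, B a → B' a) {a b : List A}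
    (hab : Conn P B a b) : Conn P B' a b :=
  Relation.EqvGen.mono (fun _ _ h' => ⟨h'.1, h _ h'.2⟩) _ _ hab

theorem Conn.thue {P : Set (Rule A)} {B : List A → Prop} {a b : List A} (h : Conn P B a b) :
    Thue P a b :=
  Relation.EqvGen.mono (fun _ _ h' => h'.1) _ _ h

theorem Conn.context {P : Set (Rule A)} {B B' : List A → Prop} {a b : List A} (x y : List A)
    (h : ∀ w, B w → B' (x ++ w ++ y)) (hab : Conn P B a b) :
    Conn P B' (x ++ a ++ y) (x ++ b ++ y) := by
  induction hab with
  | rel _ _ h' => exact .rel _ _ ⟨h'.1.context x y, h _ h'.2⟩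
  | refl => exact .refl _
  | symm _ _ _ ih => exact ih.symm
  | trans _ _ _ _ _ h₁ h₂ => exact h₁.trans _ _ _ h₂

theorem exists_join_of_thue {P : Set (Rule A)} (hP : Confluent P) {u v : List A}
    (h : Thue P u v) :
    ∃ z, Relation.ReflTransGen (Rewrites P) u z ∧ Relation.ReflTransGen (Rewrites P) v z := by
  induction h with
  | rel a b h => exact ⟨b, .single h, .refl⟩
  | refl a => exact ⟨a, .refl, .refl⟩
  | symm a b _ ih => obtain ⟨z, h₁, h₂⟩ := ih; exact ⟨z, h₂, h₁⟩
  | trans a b c _ _ ih₁ ih₂ =>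
    obtain ⟨z, hz, hz'⟩ := ih₁
    obtain ⟨y, hy, hy'⟩ := ih₂
    obtain ⟨d, hd, hd'⟩ := hP b z y hz' hy
    exact ⟨d, hz.trans hd, hy'.trans hd'⟩

variable [LinearOrder A]

/-- The rule `r` is a consequence of `P` without exceeding the left-hand side of `r`. -/
def Follows (P : Set (Rule A)) (r : Rule A) : Prop := Conn P (SLe · r.1) r.1 r.2

theorem Follows.conn {P : Set (Rule A)} {r : Rule A} (h : Follows P r) {B : List A → Prop}
    (x y : List A) (hB : ∀ w, SLe w (x ++ r.1 ++ y) → B w) :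
    Conn P B (x ++ r.1 ++ y) (x ++ r.2 ++ y) :=
  h.context (B' := B) x y fun _ hw => hB _ (hw.context x y)

/-- Each rule applied has its left-hand side inside the current string, and the strings only
decrease from `a`. So nothing need be known about rules with left-hand side above `m`; this is what
makes the inductions on left-hand sides work. -/
theorem conn_of_reflTransGen {P Q : Set (Rule A)} {m : List A} (hQ : Decreasing Q)
    (h : ∀ r ∈ Q, SLe r.1 m → Follows P r) {a b : List A}
    (hab : Relation.ReflTransGen (Rewrites Q) a b) (ha : SLe a m) {B : List A → Prop}
    (hB : ∀ w, SLe w a → B w) : Conn P B a b := by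
  induction hab with
  | refl => exact .refl _
  | tail h₁ h₂ ih =>
    refine ih.trans _ _ _ ?_
    have hle := sLe_of_reflTransGen hQ h₁
    obtain ⟨x, y, r, hr, rfl, rfl⟩ := h₂
    have hi : r.1 <:+: x ++ r.1 ++ y := ⟨x, y, rfl⟩
    exact (h r hr (((sLe_of_isInfix hi).trans hle).trans ha)).conn x y
      fun w hw => hB w (hw.trans hle)

/-- A decreasing system is confluent if the two ends of every peak are connected below the peak. -/
theorem confluent_of_peaks [Finite A] {P : Set (Rule A)} (hP : Decreasing P)
    (h : ∀ s a b, Rewrites P s a → Rewrites P s b → Conn P (SLt · s) a b) : Confluent P := by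
  intro s
  induction s using (sLt_wf A).induction with
  | _ s ih =>
  intro v w hv hw
  rcases hv.cases_head with rfl | ⟨a, hsa, hav⟩
  · exact ⟨w, hw, .refl⟩
  rcases hw.cases_head with rfl | ⟨b, hsb, hbw⟩
  · exact ⟨v, .refl, hv⟩
  -- The bound restricts only the source of each reduction, but targets are smaller still. So all
  -- nodes of a nontrivial connection lie below `s`, and the induction hypothesis at these nodes
  -- merges successive valleys.
  have key : ∀ a b, Conn P (SLt · s) a b → (a = b ∨ (SLt a s ∧ SLt b s)) ∧
      ∃ z, Relation.ReflTransGen (Rewrites P) a z ∧ Relation.ReflTransGen (Rewrites P) b z := by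
    intro a b hab
    induction hab with
    | rel a b h => exact ⟨Or.inr ⟨h.2, sLt_trans (h.1.sLt hP) h.2⟩, b, .single h.1, .refl⟩
    | refl a => exact ⟨Or.inl rfl, a, .refl, .refl⟩
    | symm a b _ ih =>
      obtain ⟨h₁, z, h₂, h₃⟩ := ih
      exact ⟨h₁.imp Eq.symm And.symm, z, h₃, h₂⟩
    | trans a b c _ _ ih₁ ih₂ =>
      obtain ⟨h₁, z, hz, hz'⟩ := ih₁
      obtain ⟨h₂, y, hy, hy'⟩ := ih₂
      rcases h₁ with rfl | h₁
      · exact ⟨h₂, y, hy, hy'⟩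
      rcases h₂ with rfl | h₂
      · exact ⟨Or.inr h₁, z, hz, hz'⟩
      obtain ⟨d, hd, hd'⟩ := ih b h₁.2 z y hz' hy
      exact ⟨Or.inr ⟨h₁.1, h₂.2⟩, d, hz.trans hd, hy'.trans hd'⟩
  obtain ⟨-, c, hac, hbc⟩ := key a b (h s a b hsa hsb)
  obtain ⟨d, hvd, hcd⟩ := ih a (hsa.sLt hP) v c hav hac
  obtain ⟨e, hde, hwe⟩ := ih b (hsb.sLt hP) d w (hbc.trans hcd) hbw
  exact ⟨e, hvd.trans hde, hwe⟩

/-- If the rules of `P` have irreducible proper substrings of left-hand sides and every critical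
pair is connected below its overlap, then the two ends of every peak are connected below it. -/
theorem conn_of_peak {P : Set (Rule A)} (hP : Decreasing P)
    (hmin : ∀ r ∈ P, ProperIrr P r.1)
    (hcrit : ∀ r₁ ∈ P, ∀ r₂ ∈ P, ∀ s₁ z s₂, z ≠ [] → r₁.1 = s₁ ++ z → r₂.1 = z ++ s₂ →
      Conn P (SLt · (s₁ ++ z ++ s₂)) (r₁.2 ++ s₂) (s₁ ++ r₂.2))
    (s a b : List A) (ha : Rewrites P s a) (hb : Rewrites P s b) : Conn P (SLt · s) a b := by
  -- By symmetry the occurrence of `r₁.1` may be taken to start no later than that of `r₂.1`; `e` is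
  -- the offset.
  have main : ∀ (x₁ e y₁ y₂ : List A), ∀ r₁ ∈ P, ∀ r₂ ∈ P, r₁.1 ++ y₁ = e ++ r₂.1 ++ y₂ →
      Conn P (SLt · (x₁ ++ r₁.1 ++ y₁)) (x₁ ++ r₁.2 ++ y₁) (x₁ ++ e ++ r₂.2 ++ y₂) := by
    intro x₁ e y₁ y₂ r₁ h₁ r₂ h₂ heq
    rw [List.append_assoc, List.append_eq_append_iff] at heq
    rcases heq with ⟨e', rfl, rfl⟩ | ⟨z, hz, hz'⟩
    · have lt₁ : SLt (x₁ ++ r₁.2 ++ (e' ++ (r₂.1 ++ y₂))) (x₁ ++ r₁.1 ++ (e' ++ (r₂.1 ++ y₂))) :=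
        (hP r₁ h₁).context _ _
      have lt₂ : SLt (x₁ ++ (r₁.1 ++ e') ++ r₂.2 ++ y₂) (x₁ ++ r₁.1 ++ (e' ++ (r₂.1 ++ y₂))) := by
        have := (hP r₂ h₂).context (x₁ ++ r₁.1 ++ e') y₂
        simpa only [List.append_assoc] using this
      refine Relation.EqvGen.trans _ (x₁ ++ r₁.2 ++ e' ++ r₂.2 ++ y₂) _
        (.rel _ _ ⟨⟨x₁ ++ r₁.2 ++ e', y₂, r₂, h₂, by simp, by simp⟩, lt₁⟩)
        (Relation.EqvGen.symm _ _ (.rel _ _ ⟨⟨x₁, e' ++ r₂.2 ++ y₂, r₁, h₁, by simp, by simp⟩, lt₂⟩))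
    · have overlap : ∀ s₂, r₂.1 = z ++ s₂ → y₁ = s₂ ++ y₂ → z ≠ [] →
          Conn P (SLt · (x₁ ++ r₁.1 ++ y₁)) (x₁ ++ r₁.2 ++ y₁) (x₁ ++ e ++ r₂.2 ++ y₂) := by
        intro s₂ hs₂ hy hne
        have := (hcrit r₁ h₁ r₂ h₂ e z s₂ hne hz hs₂).context
          (B' := (SLt · (x₁ ++ r₁.1 ++ y₁))) x₁ y₂ (fun w hw => by
            have := hw.context x₁ y₂
            rw [hy, hz]
            simpa only [List.append_assoc] using this)
        rw [hy]
        rw [hy] at this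
        simpa only [List.append_assoc] using this
      rw [List.append_eq_append_iff] at hz'
      rcases hz' with ⟨k, hk, hk'⟩ | ⟨k, hk, hk'⟩
      -- Nested occurrences: minimality forces the left-hand sides to coincide, which is the overlap
      -- with `s₁ = s₂ = []`.
      · have hinf : r₂.1 <:+: r₁.1 := ⟨e, k, by rw [hz, hk]; simp⟩
        by_cases hne : r₂.1 = r₁.1
        · have : e = [] ∧ k = [] := by
            have := congrArg List.length hne
            rw [hz, hk] at this
            simp at this
            constructor <;> apply List.eq_nil_of_length_eq_zero <;> omega
          obtain ⟨rfl, rfl⟩ := this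
          refine overlap [] (by simp [hk]) (by simpa using hk'.symm) ?_
          rintro rfl
          rw [List.nil_append] at hz
          have := hP r₁ h₁
          rw [hz] at this
          exact not_sLt_nil _ this
        · exact absurd (rewrites_of_mem h₂) (hmin r₁ h₁ _ hinf hne _)
      · by_cases hne : z = []
        · subst hne
          refine main_disjoint hP h₁ h₂ x₁ e y₁ y₂ (by simpa using hz) ?_
          simpa [hk] using hk'
        · exact overlap k hk hk' hne
  obtain ⟨x₁, y₁, r₁, h₁, rfl, rfl⟩ := ha
  obtain ⟨x₂, y₂, r₂, h₂, heq, rfl⟩ := hb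
  rw [List.append_assoc, List.append_assoc, List.append_eq_append_iff] at heq
  rcases heq with ⟨e, rfl, he⟩ | ⟨e, rfl, he⟩
  · have := main x₁ e y₁ y₂ r₁ h₁ r₂ h₂ (by simpa using he)
    simpa only [List.append_assoc] using this
  · have := main x₂ e y₂ y₁ r₂ h₂ r₁ h₁ (by simpa using he)
    rw [List.append_assoc x₂, he] at this
    have h := this.symm
    simp only [List.append_assoc] at h ⊢
    exact h
where
  main_disjoint {P : Set (Rule A)} (hP : Decreasing P) {r₁ r₂ : Rule A} (h₁ : r₁ ∈ P)
    (h₂ : r₂ ∈ P) (x₁ e y₁ y₂ : List A) (he : r₁.1 = e) (hy : y₁ = r₂.1 ++ y₂) :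
      Conn P (SLt · (x₁ ++ r₁.1 ++ y₁)) (x₁ ++ r₁.2 ++ y₁) (x₁ ++ e ++ r₂.2 ++ y₂) := by
    subst he hy
    have lt₁ := (hP r₁ h₁).context x₁ (r₂.1 ++ y₂)
    have lt₂ := (hP r₂ h₂).context (x₁ ++ r₁.1) y₂
    simp only [List.append_assoc] at lt₁ lt₂ ⊢
    exact Relation.EqvGen.trans _ (x₁ ++ r₁.2 ++ r₂.2 ++ y₂) _
      (.rel _ _ ⟨⟨x₁ ++ r₁.2, y₂, r₂, h₂, by simp, by simp⟩, lt₁⟩)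
      (Relation.EqvGen.symm _ _ (.rel _ _ ⟨⟨x₁, r₂.2 ++ y₂, r₁, h₁, by simp, by simp⟩, lt₂⟩))

end Rewriting

/-! ### Paths in two-variable automata -/

section Paths

variable {A : Type*}

theorem trail_append (s : List A) (p q : List (Letter A × List A)) :
    trail s (p ++ q) = trail s p ++ trail (endpt s p) q := by
  induction p generalizing s with
  | nil => rfl
  | cons c p ih => simp [trail, endpt, ih]

theorem endpt_append (s : List A) (p q : List (Letter A × List A)) :
    endpt s (p ++ q) = endpt (endpt s p) q := by
  induction p generalizing s with
  | nil => rfl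
  | cons c p ih => simp [endpt, ih]

/-- Rename the two ends of an arrow. -/
def mapArrow (f : List A → List A) (a : Arrow A) : Arrow A := (f a.1, a.2.1, f a.2.2)

/-- Rename the states of a path. -/
def mapPath (f : List A → List A) (p : List (Letter A × List A)) : List (Letter A × List A) :=
  p.map fun c => (c.1, f c.2)

theorem trail_mapPath (f : List A → List A) (s : List A) (p : List (Letter A × List A)) :
    trail (f s) (mapPath f p) = (trail s p).map (mapArrow f) := by
  induction p generalizing s with
  | nil => rfl
  | cons c p ih => simp only [mapPath, List.map_cons, trail] at ih ⊢; rw [ih]; rfl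

theorem endpt_mapPath (f : List A → List A) (s : List A) (p : List (Letter A × List A)) :
    endpt (f s) (mapPath f p) = f (endpt s p) := by
  induction p generalizing s with
  | nil => rfl
  | cons c p ih => simp only [mapPath, List.map_cons, endpt] at ih ⊢; rw [ih]

theorem map_fst_mapPath (f : List A → List A) (p : List (Letter A × List A)) :
    (mapPath f p).map Prod.fst = p.map Prod.fst := by
  simp [mapPath]

theorem map_fst_pad (u v : List A) : (pad u v).map Prod.fst = u := by
  induction u generalizing v with
  | nil => simp [pad]
  | cons a u ih => cases v <;> simp [pad, ih]

theorem flatMap_snd_pad {u v : List A} (h : v.length ≤ u.length) :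
    (pad u v).flatMap (fun x => x.2.toList) = v := by
  induction u generalizing v with
  | nil => simpa [pad] using h
  | cons a u ih =>
    cases v with
    | nil => simpa [pad] using ih (v := []) (by simp)
    | cons b v => simpa [pad] using ih (v := v) (by simpa using h)

/-! ### Weak acceptance -/

/-- An arrow of `E`, or an arrow labelled `(x, x)` at the initial state. -/
def WArrow (E : Finset (Arrow A)) (a : Arrow A) : Prop :=
  a ∈ E ∨ ∃ x, a = ([], (x, some x), [])

/-- The pair `r` is read by a closed path at the initial state, if the arrows labelled `(x, x)`
at the initial state are added to the automaton. -/
def WRead (E : Finset (Arrow A)) (r : Rule A) : Prop :=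
  ∃ p : List (Letter A × List A), p.map Prod.fst = pad r.1 r.2 ∧
    (∀ a ∈ trail [] p, WArrow E a) ∧ endpt [] p = []

/-- There is no arrow labelled `(x, x)` at the initial state. -/
def NoDiag (E : Finset (Arrow A)) : Prop :=
  ∀ a ∈ E, ¬ (a.2.1.2 = some a.2.1.1 ∧ (a.1 = [] ∨ a.2.2 = []))

theorem NoDiag.subset {E E' : Finset (Arrow A)} (h : NoDiag E') (hE : E ⊆ E') : NoDiag E :=
  fun a ha => h a (hE ha)

theorem WRead.subset {E E' : Finset (Arrow A)} (h : E ⊆ E') {r : Rule A} (hr : WRead E r) :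
    WRead E' r := by
  obtain ⟨p, h₁, h₂, h₃⟩ := hr
  exact ⟨p, h₁, fun a ha => (h₂ a ha).imp_left fun h' => h h', h₃⟩

/-- Cut the path after its last added loop. Padded letters are never of the form `(x, x)`, so the
cut comes before the padding and the difference of lengths, which `SL2` bounds, is unchanged. -/
theorem exists_suffix_path {E : Finset (Arrow A)} (p : List (Letter A × List A)) :
    ∀ (s u v : List A), p.map Prod.fst = pad u v → (∀ a ∈ trail s p, WArrow E a) →
      endpt s p = [] → v.length < u.length →
      (∀ a ∈ trail s p, a ∈ E) ∨ ∃ u₂ v₂ p₂, u₂ <:+: u ∧ v₂.length < u₂.length ∧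
        u₂.length + v.length = u.length + v₂.length ∧ p₂.map Prod.fst = pad u₂ v₂ ∧
        (∀ a ∈ trail [] p₂, a ∈ E) ∧ endpt [] p₂ = [] := by
  induction p with
  | nil => intro s u v _ _ _ _; left; simp [trail]
  | cons c p ih =>
    obtain ⟨x, t⟩ := c
    intro s u v hp hw he hl
    cases u with
    | nil => simp at hl
    | cons a u =>
    simp only [trail, endpt, List.map_cons, List.mem_cons, forall_eq_or_imp] at hp hw he ⊢
    obtain ⟨hw₁, hw₂⟩ := hw
    cases v with
    | nil =>
      simp only [pad, List.cons.injEq] at hp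
      have hpe : ∀ a ∈ trail t p, a ∈ E := by
        have key : ∀ (p : List (Letter A × List A)) (t u : List A),
            p.map Prod.fst = pad u [] → (∀ a ∈ trail t p, WArrow E a) → ∀ a ∈ trail t p, a ∈ E := by
          intro p
          induction p with
          | nil => simp [trail]
          | cons c p ih' =>
            intro t u hp hw
            cases u with
            | nil => simp [pad] at hp
            | cons a u =>
            obtain ⟨x, t'⟩ := c
            simp only [trail, List.map_cons, List.mem_cons, forall_eq_or_imp, pad,
              List.cons.injEq] at hp hw ⊢
            refine ⟨hw.1.resolve_right ?_, ih' _ u hp.2 hw.2⟩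
            rintro ⟨y, hy⟩
            simp only [Prod.mk.injEq] at hy
            rw [hp.1] at hy
            simp at hy
        exact key p t u hp.2 hw₂
      refine Or.inl ⟨hw₁.resolve_right ?_, hpe⟩
      rintro ⟨y, hy⟩
      simp only [Prod.mk.injEq] at hy
      rw [hp.1] at hy
      simp at hy
    | cons b v =>
      simp only [pad, List.cons.injEq] at hp
      have hl' : v.length < u.length := by simpa using hl
      rcases ih t u v hp.2 hw₂ he hl' with h | ⟨u₂, v₂, p₂, h₁, h₂, h₃, h₄⟩
      · rcases hw₁ with hw₁ | ⟨y, hy⟩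
        · exact Or.inl ⟨hw₁, h⟩
        · simp only [Prod.mk.injEq] at hy
          obtain ⟨rfl, hx, rfl⟩ := hy
          refine Or.inr ⟨u, v, p, List.infix_cons (List.infix_refl u), hl', by simp; omega,
            hp.2, h, he⟩
      · exact Or.inr ⟨u₂, v₂, p₂, List.infix_cons h₁, h₂, by simp; omega, h₄⟩

/-- Cut the path before its first added loop. Such a loop starts at the initial state, so the part
before it already ends there. -/
theorem exists_prefix_path {E : Finset (Arrow A)} (p : List (Letter A × List A)) :
    ∀ (s u v : List A), p.map Prod.fst = pad u v → (∀ a ∈ trail s p, WArrow E a) →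
      endpt s p = [] → u.length = v.length →
      ∃ u₁ v₁ p₁, u₁ <+: u ∧ v₁ <+: v ∧ u₁.length = v₁.length ∧ p₁.map Prod.fst = pad u₁ v₁ ∧
        (∀ a ∈ trail s p₁, a ∈ E) ∧ endpt s p₁ = [] := by
  induction p with
  | nil =>
    intro s u v _ _ he _
    exact ⟨[], [], [], by simp, by simp, rfl, rfl, by simp [trail], he⟩
  | cons c p ih =>
    obtain ⟨x, t⟩ := c
    intro s u v hp hw he hl
    cases u with
    | nil => simp [pad] at hp
    | cons a u =>
    cases v with
    | nil => simp at hl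
    | cons b v =>
    simp only [trail, endpt, List.map_cons, List.mem_cons, forall_eq_or_imp, pad,
      List.cons.injEq] at hp hw he ⊢
    rcases hw.1 with h | ⟨y, hy⟩
    · obtain ⟨u₁, v₁, p₁, h₁, h₂, h₃, h₄, h₅, h₆⟩ := ih t u v hp.2 hw.2 he (by simpa using hl)
      refine ⟨a :: u₁, b :: v₁, (x, t) :: p₁, ?_, ?_, by simp [h₃], ?_, ?_, h₆⟩
      · exact (List.prefix_cons_inj a).2 h₁
      · exact (List.prefix_cons_inj b).2 h₂
      · simp [pad, h₄, hp.1]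
      · intro e he'
        rcases List.mem_cons.1 he' with rfl | he'
        · exact h
        · exact h₅ e he'
    · simp only [Prod.mk.injEq] at hy
      exact ⟨[], [], [], by simp, by simp, rfl, rfl, by simp [trail], hy.1⟩

variable [LinearOrder A]

/-- Two strings that are weakly accepted and comparable in length are reduced by an accepted
rule. -/
theorem WRead.not_isIrred {E : Finset (Arrow A)} (hE : NoDiag E) {r : Rule A} (hr : WRead E r)
    (hlt : SLt r.2 r.1) (hlen : r.1.length ≤ r.2.length + 2) : ¬ IsIrred (ruleSet E) r.1 := by
  obtain ⟨p, hp, hw, he⟩ := hr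
  obtain ⟨u, v⟩ := r
  simp only at hp hlt hlen ⊢
  rw [not_isIrred_iff]
  -- No arrow `(x, x)` of `E` leaves the initial state, so every path in `E` from there satisfies
  -- the first condition of `SL2`.
  have first : ∀ (p : List (Letter A × List A)) (u v : List A), p.map Prod.fst = pad u v →
      (∀ a ∈ trail [] p, a ∈ E) → ∀ x u' v', ¬ (u = x :: u' ∧ v = x :: v') := by
    rintro p u v hp hin x u' v' ⟨rfl, rfl⟩
    cases p with
    | nil => simp [pad] at hp
    | cons c p =>
      simp only [trail, List.map_cons, List.mem_cons, forall_eq_or_imp, pad,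
        List.cons.injEq] at hp hin
      exact hE _ hin.1 ⟨by simp [hp.1], Or.inl rfl⟩
  rcases hlt.length_le.lt_or_eq with hl | hl
  · rcases exists_suffix_path p [] u v hp hw he hl with h | ⟨u₂, v₂, p₂, h₁, h₂, h₃, h₄, h₅, h₆⟩
    · exact ⟨(u, v), ⟨⟨first p u v hp h, hlt, hl.le, hlen⟩, p, hp, h, he⟩, List.infix_refl u⟩
    · exact ⟨(u₂, v₂), ⟨⟨first p₂ u₂ v₂ h₄ h₅, sLt_of_length_lt h₂, h₂.le, by
        simp only; omega⟩, p₂, h₄, h₅, h₆⟩, h₁⟩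
  -- Equal lengths: skip the added loops at the start and stop before the next one. The first
  -- letters of the remaining piece differ, so they alone decide the comparison and the piece is
  -- decreasing however it is cut off.
  · clear hlen
    induction p generalizing u v with
    | nil =>
      cases u with
      | nil => exact absurd hlt (not_sLt_nil _)
      | cons a u => cases v <;> simp [pad] at hp
    | cons c p ih =>
    obtain ⟨x, t⟩ := c
    cases u with
    | nil => simp [pad] at hp
    | cons a u =>
    cases v with
    | nil => simp at hl
    | cons b v =>
    simp only [trail, endpt, List.map_cons, List.mem_cons, forall_eq_or_imp, pad,
      List.cons.injEq] at hp hw he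
    have hl' : v.length = u.length := by simpa using hl
    rcases hw.1 with h | ⟨y, hy⟩
    · obtain ⟨u₁, v₁, p₁, h₁, h₂, h₃, h₄, h₅, h₆⟩ := exists_prefix_path p t u v hp.2 hw.2 he hl'.symm
      have hpath : ((x, t) :: p₁).map Prod.fst = pad (a :: u₁) (b :: v₁) := by simp [pad, h₄, hp.1]
      have hin : ∀ e ∈ trail [] ((x, t) :: p₁), e ∈ E := by
        intro e he'
        rcases List.mem_cons.1 he' with rfl | he'
        · exact h
        · exact h₅ e he'
      have hne := first _ _ _ hpath hin
      have hba : b < a := (hlt.cons_of_same_length hl').resolve_right fun hab =>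
        hne a u₁ v₁ ⟨rfl, by rw [hab.1]⟩
      exact ⟨(a :: u₁, b :: v₁), ⟨⟨hne, sLt_cons_cons h₃.symm hba, by simp [h₃], by simp [h₃]⟩,
        (x, t) :: p₁, hpath, hin, h₆⟩, ((List.prefix_cons_inj a).2 h₁).isInfix⟩
    · simp only [Prod.mk.injEq] at hy
      obtain ⟨-, rfl, rfl⟩ := hy
      have hab : a = b := by
        have := hp.1
        simp only [Prod.mk.injEq, Option.some.injEq] at this
        exact this.1.symm.trans this.2
      subst hab
      obtain ⟨r, hr, hi⟩ := ih hw.2 he u v (sLt_cons_iff.1 hlt) hp.2 hl'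
      exact ⟨r, hr, List.infix_cons hi⟩

end Paths

/-! ### Labels and their values in a group -/

section Values

variable {A : Type*} {G : Type*} [Group G] (g : A → G)

/-- The labels of the ends of an arrow are related by the letter of the arrow. -/
def ValArrow (a : Arrow A) : Prop :=
  val g a.2.2 = (g a.2.1.1)⁻¹ * val g a.1 * val g a.2.1.2.toList

/-- The arrow relations telescope to `u⁻¹ s v`, padding contributing nothing. A closed path at the
initial state therefore proves `u = v` in the group. -/
theorem val_endpt {s : List A} {p : List (Letter A × List A)} (h : ∀ a ∈ trail s p, ValArrow g a) :
    val g (endpt s p) = (val g ((p.map Prod.fst).map Prod.fst))⁻¹ * val g s *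
      val g ((p.map Prod.fst).flatMap (fun x => x.2.toList)) := by
  induction p generalizing s with
  | nil => simp [endpt]
  | cons c p ih =>
    obtain ⟨x, t⟩ := c
    simp only [trail, List.mem_cons, forall_eq_or_imp] at h
    have h₁ := h.1
    simp only [ValArrow] at h₁
    simp only [endpt, ih h.2, h₁, List.map_cons, val_cons, List.flatMap_cons, val_append]
    group

theorem val_eq_of_mem_ruleSet [LinearOrder A] {E : Finset (Arrow A)} (h : ∀ a ∈ E, ValArrow g a)
    {r : Rule A} (hr : r ∈ ruleSet E) : val g r.1 = val g r.2 := by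
  obtain ⟨⟨_, _, hl, _⟩, p, hp, hin, he⟩ := hr
  have := val_endpt g (fun a ha => h a (hin a ha))
  rw [he, hp, map_fst_pad, flatMap_snd_pad hl, val_nil, mul_one] at this
  exact (inv_mul_eq_one.1 this.symm)

theorem decreasing_ruleSet [LinearOrder A] (E : Finset (Arrow A)) : Decreasing (ruleSet E) :=
  fun _ hr => hr.1.2.1

/-- Forward and backward determinism amount to cancellation in the group. An arrow `(x, x)`
conjugates its source by `x`, and only the identity is conjugate to the identity. -/
theorem val_eq_of_weldEq {E : Finset (Arrow A)} {J : List A → List A → Prop}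
    (h : ∀ a ∈ E, ValArrow g a) (hJ : ∀ s t, J s t → val g s = val g t) {s t : List A}
    (hst : WeldEq E J s t) : val g s = val g t := by
  induction hst with
  | join h => exact hJ _ _ h
  | refl => rfl
  | symm _ ih => exact ih.symm
  | trans _ _ h₁ h₂ => exact h₁.trans h₂
  | fwd h₁ h₂ _ ih =>
    have e₁ := h _ h₁
    have e₂ := h _ h₂
    simp only [ValArrow] at e₁ e₂
    rw [e₁, e₂, ih]
  | bwd h₁ h₂ _ ih =>
    have e₁ := h _ h₁
    have e₂ := h _ h₂
    simp only [ValArrow] at e₁ e₂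
    rw [e₁, e₂] at ih
    exact mul_left_cancel (mul_right_cancel ih)
  | diag_src h₁ _ ih =>
    have e₁ := h _ h₁
    simp only [ValArrow] at e₁
    rw [e₁, ih]
    simp
  | diag_tgt h₁ _ ih =>
    have e₁ := h _ h₁
    simp only [ValArrow] at e₁
    rw [ih] at e₁
    simp only [val_nil, Option.toList_some, val_cons, mul_one] at e₁ ⊢
    have e₂ := e₁.symm
    rw [mul_assoc, inv_mul_eq_one] at e₂
    exact right_eq_mul.1 e₂

end Values

/-! ### Welding -/

section Welding

variable {A : Type*}

theorem WRead.map {f : List A → List A} (hf : f [] = []) {E E' : Finset (Arrow A)}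
    (h : ∀ a, WArrow E a → WArrow E' (mapArrow f a)) {r : Rule A} (hr : WRead E r) :
    WRead E' r := by
  obtain ⟨p, hp, hw, he⟩ := hr
  refine ⟨mapPath f p, by rw [map_fst_mapPath, hp], ?_, ?_⟩
  · have := trail_mapPath f [] p
    rw [hf] at this
    rw [this]
    intro a ha
    obtain ⟨b, hb, rfl⟩ := List.mem_map.1 ha
    exact h b (hw b hb)
  · have := endpt_mapPath f [] p
    rw [hf, he, hf] at this
    exact this

variable [LinearOrder A]

theorem noDiag_dropLoops (E : Finset (Arrow A)) : NoDiag (dropLoops E) := by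
  intro a ha
  exact (Finset.mem_filter.1 ha).2

theorem mem_renameArrows {f : List A → List A} {E : Finset (Arrow A)} {a : Arrow A} :
    a ∈ renameArrows f E ↔ ∃ b ∈ E, mapArrow f b = a := by
  simp only [renameArrows, Finset.mem_image, mapArrow]

theorem renameArrows_subset {f : List A → List A} {E E' : Finset (Arrow A)} (h : E ⊆ E') :
    renameArrows f E ⊆ renameArrows f E' := Finset.image_subset_image h

theorem dropLoops_subset {E E' : Finset (Arrow A)} (h : E ⊆ E') :
    dropLoops E ⊆ dropLoops E' := Finset.filter_subset_filter _ h

theorem wArrow_mapArrow_rename {f : List A → List A} (hf : f [] = []) {E : Finset (Arrow A)}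
    {a : Arrow A} (ha : WArrow E a) : WArrow (renameArrows f E) (mapArrow f a) := by
  rcases ha with ha | ⟨x, rfl⟩
  · exact Or.inl (mem_renameArrows.2 ⟨a, ha, rfl⟩)
  · exact Or.inr ⟨x, by simp [mapArrow, hf]⟩

theorem valArrow_rename {G : Type*} [Group G] (g : A → G) {f : List A → List A}
    {E : Finset (Arrow A)} (h : ∀ a ∈ E, ValArrow g a)
    (hf : ∀ a ∈ E, val g (f a.1) = val g a.1 ∧ val g (f a.2.2) = val g a.2.2) :
    ∀ a ∈ renameArrows f E, ValArrow g a := by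
  intro a ha
  obtain ⟨b, hb, rfl⟩ := mem_renameArrows.1 ha
  have := h b hb
  simp only [ValArrow, mapArrow] at *
  rw [(hf b hb).1, (hf b hb).2, this]

theorem valArrow_of_created {G : Type*} [Group G] (g : A → G) {ι : A → A}
    (hg : ∀ x, g (ι x) = (g x)⁻¹) {T : Set (Rule A)} {S : Store A}
    (hred : ∀ w S' t, RReduce T S w S' t → val g w = val g t) {s : List A}
    {p : List (Letter A × List A)} (h : Created ι T S s p) :
    ∀ a ∈ trail s p, ValArrow g a := by
  induction h with
  | nil => simp [trail]
  | cons h _ ih =>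
    simp only [trail, List.mem_cons, forall_eq_or_imp]
    refine ⟨?_, ih⟩
    have := hred _ _ _ h
    simp only [ValArrow]
    rw [← this]
    simp [hg, mul_assoc]

variable [Finite A]

theorem weldEq_weldRep (E : Finset (Arrow A)) (J : List A → List A → Prop) (s : List A) :
    WeldEq E J s (weldRep E J s) :=
  (sLt_wf A).min_mem {t | WeldEq E J s t} _

theorem weldRep_eq {E : Finset (Arrow A)} {J : List A → List A → Prop} {s t : List A}
    (h : WeldEq E J s t) : weldRep E J s = weldRep E J t := by
  have : {u | WeldEq E J s u} = {u | WeldEq E J t u} := by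
    ext u
    exact ⟨fun h' => h.symm.trans h', fun h' => h.trans h'⟩
  simp only [weldRep, this]

/-- The empty string is shortlex least, so the initial state keeps its label under every
identification. -/
theorem weldRep_nil (E : Finset (Arrow A)) (J : List A → List A → Prop) :
    weldRep E J [] = [] := by
  have h := (sLt_wf A).not_lt_min {t | WeldEq E J [] t} (WeldEq.refl [])
  exact (List.shortlex_nil_or_eq_nil (r := (· < ·)) _).resolve_left h

theorem weldRep_eq_nil {E : Finset (Arrow A)} {J : List A → List A → Prop} {s : List A}
    (h : weldRep E J s = []) : WeldEq E J s [] := by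
  have := weldEq_weldRep E J s
  rwa [h] at this

/-- An arrow is dropped only if it is labelled `(x, x)` and meets the initial state. The diagonal
identifications then send both its ends to the initial state, so it has become a loop which weak
reading allows. Applied to the needed arrows as `N`. -/
theorem wArrow_weld {M : WDiff A} {J : List A → List A → Prop} {N : Finset (Arrow A)}
    (hN : N ⊆ M.arrows) {a : Arrow A} (ha : WArrow N a) :
    WArrow (dropLoops (renameArrows (weldRep M.arrows J) N))
      (mapArrow (weldRep M.arrows J) a) := by
  rcases ha with ha | ⟨x, rfl⟩
  · by_cases hd : a.2.1.2 = some a.2.1.1 ∧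
        (weldRep M.arrows J a.1 = [] ∨ weldRep M.arrows J a.2.2 = [])
    · obtain ⟨s, ⟨x, y⟩, t⟩ := a
      simp only at hd
      obtain ⟨rfl, hd⟩ := hd
      have hm := hN ha
      have hs : weldRep M.arrows J s = [] ∧ weldRep M.arrows J t = [] := by
        rcases hd with hd | hd
        · exact ⟨hd, by rw [weldRep_eq (.diag_src hm (weldRep_eq_nil hd)), weldRep_nil]⟩
        · exact ⟨by rw [weldRep_eq (.diag_tgt hm (weldRep_eq_nil hd)), weldRep_nil], hd⟩
      exact Or.inr ⟨x, by simp [mapArrow, hs]⟩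
    · left
      rw [dropLoops, Finset.mem_filter]
      exact ⟨mem_renameArrows.2 ⟨a, ha, rfl⟩, hd⟩
  · exact Or.inr ⟨x, by simp [mapArrow, weldRep_nil]⟩

theorem WRead.weld {M : WDiff A} (hM : M.needed ⊆ M.arrows) (J : List A → List A → Prop)
    {r : Rule A} (hr : WRead M.needed r) : WRead (weld M J).needed r :=
  hr.map (weldRep_nil M.arrows J) fun _ ha => wArrow_weld hM ha

theorem valArrow_weld {G : Type*} [Group G] (g : A → G) {M : WDiff A}
    {J : List A → List A → Prop} (h : ∀ a ∈ M.arrows, ValArrow g a)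
    (hJ : ∀ s t, J s t → val g s = val g t) : ∀ a ∈ (weld M J).arrows, ValArrow g a := by
  intro a ha
  refine valArrow_rename g h (fun a ha => ?_) a (Finset.mem_filter.1 ha).1
  exact ⟨(val_eq_of_weldEq g h hJ (weldEq_weldRep _ _ _)).symm,
    (val_eq_of_weldEq g h hJ (weldEq_weldRep _ _ _)).symm⟩

/-- The properties of `WDiff` that are preserved by the procedure. -/
structure GoodAut {G : Type*} [Group G] (g : A → G) (M : WDiff A) : Prop where
  sub : M.needed ⊆ M.arrows
  noDiag : NoDiag M.arrows
  val : ∀ a ∈ M.arrows, ValArrow g a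

theorem goodAut_weld {G : Type*} [Group G] (g : A → G) {M : WDiff A}
    {J : List A → List A → Prop} (hs : M.needed ⊆ M.arrows) (h : ∀ a ∈ M.arrows, ValArrow g a)
    (hJ : ∀ s t, J s t → RapidKB.val g s = RapidKB.val g t) : GoodAut g (weld M J) :=
  ⟨dropLoops_subset (renameArrows_subset hs), noDiag_dropLoops _, valArrow_weld g h hJ⟩

/-- Split the rule as `(u₁ u₂, v₁ v₂)` at the join. The forward path ends at a state of value `u₁⁻¹
v₁`, the backward path starts at one of value `u₂ v₂⁻¹`, and these agree because the rule holds in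
the group. So the join identifies equal values only. -/
theorem sew_spec {G : Type*} [Group G] (g : A → G) {ι : A → A}
    (hg : ∀ x, g (ι x) = (g x)⁻¹) {T : Set (Rule A)} {S : Store A}
    (hred : ∀ w S' t, RReduce T S w S' t → val g w = val g t) {M M' : WDiff A} {r : Rule A}
    (hM : GoodAut g M) (hr : val g r.1 = val g r.2) (hl : r.2.length ≤ r.1.length)
    (h : Sew ι T S M r M') :
    GoodAut g M' ∧ WRead M'.needed r ∧ ∀ r', WRead M.needed r' → WRead M'.needed r' := by
  obtain ⟨p, b, q, t, hpad, hp, -, hq, hqe, -, hb, rfl⟩ := h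
  have hbv := valArrow_of_created g hg hred hb
  have hsub : M.needed ∪ (trail [] p ++ trail (endpt [] p) b ++ trail t q).toFinset ⊆
      M.arrows ∪ (trail (endpt [] p) b).toFinset := by
    intro a ha
    simp only [Finset.mem_union, List.mem_toFinset, List.mem_append] at ha ⊢
    rcases ha with ha | (ha | ha) | ha
    · exact Or.inl (hM.sub ha)
    · exact Or.inl (hp a ha)
    · exact Or.inr ha
    · exact Or.inl (hq a ha)
  have hval : ∀ a ∈ M.arrows ∪ (trail (endpt [] p) b).toFinset, ValArrow g a := by
    intro a ha
    simp only [Finset.mem_union, List.mem_toFinset] at ha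
    rcases ha with ha | ha
    · exact hM.val a ha
    · exact hbv a ha
  have hJ : val g (endpt (endpt [] p) b) = val g t := by
    have h₁ := val_endpt g (s := []) (p := p ++ b) (by
      rw [trail_append]
      intro a ha
      rcases List.mem_append.1 ha with ha | ha
      · exact hM.val a (hp a ha)
      · exact hbv a ha)
    have h₂ := val_endpt g (s := t) (p := q) (fun a ha => hM.val a (hq a ha))
    rw [endpt_append] at h₁
    rw [hqe] at h₂
    have e₁ : val g r.1 = val g (((p ++ b ++ q).map Prod.fst).map Prod.fst) := by
      rw [hpad, map_fst_pad]
    have e₂ : val g r.2 = val g (((p ++ b ++ q).map Prod.fst).flatMap (fun x => x.2.toList)) := by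
      rw [hpad, flatMap_snd_pad hl]
    rw [e₁, e₂, List.map_append (l₂ := q), List.map_append, List.flatMap_append, val_append,
      val_append] at hr
    rw [h₁, val_nil, mul_one]
    generalize val g (((p ++ b).map Prod.fst).map Prod.fst) = a₁ at *
    generalize val g (((p ++ b).map Prod.fst).flatMap (fun x => x.2.toList)) = a₂ at *
    generalize val g ((q.map Prod.fst).map Prod.fst) = b₁ at *
    generalize val g ((q.map Prod.fst).flatMap (fun x => x.2.toList)) = b₂ at *
    rw [val_nil] at h₂
    have h₃ : val g t = b₁ * b₂⁻¹ := by
      have : val g t = b₁ * (b₁⁻¹ * val g t * b₂) * b₂⁻¹ := by group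
      rw [this, ← h₂]; simp
    rw [h₃, inv_mul_eq_iff_eq_mul, ← mul_assoc, hr]
    simp
  refine ⟨goodAut_weld g hsub hval ?_, ?_, ?_⟩
  · rintro s s' ⟨rfl, rfl⟩
    exact hJ
  · set N := M.needed ∪ (trail [] p ++ trail (endpt [] p) b ++ trail t q).toFinset with hN
    set E := M.arrows ∪ (trail (endpt [] p) b).toFinset with hE
    set J : List A → List A → Prop := fun s s' => s = endpt (endpt [] p) b ∧ s' = t with hJdef
    set f := weldRep E J with hf
    have hf0 : f [] = [] := weldRep_nil _ _
    have hft : f (endpt (endpt [] p) b) = f t := weldRep_eq (.join ⟨rfl, rfl⟩)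
    have hw : ∀ a, a ∈ trail [] p ∨ a ∈ trail (endpt [] p) b ∨ a ∈ trail t q →
        WArrow (weld ⟨E, N⟩ J).needed (mapArrow f a) := by
      intro a ha
      refine wArrow_weld (M := ⟨E, N⟩) hsub (Or.inl ?_)
      simp only [hN, Finset.mem_union, List.mem_toFinset, List.mem_append]
      tauto
    have t₁ : trail [] (mapPath f (p ++ b)) = (trail [] (p ++ b)).map (mapArrow f) := by
      have := trail_mapPath f [] (p ++ b)
      rwa [hf0] at this
    have t₂ : endpt [] (mapPath f (p ++ b)) = f t := by
      have := endpt_mapPath f [] (p ++ b)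
      rwa [hf0, endpt_append, hft] at this
    refine ⟨mapPath f (p ++ b) ++ mapPath f q, ?_, ?_, ?_⟩
    · rw [List.map_append, map_fst_mapPath, map_fst_mapPath, ← List.map_append, hpad]
    · rw [trail_append, t₁, t₂, trail_mapPath, trail_append, List.map_append]
      intro a ha
      simp only [List.mem_append, List.mem_map] at ha
      rcases ha with (⟨c, hc, rfl⟩ | ⟨c, hc, rfl⟩) | ⟨c, hc, rfl⟩
      · exact hw c (Or.inl hc)
      · exact hw c (Or.inr (Or.inl hc))
      · exact hw c (Or.inr (Or.inr hc))
    · rw [endpt_append, t₂, endpt_mapPath, hqe, hf0]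
  · intro r' hr'
    refine WRead.weld (M := ⟨_, _⟩) hsub _ ?_
    obtain ⟨p', h₁, h₂, h₃⟩ := hr'
    exact ⟨p', h₁, fun a ha => (h₂ a ha).imp_left fun h => Finset.mem_union_left _ h, h₃⟩

end Welding

/-! ### The store during rapid reduction -/

section Reduction

variable {A : Type*} [LinearOrder A]

theorem Store.mem_all {S : Store A} {r : Rule A} :
    r ∈ S.all ↔ r ∈ S.considered ∨ r ∈ S.thisPass ∨ r ∈ S.newRules ∨ r ∈ S.toDelete := by
  simp [Store.all]

/-- `S'` arises from `S` by inserting into `New` rules which satisfy `Q` and whose left-hand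
sides are not left-hand sides in `S`. -/
structure Grow (Q : Rule A → Prop) (S S' : Store A) : Prop where
  considered : S'.considered = S.considered
  thisPass : S'.thisPass = S.thisPass
  toDelete : S'.toDelete = S.toDelete
  subset : S.newRules ⊆ S'.newRules
  fresh : ∀ r ∈ S'.newRules, r ∈ S.newRules ∨ ((∀ σ, (r.1, σ) ∉ S.all) ∧ Q r)

theorem Grow.refl (Q : Rule A → Prop) (S : Store A) : Grow Q S S :=
  ⟨rfl, rfl, rfl, Finset.Subset.refl _, fun _ h => Or.inl h⟩

theorem Grow.all_subset {Q : Rule A → Prop} {S S' : Store A} (h : Grow Q S S') :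
    S.all ⊆ S'.all := by
  intro r hr
  rw [Store.mem_all] at *
  rw [h.considered, h.thisPass, h.toDelete]
  exact hr.imp_right (Or.imp_right (Or.imp_left fun h' => h.subset h'))

theorem Grow.mem_all {Q : Rule A → Prop} {S S' : Store A} (h : Grow Q S S') {r : Rule A}
    (hr : r ∈ S'.all) : r ∈ S.all ∨ ((∀ σ, (r.1, σ) ∉ S.all) ∧ Q r) := by
  rw [Store.mem_all] at hr
  rw [h.considered, h.thisPass, h.toDelete] at hr
  rcases hr with hr | hr | hr | hr
  · exact Or.inl (Store.mem_all.2 (by tauto))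
  · exact Or.inl (Store.mem_all.2 (by tauto))
  · exact (h.fresh r hr).imp_left fun h => Store.mem_all.2 (by tauto)
  · exact Or.inl (Store.mem_all.2 (by tauto))

theorem Grow.trans {Q : Rule A → Prop} {S S' S'' : Store A} (h : Grow Q S S')
    (h' : Grow Q S' S'') : Grow Q S S'' := by
  refine ⟨h'.considered.trans h.considered, h'.thisPass.trans h.thisPass,
    h'.toDelete.trans h.toDelete, h.subset.trans h'.subset, fun r hr => ?_⟩
  rcases h'.fresh r hr with h₁ | ⟨h₁, h₂⟩
  · exact h.fresh r h₁
  · exact Or.inr ⟨fun σ hσ => h₁ σ (h.all_subset hσ), h₂⟩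

theorem Grow.mono {Q Q' : Rule A → Prop} (hQ : ∀ r, Q r → Q' r) {S S' : Store A}
    (h : Grow Q S S') : Grow Q' S S' :=
  ⟨h.considered, h.thisPass, h.toDelete, h.subset, fun r hr =>
    (h.fresh r hr).imp_right (And.imp_right (hQ r))⟩

theorem Grow.forall_mem {Q p : Rule A → Prop} (hQ : ∀ r, Q r → p r) {S S' : Store A}
    (h : Grow Q S S') (hS : ∀ r ∈ S.all, p r) : ∀ r ∈ S'.all, p r := fun r hr =>
  (h.mem_all hr).elim (hS r) fun h => hQ r h.2

/-- The rules that are recorded when strings not exceeding `z` are reduced with respect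
to `T`. -/
def Fresh (T : Set (Rule A)) (z : List A) (r : Rule A) : Prop :=
  r ∈ T ∧ ProperIrr T r.1 ∧ SLe r.1 z

theorem Fresh.mono {T : Set (Rule A)} {z z' : List A} (h : SLe z z') (r : Rule A)
    (hr : Fresh T z r) : Fresh T z' r := ⟨hr.1, hr.2.1, hr.2.2.trans h⟩

theorem Store.mem_all_record {S : Store A} {r r' : Rule A} :
    r' ∈ (S.record r).all ↔ r' = r ∨ r' ∈ S.all := by
  unfold Store.record
  split_ifs with h
  · constructor
    · exact Or.inr
    · rintro (rfl | h')
      · exact h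
      · exact h'
  · simp only [Store.mem_all, Finset.mem_insert]
    tauto

/-- A left-hand side properly inside `l` would give either a shorter reducible prefix or a shorter
suffix that is a left-hand side. Hence every recorded rule has a left-hand side without reducible
proper substrings, which is what `Fresh` keeps track of. -/
theorem RStep.spec {T : Set (Rule A)} {c c' : Store A × List A} (h : RStep T c c') :
    Grow (Fresh T c.2) c.1 c'.1 ∧ Rewrites (c'.1.all : Set (Rule A)) c.2 c'.2 ∧
      ¬ IsIrred T c.2 := by
  obtain ⟨p, l, q, ρ, hc, ⟨σ, hσ⟩, hpre, hsuf, hρ, rfl⟩ := h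
  have hproper : ProperIrr T l := by
    intro w hw hne
    rw [isIrred_iff]
    intro r hr hrw
    obtain ⟨x, y, hxy⟩ := hrw.trans hw
    have hlen : r.1.length < l.length := by
      have := hrw.length_le
      have := hw.length_le
      rcases this.lt_or_eq with h | h
      · omega
      · exact absurd (hw.eq_of_length h) hne
    rcases List.eq_nil_or_concat y with rfl | ⟨y, b, rfl⟩
    · refine hsuf r.1 ⟨x, by simpa using hxy⟩ ?_ ⟨r.2, hr⟩
      rintro h
      rw [h] at hlen
      exact lt_irrefl _ hlen
    · refine hpre (p ++ x ++ r.1) ⟨y ++ [b], ?_⟩ ?_ _ ⟨p ++ x, [], r, hr, by simp, rfl⟩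
      · rw [← hxy]; simp
      · intro h
        have := congrArg List.length h
        rw [← hxy] at this
        simp at this
  have hle : SLe l c.2 := sLe_of_isInfix ⟨p, q, hc.symm⟩
  refine ⟨?_, ⟨p, q, (l, ρ), ?_, hc, rfl⟩, ?_⟩
  · by_cases hin : (l, ρ) ∈ c.1.all
    · simp only [Store.record, if_pos hin]
      exact Grow.refl _ _
    · simp only [Store.record, if_neg hin]
      refine ⟨rfl, rfl, rfl, Finset.subset_insert _ _, fun r hr => ?_⟩
      rcases Finset.mem_insert.1 hr with rfl | hr
      · right
        rcases hρ with hρ | hρ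
        · exact absurd (Finset.mem_coe.1 hρ.1) hin
        · exact ⟨fun σ hσ => hρ.1 ⟨σ, hσ⟩, hρ.2.1, hproper, hle⟩
      · exact Or.inl hr
  · exact Finset.mem_coe.2 (Store.mem_all_record.2 (Or.inl rfl))
  · rw [not_isIrred_iff]
    exact ⟨(l, σ), hσ, p, q, hc.symm⟩

/-- All choices in a step are minima of nonempty sets. So an exhausted reduction can only stop at a
string irreducible for `T`. -/
theorem exists_rStep [Finite A] {T : Set (Rule A)} {w : List A} (hw : ¬ IsIrred T w)
    (S : Store A) : ∃ c, RStep T (S, w) c := by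
  classical
  have h₁ : ∃ n, ¬ IsIrred T (w.take n) := ⟨w.length, by simpa using hw⟩
  set n := Nat.find h₁
  have hn : ¬ IsIrred T (w.take n) := Nat.find_spec h₁
  have hmin : ∀ p', p' <+: w.take n → p' ≠ w.take n → IsIrred T p' := by
    intro p' hp' hne
    have hlt : p'.length < (w.take n).length :=
      lt_of_le_of_ne hp'.length_le fun h => hne (hp'.eq_of_length h)
    have hlt' : p'.length < n := lt_of_lt_of_le hlt (List.length_take_le _ _)
    have := Nat.find_min h₁ hlt'
    rw [not_not, ← List.prefix_iff_eq_take.1 (hp'.trans (List.take_prefix _ _))] at this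
    exact this
  obtain ⟨r, hr, x, y, hxy⟩ := not_isIrred_iff.1 hn
  have hy : y = [] := by
    by_contra hy
    refine hmin (x ++ r.1) ⟨y, hxy⟩ ?_ _ ⟨x, [], r, hr, by simp, rfl⟩
    intro h
    rw [← hxy] at h
    simp at h
    exact hy h
  subst hy
  have h₂ : ∃ m l, l.length = m ∧ l <:+ w.take n ∧ ∃ σ, (l, σ) ∈ T :=
    ⟨_, r.1, rfl, ⟨x, by simpa using hxy⟩, r.2, hr⟩
  obtain ⟨l, hlm, ⟨p, hp⟩, hlT⟩ := Nat.find_spec h₂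
  have hlmin : ∀ l', l' <:+ l → l' ≠ l → ¬ ∃ σ, (l', σ) ∈ T := by
    intro l' hl' hne hσ
    have hlt : l'.length < l.length :=
      lt_of_le_of_ne hl'.length_le fun h => hne (hl'.eq_of_length h)
    rw [hlm] at hlt
    exact Nat.find_min h₂ hlt ⟨l', rfl, hl'.trans ⟨p, hp⟩, hσ⟩
  have hleast : ∀ T' : Set (Rule A), (∃ σ, (l, σ) ∈ T') → ∃ ρ, LeastRhs T' l ρ := by
    intro T' h
    exact ⟨(sLt_wf A).min {σ | (l, σ) ∈ T'} h, (sLt_wf A).min_mem _ h,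
      fun σ hσ => (sLt_wf A).not_lt_min {σ | (l, σ) ∈ T'} hσ⟩
  have hρ : ∃ ρ, LeastRhs (S.all : Set (Rule A)) l ρ ∨
      ((¬ ∃ σ, (l, σ) ∈ S.all) ∧ LeastRhs T l ρ) := by
    by_cases h : ∃ σ, (l, σ) ∈ S.all
    · obtain ⟨ρ, hρ⟩ := hleast (S.all : Set (Rule A)) (by simpa using h)
      exact ⟨ρ, Or.inl hρ⟩
    · obtain ⟨ρ, hρ⟩ := hleast T hlT
      exact ⟨ρ, Or.inr ⟨h, hρ⟩⟩
  obtain ⟨ρ, hρ⟩ := hρ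
  refine ⟨_, p, l, w.drop n, ρ, ?_, hlT, ?_, hlmin, hρ, rfl⟩
  · rw [hp, List.take_append_drop]
  · rw [hp]; exact hmin

/-- Each rule applied is recorded, so the reduction is one by explicit rules of the final store,
even where `S` had none. The bound `z` is free in order that successive reductions can share it. -/
theorem RReduce.spec [Finite A] {T : Set (Rule A)} (hT : Decreasing T) {S S' : Store A}
    {w w' z : List A} (hS : Decreasing (S.all : Set (Rule A))) (h : RReduce T S w S' w')
    (hz : SLe w z) :
    Grow (Fresh T z) S S' ∧ Decreasing (S'.all : Set (Rule A)) ∧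
      Relation.ReflTransGen (Rewrites (S'.all : Set (Rule A))) w w' ∧ IsIrred T w' := by
  obtain ⟨h, hend⟩ := h
  have key : ∀ c, Relation.ReflTransGen (RStep T) (S, w) c → Grow (Fresh T z) S c.1 ∧
      Decreasing (c.1.all : Set (Rule A)) ∧
      Relation.ReflTransGen (Rewrites (c.1.all : Set (Rule A))) w c.2 := by
    intro c hc
    induction hc with
    | refl => exact ⟨Grow.refl _ _, hS, .refl⟩
    | tail _ h ih =>
      obtain ⟨h₁, h₂, h₃⟩ := ih
      obtain ⟨h₄, h₅, -⟩ := h.spec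
      have hle := (sLe_of_reflTransGen h₂ h₃).trans hz
      refine ⟨h₁.trans (h₄.mono (Fresh.mono hle)), ?_, ?_⟩
      · exact h₄.forall_mem (p := fun r => SLt r.2 r.1) (fun r hr => hT r hr.1) h₂
      · exact (reflTransGen_imp (fun a b hab => hab.mono
          (Finset.coe_subset.2 h₄.all_subset)) h₃).tail h₅
  obtain ⟨h₁, h₂, h₃⟩ := key _ h
  refine ⟨h₁, h₂, h₃, ?_⟩
  by_contra hirr
  obtain ⟨c, hc⟩ := exists_rStep hirr S'
  exact hend c hc

theorem RReduce.eq_of_isIrred {T : Set (Rule A)} {S S' : Store A} {w w' : List A}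
    (h : RReduce T S w S' w') (hw : IsIrred T w) : S' = S ∧ w' = w := by
  rcases h.1.cases_head with h | ⟨c, h, _⟩
  · cases h; exact ⟨rfl, rfl⟩
  · exact absurd hw h.spec.2.2

/-! ### The first part of minimization -/

/-- In the second alternative the first change happens in a proper substring `w`. All rules used on
the way from `l` to `u` then have left-hand sides below `l`, as the induction in `GoodRun.follows`
requires. -/
theorem Prepare.spec [Finite A] {T : Set (Rule A)} (hT : Decreasing T) {S S' : Store A}
    {l u : List A} (hS : Decreasing (S.all : Set (Rule A))) (h : Prepare T S l S' u) :
    Grow (Fresh T l) S S' ∧ Decreasing (S'.all : Set (Rule A)) ∧ ((u = l ∧ ProperIrr T l) ∨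
      (IsIrred T u ∧ ∃ x w w' y, l = x ++ w ++ y ∧ SLt w l ∧ w' ≠ w ∧ ¬ IsIrred T w ∧
        Relation.ReflTransGen (Rewrites (S'.all : Set (Rule A))) w w' ∧
        Relation.ReflTransGen (Rewrites (S'.all : Set (Rule A))) (x ++ w' ++ y) u)) := by
  cases h with
  | @pre i y S₁ i' _ _ h₁ hne h₂ =>
    have hlt : SLt i (i ++ [y]) := sLt_of_length_lt (by simp)
    obtain ⟨g₁, d₁, r₁, -⟩ := h₁.spec hT hS (Or.inr hlt)
    have hle : SLe (i' ++ [y]) (i ++ [y]) := by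
      simpa using (sLe_of_reflTransGen d₁ r₁).context [] [y]
    obtain ⟨g₂, d₂, r₂, irr⟩ := h₂.spec hT d₁ hle
    have hmono : Relation.ReflTransGen (Rewrites (S'.all : Set (Rule A))) i i' :=
      reflTransGen_imp (fun a b hab => hab.mono (Finset.coe_subset.2 g₂.all_subset)) r₁
    exact ⟨g₁.trans g₂, d₂, Or.inr ⟨irr, [], i, i', [y], by simp, hlt, hne,
      fun hi => hne (h₁.eq_of_isIrred hi).2, hmono, by simpa using r₂⟩⟩
  | @suf i y x t S₁ S₂ t' _ _ he h₀ h₁ hne h₂ =>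
    have hlt : SLt t (x :: t) := sLt_of_length_lt (by simp)
    have hlt₀ : SLt i (x :: t) := sLt_of_length_lt (by rw [he]; simp)
    obtain ⟨g₀, d₀, -, -⟩ := h₀.spec hT hS (Or.inr hlt₀)
    obtain ⟨g₁, d₁, r₁, -⟩ := h₁.spec hT d₀ (Or.inr hlt)
    have hle : SLe (x :: t') (x :: t) := by
      simpa using (sLe_of_reflTransGen d₁ r₁).context [x] []
    obtain ⟨g₂, d₂, r₂, irr⟩ := h₂.spec hT d₁ hle
    have hmono : Relation.ReflTransGen (Rewrites (S'.all : Set (Rule A))) t t' :=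
      reflTransGen_imp (fun a b hab => hab.mono (Finset.coe_subset.2 g₂.all_subset)) r₁
    exact ⟨(g₀.trans g₁).trans g₂, d₂, Or.inr ⟨irr, [x], t, t', [], by simp, hlt, hne,
      fun hi => hne (h₁.eq_of_isIrred hi).2, hmono, by simpa using r₂⟩⟩
  | @same i y x t S₁ _ he h₀ h₁ =>
    have hlt : SLt t (x :: t) := sLt_of_length_lt (by simp)
    have hlt₀ : SLt i (x :: t) := sLt_of_length_lt (by rw [he]; simp)
    obtain ⟨g₀, d₀, -, irr₀⟩ := h₀.spec hT hS (Or.inr hlt₀)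
    obtain ⟨g₁, d₁, -, irr₁⟩ := h₁.spec hT d₀ (Or.inr hlt)
    refine ⟨g₀.trans g₁, d₁, Or.inl ⟨rfl, fun w hw hne => ?_⟩⟩
    rcases proper_isInfix_cons_append he rfl hw hne with h | h
    · exact irr₀.of_isInfix h
    · exact irr₁.of_isInfix h

theorem Prepare.eq_of_properIrr {T : Set (Rule A)} {S S' : Store A}
    {l u : List A} (hl : ProperIrr T l) (h : Prepare T S l S' u) : u = l := by
  cases h with
  | @pre i y S₁ i' _ _ h₁ hne h₂ =>
    exact absurd (h₁.eq_of_isIrred (hl i ⟨[], [y], by simp⟩ (by simp))).2 hne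
  | @suf i y x t S₁ S₂ t' _ _ he h₀ h₁ hne h₂ =>
    exact absurd (h₁.eq_of_isIrred (hl t ⟨[x], [], by simp⟩ (by simp))).2 hne
  | same => rfl

/-! ### The loop of minimization -/

/-- A move of a letter to the other side, or a cancellation. -/
def PreStep (ι : A → A) (r r' : Rule A) : Prop :=
  MoveLast ι r r' ∨ MoveFirst ι r r' ∨ CancelFirst r r' ∨ CancelLast r r'

/-- If the lengths differ by more than two, the left-hand side stays longer after the move. If they
differ by exactly two they become equal, and the condition on first letters decides. The orientation
before the move is irrelevant. -/
theorem MoveLast.sLt {ι : A → A} {r r' : Rule A} (h : MoveLast ι r r') : SLt r'.2 r'.1 := by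
  obtain ⟨x, h₁, h₂, h₃⟩ := h
  have hl₁ := congrArg List.length h₁
  have hl₂ := congrArg List.length h₂
  simp only [List.length_append, List.length_cons, List.length_nil] at hl₁ hl₂
  rcases h₃ with h₃ | ⟨h₃, a, u, b, v, ha, hb, hlt⟩
  · exact sLt_of_length_lt (by omega)
  · have hv : r.2.length = v.length + 1 := by rw [hb]; simp
    rw [hb, List.cons_append] at h₂
    rcases hr : r'.1 with _ | ⟨a', u'⟩
    · rw [hr] at hl₁; simp at hl₁; omega
    · rw [hr, ha, List.cons_append, List.cons.injEq] at h₁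
      rw [h₂, ← h₁.1]
      refine sLt_cons_cons ?_ hlt
      rw [hr] at hl₁
      rw [h₂] at hl₂
      simp only [List.length_cons] at hl₁ hl₂
      omega

theorem MoveFirst.sLt {ι : A → A} {r r' : Rule A} (h : MoveFirst ι r r') : SLt r'.2 r'.1 := by
  obtain ⟨a, b, u, h₁, h₂, h₃, rfl⟩ := h
  refine sLt_cons_cons ?_ h₃
  rw [h₁] at h₂
  simpa using h₂.symm

theorem PreStep.length_lt {ι : A → A} {r r' : Rule A} (h : PreStep ι r r') :
    r'.1.length < r.1.length := by
  rcases h with ⟨x, h, -⟩ | ⟨a, b, u, h, -, -, rfl⟩ | ⟨x, h, -⟩ | ⟨x, h, -⟩ <;> simp [h]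

theorem PreStep.isInfix {ι : A → A} {r r' : Rule A} (h : PreStep ι r r') : r'.1 <:+: r.1 := by
  rcases h with ⟨x, h, -⟩ | ⟨a, b, u, h, -, -, rfl⟩ | ⟨x, h, -⟩ | ⟨x, h, -⟩
  · exact ⟨[], [x], by simp [h]⟩
  · exact ⟨[a], [], by simp [h]⟩
  · exact ⟨[x], [], by simp [h]⟩
  · exact ⟨[], [x], by simp [h]⟩

theorem PreStep.sLt {ι : A → A} {r r' : Rule A} (h : PreStep ι r r') (hr : SLt r.2 r.1) :
    SLt r'.2 r'.1 := by
  rcases h with h | h | ⟨x, h₁, h₂⟩ | ⟨x, h₁, h₂⟩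
  · exact h.sLt
  · exact h.sLt
  · rwa [h₁, h₂, sLt_cons_iff] at hr
  · rwa [h₁, h₂, sLt_append_right_iff] at hr

/-- With `z` the larger side, this says that the larger side strictly drops, even for a rule that is
not decreasing. It is the measure behind `MinRound.fixed`. -/
theorem PreStep.lt {ι : A → A} {r r' : Rule A} (h : PreStep ι r r') {z : List A}
    (h₁ : SLe r.1 z) (h₂ : SLe r.2 z) : SLt r'.1 z ∧ SLt r'.2 z := by
  have hlt : SLt r'.1 z := sLt_of_lt_of_le (sLt_of_length_lt h.length_lt) h₁
  refine ⟨hlt, ?_⟩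
  rcases h with h | h | ⟨x, -, h⟩ | ⟨x, -, h⟩
  · exact sLt_trans h.sLt hlt
  · exact sLt_trans h.sLt hlt
  · exact sLt_of_lt_of_le (sLt_of_length_lt (by simp [h])) h₂
  · exact sLt_of_lt_of_le (sLt_of_length_lt (by simp [h])) h₂

theorem PreStep.val {G : Type*} [Group G] {g : A → G} {ι : A → A} (hg : ∀ x, g (ι x) = (g x)⁻¹)
    {r r' : Rule A} (h : PreStep ι r r') (hr : val g r.1 = val g r.2) :
    val g r'.1 = val g r'.2 := by
  rcases h with ⟨x, h₁, h₂, -⟩ | ⟨a, b, u, h₁, -, -, rfl⟩ | ⟨x, h₁, h₂⟩ | ⟨x, h₁, h₂⟩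
  · rw [h₁] at hr
    rw [h₂]
    simp only [val_append, val_cons, val_nil, mul_one, hg] at hr ⊢
    rw [← hr, mul_inv_cancel_right]
  · rw [h₁] at hr
    simp only [val_cons, hg] at hr ⊢
    rw [← hr, inv_mul_cancel_left]
  · rw [h₁, h₂] at hr
    simpa using hr
  · rw [h₁, h₂] at hr
    simpa using hr

theorem val_of_preSteps {G : Type*} [Group G] {g : A → G} {ι : A → A}
    (hg : ∀ x, g (ι x) = (g x)⁻¹) {r r' : Rule A} (h : Relation.ReflTransGen (PreStep ι) r r')
    (hr : val g r.1 = val g r.2) : val g r'.1 = val g r'.2 := by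
  induction h with
  | refl => exact hr
  | tail _ h ih => exact h.val hg ih

theorem MinRound.spec [Finite A] {ι : A → A} {T : Set (Rule A)} (hT : Decreasing T)
    {S S' : Store A} {r r' : Rule A} {z : List A} (hS : Decreasing (S.all : Set (Rule A)))
    (h : MinRound ι T S r S' r') (h₁ : SLe r.1 z) (h₂ : SLe r.2 z) :
    Grow (Fresh T z) S S' ∧ Decreasing (S'.all : Set (Rule A)) ∧
    ∃ r₄ v, Relation.ReflTransGen (PreStep ι) r r₄ ∧
      Relation.ReflTransGen (Rewrites (S'.all : Set (Rule A))) r₄.2 v ∧ IsIrred T v ∧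
      r' = orient r₄.1 v := by
  obtain ⟨r₁, r₂, r₃, r₄, v, e₁, e₂, e₃, e₄, hv, rfl⟩ := h
  have hpre : Relation.ReflTransGen (PreStep ι) r r₄ := by
    have p₁ : Relation.ReflTransGen (PreStep ι) r r₁ :=
      reflTransGen_imp (fun _ _ h => Or.inl h) e₁.1
    have p₂ : Relation.ReflTransGen (PreStep ι) r₁ r₂ := by
      rcases e₂ with e₂ | ⟨-, rfl⟩
      · exact .single (Or.inr (Or.inl e₂))
      · exact .refl
    have p₃ : Relation.ReflTransGen (PreStep ι) r₂ r₃ :=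
      reflTransGen_imp (fun _ _ h => Or.inr (Or.inr (Or.inl h))) e₃.1
    have p₄ : Relation.ReflTransGen (PreStep ι) r₃ r₄ :=
      reflTransGen_imp (fun _ _ h => Or.inr (Or.inr (Or.inr h))) e₄.1
    exact ((p₁.trans p₂).trans p₃).trans p₄
  have hle : SLe r₄.2 z := by
    have : SLe r₄.1 z ∧ SLe r₄.2 z := by
      clear hv e₄
      induction hpre with
      | refl => exact ⟨h₁, h₂⟩
      | tail _ h ih => exact ⟨Or.inr (h.lt ih.1 ih.2).1, Or.inr (h.lt ih.1 ih.2).2⟩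
    exact this.2
  obtain ⟨g, d, hr, irr⟩ := hv.spec hT hS hle
  exact ⟨g, d, r₄, v, hpre, hr, irr, rfl⟩

/-- No letter can be moved or cancelled, and the rule is oriented, with irreducible right-hand
side and irreducible proper substrings of the left-hand side. -/
structure TMin (ι : A → A) (T : Set (Rule A)) (r : Rule A) : Prop where
  lt : SLt r.2 r.1
  noPre : ∀ r', ¬ PreStep ι r r'
  rhs : IsIrred T r.2
  lhs : ProperIrr T r.1

theorem eq_or_lt_of_preSteps {ι : A → A} {r r' : Rule A}
    (h : Relation.ReflTransGen (PreStep ι) r r') :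
    r' = r ∨ (r'.1.length < r.1.length ∧ r'.1 <:+: r.1 ∧ (SLt r.2 r.1 → SLt r'.2 r'.1) ∧
      ∀ z, SLe r.1 z → SLe r.2 z → SLt r'.1 z ∧ SLt r'.2 z) := by
  induction h with
  | refl => exact Or.inl rfl
  | tail _ h ih =>
    right
    rcases ih with rfl | ⟨h₁, h₂, h₃, h₄⟩
    · exact ⟨h.length_lt, h.isInfix, h.sLt, fun z => h.lt⟩
    · exact ⟨h.length_lt.trans h₁, h.isInfix.trans h₂, fun h' => h.sLt (h₃ h'), fun z a b =>
        h.lt (Or.inr (h₄ z a b).1) (Or.inr (h₄ z a b).2)⟩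

theorem orient_of_lt {u v : List A} (h : SLt v u) : orient u v = (u, v) := by
  unfold orient
  rw [if_neg h.asymm]

theorem orient_cases (u v : List A) :
    (orient u v = (u, v) ∧ SLe v u) ∨ (orient u v = (v, u) ∧ SLt u v) := by
  unfold orient
  split_ifs with h
  · exact Or.inr ⟨rfl, h⟩
  · exact Or.inl ⟨rfl, not_sLt.1 h⟩

/-- A round that changes nothing. -/
theorem MinRound.fixed [Finite A] {ι : A → A} {T : Set (Rule A)} (hT : Decreasing T)
    {S S' : Store A} {r : Rule A} (hS : Decreasing (S.all : Set (Rule A)))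
    (h : MinRound ι T S r S' r) :
    (∀ r', ¬ PreStep ι r r') ∧ IsIrred T r.2 ∧ (SLt r.2 r.1 ∨ r = ([], [])) := by
  obtain ⟨z, hz₁, hz₂, hz⟩ : ∃ z, SLe r.1 z ∧ SLe r.2 z ∧ (z = r.1 ∨ z = r.2) := by
    rcases sLt_trichotomy r.1 r.2 with h | h | h
    · exact ⟨r.2, Or.inr h, SLe.refl _, Or.inr rfl⟩
    · exact ⟨r.2, Or.inl h, SLe.refl _, Or.inr rfl⟩
    · exact ⟨r.1, SLe.refl _, Or.inr h, Or.inl rfl⟩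
  have hspec := h.spec hT hS hz₁ hz₂
  obtain ⟨r₁, r₂, r₃, r₄, v, e₁, e₂, e₃, e₄, hv, ho⟩ := h
  have p₁ : Relation.ReflTransGen (PreStep ι) r r₁ :=
    reflTransGen_imp (fun _ _ h => Or.inl h) e₁.1
  have p₂ : Relation.ReflTransGen (PreStep ι) r₁ r₂ := by
    rcases e₂ with e₂ | ⟨-, rfl⟩
    · exact .single (Or.inr (Or.inl e₂))
    · exact .refl
  have p₃ : Relation.ReflTransGen (PreStep ι) r₂ r₃ :=
    reflTransGen_imp (fun _ _ h => Or.inr (Or.inr (Or.inl h))) e₃.1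
  have p₄ : Relation.ReflTransGen (PreStep ι) r₃ r₄ :=
    reflTransGen_imp (fun _ _ h => Or.inr (Or.inr (Or.inr h))) e₄.1
  have hlen : ∀ {a b : Rule A}, Relation.ReflTransGen (PreStep ι) a b →
      b = a ∨ b.1.length < a.1.length := fun h => (eq_or_lt_of_preSteps h).imp_right And.left
  have hle : ∀ {a b : Rule A}, Relation.ReflTransGen (PreStep ι) a b →
      b.1.length ≤ a.1.length := fun h => by
    rcases hlen h with rfl | h
    · exact le_rfl
    · exact h.le
  -- Any move or cancellation lowers the larger side, and reducing or interchanging sides never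
  -- raises it. So a round which returns its input has moved and cancelled nothing.
  have h4r : r₄ = r := by
    rcases eq_or_lt_of_preSteps (((p₁.trans p₂).trans p₃).trans p₄) with h | ⟨-, -, -, h⟩
    · exact h
    · exfalso
      obtain ⟨l₁, l₂⟩ := h z hz₁ hz₂
      obtain ⟨-, d, hvr, -⟩ := hv.spec hT hS (Or.inr l₂)
      have l₃ : SLt v z := (sLe_of_reflTransGen d hvr).trans_lt l₂
      have : SLt r.1 z ∧ SLt r.2 z := by
        rcases orient_cases r₄.1 v with ⟨h, -⟩ | ⟨h, -⟩
        · rw [ho, h]; exact ⟨l₁, l₃⟩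
        · rw [ho, h]; exact ⟨l₃, l₁⟩
      rcases hz with rfl | rfl
      · exact sLt_irrefl _ this.1
      · exact sLt_irrefl _ this.2
  subst h4r
  have h3 : r₃ = r₄ := by
    rcases hlen p₄ with h | h
    · exact h.symm
    · have := hle ((p₁.trans p₂).trans p₃)
      omega
  subst h3
  have h2 : r₂ = r₃ := by
    rcases hlen p₃ with h | h
    · exact h.symm
    · have := hle (p₁.trans p₂)
      omega
  subst h2
  have h1 : r₁ = r₂ := by
    rcases hlen p₂ with h | h
    · exact h.symm
    · have := hle p₁
      omega
  subst h1
  have hno : ∀ r', ¬ PreStep ι r₁ r' := by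
    rintro r' (h | h | h | h)
    · exact e₁.2 _ h
    · rcases e₂ with e₂ | ⟨e₂, -⟩
      · exact absurd (PreStep.length_lt (Or.inr (Or.inl e₂))) (lt_irrefl _)
      · exact e₂ _ h
    · exact e₃.2 _ h
    · exact e₄.2 _ h
  obtain ⟨-, d, hvr, hirr⟩ := hv.spec hT hS hz₂
  rcases orient_cases r₁.1 v with ⟨h, hle⟩ | ⟨h, hlt⟩
  · rw [h] at ho
    have hv : v = r₁.2 := (congrArg Prod.snd ho).symm
    subst hv
    refine ⟨hno, hirr, ?_⟩
    rcases hle with he | hlt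
    · right
      obtain ⟨u, v⟩ := r₁
      simp only at he
      subst he
      cases v with
      | nil => rfl
      | cons a v => exact absurd (Or.inr (Or.inr (Or.inl ⟨a, rfl, rfl⟩))) (hno (v, v))
    · exact Or.inl hlt
  · rw [h] at ho
    have h₁ : r₁.1 = v := congrArg Prod.fst ho
    rw [h₁] at hlt
    exact absurd hlt (sLt_irrefl _)

theorem MinRound.eq_of_tMin {ι : A → A} {T : Set (Rule A)}
    {S S' : Store A} {r r' : Rule A} (hr : TMin ι T r) (h : MinRound ι T S r S' r') : r' = r := by
  obtain ⟨r₁, r₂, r₃, r₄, v, e₁, e₂, e₃, e₄, hv, ho⟩ := h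
  have h1 : r₁ = r := by
    rcases e₁.1.cases_head with h | ⟨c, h, _⟩
    · exact h.symm
    · exact absurd (Or.inl h) (hr.noPre c)
  subst h1
  have h2 : r₂ = r₁ := by
    rcases e₂ with h | ⟨-, h⟩
    · exact absurd (Or.inr (Or.inl h)) (hr.noPre _)
    · exact h
  subst h2
  have h3 : r₃ = r₂ := by
    rcases e₃.1.cases_head with h | ⟨c, h, _⟩
    · exact h.symm
    · exact absurd (Or.inr (Or.inr (Or.inl h))) (hr.noPre c)
  subst h3
  have h4 : r₄ = r₃ := by
    rcases e₄.1.cases_head with h | ⟨c, h, _⟩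
    · exact h.symm
    · exact absurd (Or.inr (Or.inr (Or.inr h))) (hr.noPre c)
  subst h4
  rw [ho, (hv.eq_of_isIrred hr.rhs).2, orient_of_lt hr.lt]

theorem MinLoop.eq_of_tMin {ι : A → A} {T : Set (Rule A)}
    {S S' : Store A} {r r' : Rule A} (hr : TMin ι T r) (h : MinLoop ι T S r S' r') : r' = r := by
  cases h with
  | halt => rfl
  | again h hne _ => exact absurd (h.eq_of_tMin hr) hne

/-- General properties of the loop. -/
theorem MinLoop.spec [Finite A] {ι : A → A} {T : Set (Rule A)} (hT : Decreasing T)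
    {S S' : Store A} {r r' : Rule A} {z : List A} (hS : Decreasing (S.all : Set (Rule A)))
    (h : MinLoop ι T S r S' r') (h₁ : SLe r.1 z) (h₂ : SLt r.2 z) :
    Grow (Fresh T z) S S' ∧ Decreasing (S'.all : Set (Rule A)) ∧ SLe r'.1 z ∧ SLt r'.2 z ∧
      (∀ r'', ¬ PreStep ι r' r'') ∧ IsIrred T r'.2 ∧ (SLt r'.2 r'.1 ∨ r' = ([], [])) := by
  induction h with
  | halt h =>
    obtain ⟨g, d, -⟩ := h.spec hT hS h₁ (Or.inr h₂)
    obtain ⟨f₁, f₂, f₃⟩ := h.fixed hT hS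
    exact ⟨g, d, h₁, h₂, f₁, f₂, f₃⟩
  | again h _ _ ih =>
    obtain ⟨g, d, r₄, v, hp, hv, -, rfl⟩ := h.spec hT hS h₁ (Or.inr h₂)
    have hb : SLe r₄.1 z ∧ SLt r₄.2 z := by
      rcases eq_or_lt_of_preSteps hp with rfl | ⟨-, -, -, h⟩
      · exact ⟨h₁, h₂⟩
      · exact ⟨Or.inr (h z h₁ (Or.inr h₂)).1, (h z h₁ (Or.inr h₂)).2⟩
    have hvz : SLt v z := (sLe_of_reflTransGen d hv).trans_lt hb.2
    have hb' : SLe (orient r₄.1 v).1 z ∧ SLt (orient r₄.1 v).2 z := by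
      rcases orient_cases r₄.1 v with ⟨h, -⟩ | ⟨h, hlt⟩
      · rw [h]; exact ⟨hb.1, hvz⟩
      · rw [h]; exact ⟨Or.inr hvz, sLt_trans hlt hvz⟩
    obtain ⟨g', rest⟩ := ih d hb'.1 hb'.2
    exact ⟨g.trans g', rest⟩

/-- The loop, started with an irreducible left-hand side. -/
theorem MinLoop.isIrred [Finite A] {ι : A → A} {T : Set (Rule A)} (hT : Decreasing T)
    {S S' : Store A} {r r' : Rule A} {z : List A} (hS : Decreasing (S.all : Set (Rule A)))
    (h : MinLoop ι T S r S' r') (h₁ : SLe r.1 z) (h₂ : SLe r.2 z) (hr : IsIrred T r.1) :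
    IsIrred T r'.1 ∧ IsIrred T r'.2 ∧ SLe r'.1 z := by
  have key : ∀ {S S' : Store A} {r r' : Rule A}, Decreasing (S.all : Set (Rule A)) →
      MinRound ι T S r S' r' → SLe r.1 z → SLe r.2 z → IsIrred T r.1 →
      IsIrred T r'.1 ∧ IsIrred T r'.2 ∧ SLe r'.1 z ∧ SLe r'.2 z ∧
        Decreasing (S'.all : Set (Rule A)) := by
    intro S S' r r' hS h h₁ h₂ hr
    obtain ⟨-, d, r₄, v, hp, hv, irr, rfl⟩ := h.spec hT hS h₁ h₂
    have hb : SLe r₄.1 z ∧ SLe r₄.2 z ∧ IsIrred T r₄.1 := by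
      rcases eq_or_lt_of_preSteps hp with rfl | ⟨-, hi, -, h⟩
      · exact ⟨h₁, h₂, hr⟩
      · exact ⟨Or.inr (h z h₁ h₂).1, Or.inr (h z h₁ h₂).2, hr.of_isInfix hi⟩
    have hvz : SLe v z := (sLe_of_reflTransGen d hv).trans hb.2.1
    rcases orient_cases r₄.1 v with ⟨h, -⟩ | ⟨h, -⟩
    · rw [h]; exact ⟨hb.2.2, irr, hb.1, hvz, d⟩
    · rw [h]; exact ⟨irr, hb.2.2, hvz, hb.1, d⟩
  induction h with
  | halt h =>
    obtain ⟨h, h', hz, -⟩ := key hS h h₁ h₂ hr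
    exact ⟨h, h', hz⟩
  | again h _ _ ih =>
    obtain ⟨i₁, -, l₁, l₂, d⟩ := key hS h h₁ h₂ hr
    exact ih d l₁ l₂ i₁

/-- The loop, started with a rule whose left-hand side has irreducible proper substrings. -/
theorem MinLoop.properIrr [Finite A] {ι : A → A} {T : Set (Rule A)} (hT : Decreasing T)
    {S S' : Store A} {r r' : Rule A} (hS : Decreasing (S.all : Set (Rule A)))
    (h : MinLoop ι T S r S' r') (hr : ProperIrr T r.1) (hlt : SLt r.2 r.1) :
    TMin ι T r' ∧ r'.1 <:+: r.1 ∧ (r'.1 = r.1 →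
      Relation.ReflTransGen (Rewrites (S'.all : Set (Rule A))) r.2 r'.2) := by
  have key : ∀ {S S' : Store A} {r r' : Rule A}, Decreasing (S.all : Set (Rule A)) →
      MinRound ι T S r S' r' → ProperIrr T r.1 → SLt r.2 r.1 →
      Decreasing (S'.all : Set (Rule A)) ∧ SLt r'.2 r'.1 ∧ r'.1 <:+: r.1 ∧ (r'.1 = r.1 →
      Relation.ReflTransGen (Rewrites (S'.all : Set (Rule A))) r.2 r'.2) := by
    intro S S' r r' hS h hr hlt
    obtain ⟨-, d, r₄, v, hp, hv, irr, rfl⟩ := h.spec hT hS (SLe.refl _) (Or.inr hlt)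
    rcases eq_or_lt_of_preSteps hp with rfl | ⟨hl, hi, hlt', -⟩
    · have : SLt v r₄.1 := (sLe_of_reflTransGen d hv).trans_lt hlt
      rw [orient_of_lt this]
      exact ⟨d, this, List.infix_refl _, fun _ => hv⟩
    · have : SLt v r₄.1 := (sLe_of_reflTransGen d hv).trans_lt (hlt' hlt)
      rw [orient_of_lt this]
      refine ⟨d, this, hi, fun h => ?_⟩
      simp only at h
      rw [h] at hl
      exact absurd hl (lt_irrefl _)
  have hspec := h.spec hT hS (SLe.refl _) hlt
  obtain ⟨-, -, -, -, no, irr, -⟩ := hspec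
  suffices h : SLt r'.2 r'.1 ∧ r'.1 <:+: r.1 ∧ (r'.1 = r.1 →
      Relation.ReflTransGen (Rewrites (S'.all : Set (Rule A))) r.2 r'.2) from
    ⟨⟨h.1, no, irr, hr.of_isInfix h.2.1⟩, h.2⟩
  clear no irr
  induction h with
  | halt h => exact (key hS h hr hlt).2
  | @again S r S₁ r₁ S₂ r₂ h _ h' ih =>
    obtain ⟨d, l, i, c⟩ := key hS h hr hlt
    obtain ⟨l', i', c'⟩ := ih d (hr.of_isInfix i) l
    refine ⟨l', i'.trans i, fun he => ?_⟩
    -- Left-hand sides only shrink to substrings, so if the last one equals the first then all those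
    -- between do.
    have h₁ : r₁.1 = r.1 := i.eq_of_length (le_antisymm i.length_le (by
      rw [← he]; exact i'.length_le))
    have g := (h'.spec hT d (SLe.refl _) l).1
    exact (reflTransGen_imp (fun a b hab => hab.mono
      (Finset.coe_subset.2 g.all_subset)) (c h₁)).trans (c' (he.trans h₁.symm))

theorem MinLoop.val [Finite A] {G : Type*} [Group G] {g : A → G} {ι : A → A}
    (hg : ∀ x, g (ι x) = (g x)⁻¹) {T : Set (Rule A)} (hT : Decreasing T)
    (hTv : ∀ r ∈ T, val g r.1 = val g r.2)
    {S S' : Store A} {r r' : Rule A} {z : List A} (hS : Decreasing (S.all : Set (Rule A)))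
    (hSv : ∀ r ∈ S.all, RapidKB.val g r.1 = RapidKB.val g r.2)
    (h : MinLoop ι T S r S' r') (h₁ : SLe r.1 z) (h₂ : SLe r.2 z)
    (hr : RapidKB.val g r.1 = RapidKB.val g r.2) :
    RapidKB.val g r'.1 = RapidKB.val g r'.2 := by
  induction h with
  | halt h => exact hr
  | again h _ _ ih =>
    obtain ⟨gr, d, r₄, v, hp, hv, -, rfl⟩ := h.spec hT hS h₁ h₂
    have hb : SLe r₄.1 z ∧ SLe r₄.2 z := by
      rcases eq_or_lt_of_preSteps hp with rfl | ⟨-, -, -, h⟩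
      · exact ⟨h₁, h₂⟩
      · exact ⟨Or.inr (h z h₁ h₂).1, Or.inr (h z h₁ h₂).2⟩
    have hvz : SLe v z := (sLe_of_reflTransGen d hv).trans hb.2
    have hSv' := gr.forall_mem (p := fun r => RapidKB.val g r.1 = RapidKB.val g r.2)
      (fun r hr => hTv r hr.1) hSv
    have h4 : RapidKB.val g r₄.1 = RapidKB.val g r₄.2 := val_of_preSteps hg hp hr
    rw [val_eq_of_reflTransGen g hSv' hv] at h4
    rcases orient_cases r₄.1 v with ⟨h, -⟩ | ⟨h, -⟩
    · rw [h] at ih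
      exact ih d hSv' hb.1 hvz h4
    · rw [h] at ih
      exact ih d hSv' hvz hb.1 h4.symm

/-! ### Minimization preserves consequences -/

/-- The two sides are connected by reductions which start at strings not exceeding the larger of
the two. -/
def Bounded (P : Set (Rule A)) (r : Rule A) : Prop :=
  ∀ z, SLe r.1 z → SLe r.2 z → Conn P (SLe · z) r.1 r.2

theorem Follows.bounded {P : Set (Rule A)} {r : Rule A} (h : Follows P r) : Bounded P r :=
  fun _ hz _ => Conn.mono (fun _ ha => SLe.trans ha hz) h

theorem Bounded.swap {P : Set (Rule A)} {u v : List A} (h : Bounded P (u, v)) :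
    Bounded P (v, u) := fun z h₁ h₂ => (h z h₂ h₁).symm

theorem exists_max (u v : List A) : ∃ m, SLe u m ∧ SLe v m ∧ (m = u ∨ m = v) := by
  rcases sLt_trichotomy u v with h | h | h
  · exact ⟨v, Or.inr h, SLe.refl _, Or.inr rfl⟩
  · exact ⟨v, Or.inl h, SLe.refl _, Or.inr rfl⟩
  · exact ⟨u, SLe.refl _, Or.inr h, Or.inl rfl⟩

theorem Bounded.context {P : Set (Rule A)} {u v : List A} (h : Bounded P (u, v))
    (x y : List A) : Bounded P (x ++ u ++ y, x ++ v ++ y) := by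
  intro z h₁ h₂
  obtain ⟨m, hu, hv, hm⟩ := exists_max u v
  refine Conn.context (B := (SLe · m)) x y (fun w hw => ?_) (h m hu hv)
  refine (SLe.context hw x y).trans ?_
  rcases hm with rfl | rfl
  · exact h₁
  · exact h₂

/-- A move is undone by a special rule, which cancels a letter against its inverse. The left-hand
side of this rule has to lie below `m`: for `MoveLast` by its length, for `MoveFirst` by the
condition `ι a < b`. -/
theorem PreStep.bounded {P : Set (Rule A)} {ι : A → A} (hι : Function.Involutive ι)
    {m : List A} (hs : ∀ x, SLt [x, ι x] m → Follows P ([x, ι x], []))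
    {r r' : Rule A} (h : PreStep ι r r') (hm : SLe r.1 m) (hb : Bounded P r') : Bounded P r := by
  intro z h₁ h₂
  rcases h with h | h | ⟨x, e₁, e₂⟩ | ⟨x, e₁, e₂⟩
  · have hlt := h.sLt
    obtain ⟨x, e₁, e₂, hc⟩ := h
    have hl₁ := congrArg List.length e₁
    have hl₂ := congrArg List.length e₂
    simp only [List.length_append, List.length_cons, List.length_nil] at hl₁ hl₂
    have hlen : 2 < r.1.length := by
      rcases hc with hc | ⟨hc, -, -, b, v, -, hb, -⟩
      · omega
      · rw [hc, hb]; simp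
    have c₁ := hb.context [] [x] r.1 (Or.inl (by simp [e₁])) (by
      rw [e₁]
      exact Or.inr (by simpa using hlt.append_right [x]))
    have lt₂ : SLt (r.2 ++ [ι x, x] ++ []) r.1 := by
      have := hlt.append_right [x]
      rw [← e₁, e₂] at this
      simpa using this
    have hsx := hs (ι x) (sLt_of_lt_of_le (sLt_of_length_lt (by simpa using hlen)) hm)
    rw [hι x] at hsx
    have c₂ := hsx.conn (B := (SLe · z)) r.2 [] fun w hw =>
      (hw.trans (Or.inr lt₂)).trans h₁
    rw [e₂, List.nil_append, List.nil_append, ← e₁] at c₁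
    simp only [List.append_nil, List.append_assoc, List.cons_append, List.nil_append] at c₁ c₂
    exact (Conn.mono (fun w hw => SLe.trans hw h₁) c₁).trans _ _ _ c₂
  · have hlt := h.sLt
    obtain ⟨a, b, u, e₁, hl, hab, rfl⟩ := h
    have c₁ := hb.context [a] [] r.1 (Or.inl (by simp [e₁])) (by
      rw [e₁]
      exact Or.inr (by simpa using sLt_cons_iff.2 hlt))
    have lt₂ : SLt ([] ++ [a, ι a] ++ r.2) r.1 := by
      rw [e₁]
      exact sLt_cons_iff.2 hlt
    have lt₃ : SLt [a, ι a] r.1 := by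
      rw [e₁]
      refine sLt_cons_iff.2 ?_
      have : SLt [ι a] [b] := sLt_cons_cons rfl hab
      exact sLt_of_lt_of_le this (sLe_of_isInfix ⟨[], u, by simp⟩)
    have c₂ := (hs a (sLt_of_lt_of_le lt₃ hm)).conn (B := (SLe · z)) [] r.2 fun w hw =>
      (hw.trans (Or.inr lt₂)).trans h₁
    simp only [List.append_nil, List.cons_append, List.nil_append] at c₁ c₂
    rw [e₁] at c₁ h₁ ⊢
    exact (Conn.mono (fun w hw => SLe.trans hw h₁) c₁).trans _ _ _ c₂
  · have := hb.context [x] [] z (by simpa [e₁] using h₁) (by simpa [e₂] using h₂)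
    simpa [e₁, e₂] using this
  · have := hb.context [] [x] z (by simpa [e₁] using h₁) (by simpa [e₂] using h₂)
    simpa [e₁, e₂] using this

/-- The loop is run backwards, from the output to the input. Right-hand sides stay below `m`, so the
rules that reduce them have left-hand sides strictly below `m`. In the application `m` is the
left-hand side of the rule being minimized, hence the strict inequality in `hQ`. -/
theorem MinLoop.bounded [Finite A] {P Q : Set (Rule A)} {ι : A → A} (hι : Function.Involutive ι)
    {T : Set (Rule A)} (hT : Decreasing T) {S S' : Store A} {r r' : Rule A} {m : List A}
    (hS : Decreasing (S.all : Set (Rule A))) (h : MinLoop ι T S r S' r')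
    (hQ : ∀ r ∈ Q, SLt r.1 m → Follows P r) (hs : ∀ x, ([x, ι x], []) ∈ Q)
    (hSQ : (S'.all : Set (Rule A)) ⊆ Q) (h₁ : SLe r.1 m) (h₂ : SLt r.2 m)
    (hb : Bounded P r') : Bounded P r := by
  induction h with
  | halt => exact hb
  | again h _ h' ih =>
    obtain ⟨g, d, r₄, v, hp, hv, -, rfl⟩ := h.spec hT hS h₁ (Or.inr h₂)
    have hb₄ : SLe r₄.1 m ∧ SLt r₄.2 m := by
      rcases eq_or_lt_of_preSteps hp with rfl | ⟨-, -, -, h⟩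
      · exact ⟨h₁, h₂⟩
      · exact ⟨Or.inr (h m h₁ (Or.inr h₂)).1, (h m h₁ (Or.inr h₂)).2⟩
    have hle := sLe_of_reflTransGen d hv
    have hvz : SLt v m := hle.trans_lt hb₄.2
    have hbo : SLe (orient r₄.1 v).1 m ∧ SLt (orient r₄.1 v).2 m := by
      rcases orient_cases r₄.1 v with ⟨h, -⟩ | ⟨h, hlt⟩
      · rw [h]; exact ⟨hb₄.1, hvz⟩
      · rw [h]; exact ⟨Or.inr hvz, sLt_trans hlt hvz⟩
    have g' := (h'.spec hT d hbo.1 hbo.2).1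
    have b₁ : Bounded P (r₄.1, v) := by
      have := ih d hSQ hbo.1 hbo.2 hb
      rcases orient_cases r₄.1 v with ⟨h, -⟩ | ⟨h, -⟩
      · rwa [h] at this
      · rw [h] at this; exact this.swap
    have b₂ : Bounded P r₄ := by
      intro z hz₁ hz₂
      refine (b₁ z hz₁ (hle.trans hz₂)).trans _ _ _ (Relation.EqvGen.symm _ _ ?_)
      refine conn_of_reflTransGen (m := r₄.2) d (fun r hr hrm => ?_) hv (SLe.refl _)
        (fun w hw => hw.trans hz₂)
      exact hQ r (hSQ (Finset.coe_subset.2 g'.all_subset hr)) (hrm.trans_lt hb₄.2)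
    have hback : ∀ a b : Rule A, Relation.ReflTransGen (PreStep ι) a b → SLe a.1 m →
        Bounded P b → Bounded P a := by
      intro a b hab ha hbb
      induction hab using Relation.ReflTransGen.head_induction_on with
      | refl => exact hbb
      | head h _ ih =>
        exact h.bounded hι (fun x hx => hQ _ (hs x) hx) ha
          (ih (Or.inr (sLt_of_lt_of_le (sLt_of_length_lt h.length_lt) ha)))
    exact hback _ _ hp h₁ b₂

end Reduction

section Handling

variable {A : Type*} [LinearOrder A]

/-! ### The outcome of minimizing one rule -/

/-- The outcome `out` of minimizing `r`, with the store `S₂` just before the output is handled;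
`b` says whether the left-hand side was affected by the first steps. -/
structure Outcome (ι : A → A) (T : Set (Rule A)) (S S₂ : Store A) (r out : Rule A) (b : Bool) :
    Prop where
  grow : Grow (Fresh T r.1) S S₂
  dec : Decreasing (S₂.all : Set (Rule A))
  out_min : out = ([], []) ∨ TMin ι T out
  affected : b = true → ¬ ProperIrr T r.1 ∧ SLt out.1 r.1 ∧
    ∃ r' ∈ S₂.all, r'.1 <:+: r.1 ∧ r'.1 ≠ r.1
  unaffected : b = false → ProperIrr T r.1 ∧ TMin ι T out ∧ out.1 <:+: r.1 ∧ (out.1 = r.1 →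
    Relation.ReflTransGen (Rewrites (S₂.all : Set (Rule A))) r.2 out.2)
  stable : TMin ι T r → out = r
  follows : ∀ P Q : Set (Rule A), (∀ r' ∈ Q, SLt r'.1 r.1 → Follows P r') →
    (∀ x, ([x, ι x], []) ∈ Q) → (S₂.all : Set (Rule A)) ⊆ Q → Bounded P out → Follows P r

theorem MinimizeAndHandle.outcome [Finite A] {ι : A → A} (hι : Function.Involutive ι)
    {T : Set (Rule A)} (hT : Decreasing T) {S S' : Store A} {M M' : WDiff A} {r : Rule A}
    (hS : Decreasing (S.all : Set (Rule A))) (hr : SLt r.2 r.1)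
    (h : MinimizeAndHandle ι T S M r S' M') :
    ∃ S₂ out b, Outcome ι T S S₂ r out b ∧ S' = handle S₂ r out b ∧
      ((out = ([], []) ∧ M' = M) ∨ (out ≠ ([], []) ∧ Sew ι T S₂ M out M')) ∧
      ∀ {G : Type _} [Group G] (g : A → G), (∀ x, g (ι x) = (g x)⁻¹) →
        (∀ r ∈ T, val g r.1 = val g r.2) → (∀ r ∈ S.all, val g r.1 = val g r.2) →
        val g r.1 = val g r.2 → val g out.1 = val g out.2 := by
  obtain ⟨S₁, u, S₂, out, hp, hl, hsew, rfl⟩ := h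
  obtain ⟨g₁, d₁, hcase⟩ := hp.spec hT hS
  have hu : SLe u r.1 ∧ Relation.ReflTransGen (Rewrites (S₁.all : Set (Rule A))) r.1 u := by
    rcases hcase with ⟨rfl, -⟩ | ⟨-, x, w, w', y, he, -, -, -, h₁, h₂⟩
    · exact ⟨SLe.refl _, .refl⟩
    · have : Relation.ReflTransGen (Rewrites (S₁.all : Set (Rule A))) r.1 u := by
        rw [he]
        exact (reflTransGen_context h₁ x y).trans h₂
      exact ⟨sLe_of_reflTransGen d₁ this, this⟩
  obtain ⟨g₂, d₂, l₁, l₂, no, irr, hlt⟩ := hl.spec hT d₁ hu.1 hr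
  have hsub : (S₁.all : Set (Rule A)) ⊆ S₂.all := Finset.coe_subset.2 g₂.all_subset
  have haff : u ≠ r.1 → ¬ ProperIrr T r.1 ∧ SLt out.1 r.1 ∧ IsIrred T out.1 ∧
      ∃ r' ∈ S₂.all, r'.1 <:+: r.1 ∧ r'.1 ≠ r.1 := by
    intro hne
    rcases hcase with ⟨h, -⟩ | ⟨hirr, x, w, w', y, he, hw, hne', hred, h₁, h₂⟩
    · exact absurd h hne
    have hwi : w <:+: r.1 := ⟨x, y, he.symm⟩
    refine ⟨fun hproper => hred (hproper w hwi hw.ne), ?_, ?_⟩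
    -- The reduced string `u` and the right-hand side both lie strictly below the old left-hand
    -- side; their maximum bounds the output.
    · have : ∃ z, SLe u z ∧ SLe r.2 z ∧ SLt z r.1 := by
        obtain ⟨m, h₁, h₂, h₃⟩ := exists_max u r.2
        refine ⟨m, h₁, h₂, ?_⟩
        rcases h₃ with rfl | rfl
        · exact hu.1.resolve_left hne
        · exact hr
      obtain ⟨z, hz₁, hz₂, hz⟩ := this
      exact (hl.isIrred hT d₁ (z := z) hz₁ hz₂ hirr).2.2.trans_lt hz
    · refine ⟨(hl.isIrred hT d₁ hu.1 (Or.inr hr) hirr).1, ?_⟩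
      -- The reduction of `w` is nontrivial, so a stored rule has its left-hand side inside `w`,
      -- hence below `r.1`.
      obtain ⟨r', hr', hi⟩ := not_isIrred_iff.1 (not_isIrred_of_reflTransGen h₁ hne')
      refine ⟨r', hsub hr', hi.trans hwi, ?_⟩
      rintro h
      have := sLe_of_isInfix hi
      rw [h] at this
      exact sLt_irrefl _ (this.trans_lt hw)
  have hunaff : u = r.1 → ProperIrr T r.1 ∧ TMin ι T out ∧ out.1 <:+: r.1 ∧ (out.1 = r.1 →
      Relation.ReflTransGen (Rewrites (S₂.all : Set (Rule A))) r.2 out.2) := by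
    intro he
    have hproper : ProperIrr T r.1 := by
      rcases hcase with ⟨-, h⟩ | ⟨hirr, -⟩
      · exact h
      · rw [he] at hirr; exact hirr.properIrr
    subst he
    exact ⟨hproper, hl.properIrr hT d₁ hproper hr⟩
  refine ⟨S₂, out, decide (u ≠ r.1), ⟨g₁.trans g₂, d₂, ?_, ?_, ?_, ?_, ?_⟩, rfl, hsew, ?_⟩
  · by_cases he : u = r.1
    · exact Or.inr (hunaff he).2.1
    · rcases hlt with hlt | hlt
      · exact Or.inr ⟨hlt, no, irr, (haff he).2.2.1.properIrr⟩
      · exact Or.inl hlt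
  · intro h
    obtain ⟨h₁, h₂, -, h₃⟩ := haff (of_decide_eq_true h)
    exact ⟨h₁, h₂, h₃⟩
  · intro h
    exact hunaff (by simpa using h)
  · intro hmin
    have := hp.eq_of_properIrr hmin.lhs
    subst this
    exact hl.eq_of_tMin hmin
  · intro P Q hQ hs hSQ hb
    have hb' := hl.bounded hι hT d₁ hQ hs hSQ hu.1 hr hb
    have c₁ : Conn P (SLe · r.1) u r.2 := hb' r.1 hu.1 (Or.inr hr)
    refine Relation.EqvGen.trans _ _ _ ?_ c₁
    rcases hcase with ⟨rfl, -⟩ | ⟨-, x, w, w', y, he, hw, hne, -, h₁, h₂⟩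
    · exact .refl _
    -- The connection runs through `x w y`, `x w' y`, `u` and `r.2`. The rules used up to `u` act on
    -- `w` or on `x w' y`, both below `r.1`.
    · have fol : ∀ m, SLt m r.1 → ∀ r' ∈ (S₁.all : Set (Rule A)), SLe r'.1 m → Follows P r' :=
        fun m hm r' hr' hle => hQ r' (hSQ (hsub hr')) (hle.trans_lt hm)
      have hw' : SLt (x ++ w' ++ y) r.1 := by
        rw [he]
        exact ((sLe_of_reflTransGen d₁ h₁).resolve_left hne).context x y
      have c₂ : Conn P (SLe · w) w w' :=
        conn_of_reflTransGen d₁ (fol w hw) h₁ (SLe.refl _) fun _ h => h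
      have c₃ : Conn P (SLe · r.1) (x ++ w' ++ y) u :=
        conn_of_reflTransGen d₁ (fol _ hw') h₂ (SLe.refl _) fun _ h => h.trans (Or.inr hw')
      have c₄ : Conn P (SLe · r.1) (x ++ w ++ y) (x ++ w' ++ y) :=
        c₂.context x y fun a ha => by rw [he]; exact SLe.context ha x y
      rw [he] at c₃ c₄ ⊢
      exact c₄.trans _ _ _ c₃
  · intro G _ g hg hTv hSv hrv
    have hSv₁ := g₁.forall_mem (p := fun r => val g r.1 = val g r.2)
      (fun r hr => hTv r hr.1) hSv
    refine hl.val hg hT hTv d₁ hSv₁ hu.1 (Or.inr hr) ?_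
    rw [← val_eq_of_reflTransGen g hSv₁ hu.2]
    exact hrv

/-! ### Handling the output -/

theorem mem_considered_handle {S : Store A} {r out r' : Rule A} {b : Bool} :
    r' ∈ (handle S r out b).considered ↔ r' ∈ S.considered ∧ (r' = r → out = r) := by
  unfold handle
  split
  · split <;> simp [*]
  · simp only [Finset.mem_erase]
    tauto

theorem mem_newRules_handle {S : Store A} {r out r' : Rule A} {b : Bool} :
    r' ∈ (handle S r out b).newRules ↔
      r' ∈ S.newRules ∧ (r' = r → out = r ∧ r ∈ S.considered) := by
  unfold handle
  split
  · split
    · simp [*]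
    · simp only [Finset.mem_erase]
      tauto
  · simp only [Finset.mem_erase]
    tauto

theorem mem_thisPass_handle {S : Store A} {r out r' : Rule A} {b : Bool} :
    r' ∈ (handle S r out b).thisPass ↔
    r' ∈ S.thisPass ∨ (r' = out ∧ out = r ∧ r ∉ S.considered) ∨
      (r' = out ∧ out ≠ r ∧ out ≠ ([], []) ∧ out ∉ S.all) := by
  unfold handle
  split
  · rename_i h
    subst h
    split
    · simp [*]
    · simp only [Finset.mem_insert]
      tauto
  · simp only
    split
    · tauto
    · simp only [Finset.mem_insert]
      tauto

theorem mem_toDelete_handle {S : Store A} {r out r' : Rule A} {b : Bool} :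
    r' ∈ (handle S r out b).toDelete ↔
    r' ∈ S.toDelete ∨ (r' = r ∧ out ≠ r ∧ b = false) := by
  unfold handle
  split
  · split <;> simp [*]
  · cases b with
    | true => simp
    | false =>
      simp only [Bool.false_eq_true, ↓reduceIte, Finset.mem_insert, ne_eq]
      tauto

theorem mem_of_mem_handle {S : Store A} {r out r' : Rule A} {b : Bool} (hr : r ∈ S.all)
    (h : r' ∈ (handle S r out b).all) :
    r' ∈ S.all ∨ (r' = out ∧ out ≠ ([], []) ∧ out ≠ r) := by
  rw [Store.mem_all, mem_considered_handle, mem_newRules_handle, mem_thisPass_handle,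
    mem_toDelete_handle] at h
  rcases h with h | (h | ⟨h, h', -⟩ | h) | h | h | ⟨rfl, -⟩
  · exact Or.inl (Store.mem_all.2 (by tauto))
  · exact Or.inl (Store.mem_all.2 (by tauto))
  · rw [h, h']
    exact Or.inl hr
  · tauto
  · exact Or.inl (Store.mem_all.2 (by tauto))
  · exact Or.inl (Store.mem_all.2 (by tauto))
  · exact Or.inl hr

/-- Only an affected input can be lost; any other replaced input is kept in `Delete`. -/
theorem mem_handle {S : Store A} {r out r' : Rule A} {b : Bool} (h : r' ∈ S.all) :
    r' ∈ (handle S r out b).all ∨ (r' = r ∧ out ≠ r ∧ b = true) := by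
  rw [Store.mem_all, mem_considered_handle, mem_newRules_handle, mem_thisPass_handle,
    mem_toDelete_handle]
  rw [Store.mem_all] at h
  by_cases h₁ : r' = r
  · subst h₁
    by_cases h₂ : out = r'
    · subst h₂
      tauto
    · cases b <;> tauto
  · tauto

theorem out_mem_handle {S : Store A} {r out : Rule A} {b : Bool} (hout : out ≠ ([], []))
    (hne : out ≠ r) : out ∈ (handle S r out b).all := by
  by_cases h : out ∈ S.all
  · rcases mem_handle (r := r) (out := out) (b := b) h with h | h
    · exact h
    · exact absurd h.1 hne
  · rw [Store.mem_all, mem_thisPass_handle]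
    tauto

/-! ### Relabelling at the end of a pass -/

theorem isIrred_nil {T : Set (Rule A)} (hT : Decreasing T) : IsIrred T [] := by
  rw [isIrred_iff]
  intro r hr h
  have := hT r hr
  rw [List.eq_nil_of_infix_nil h] at this
  exact not_sLt_nil _ this

theorem ReduceList.spec [Finite A] {G : Type*} [Group G] (g : A → G) {T : Set (Rule A)}
    (hT : Decreasing T) (hTv : ∀ r ∈ T, val g r.1 = val g r.2) {S S' : Store A}
    {l l' : List (List A)} (hS : Decreasing (S.all : Set (Rule A)))
    (hSv : ∀ r ∈ S.all, val g r.1 = val g r.2) (h : ReduceList T S l S' l') :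
    Grow (fun r => r ∈ T ∧ ProperIrr T r.1) S S' ∧
      List.Forall₂ (fun w w' => val g w' = val g w ∧ (IsIrred T w → w' = w)) l l' := by
  induction h with
  | nil S => exact ⟨Grow.refl _ _, .nil⟩
  | cons h _ ih =>
    obtain ⟨g₁, d₁, r₁, -⟩ := h.spec hT hS (SLe.refl _)
    have hSv₁ := g₁.forall_mem (p := fun r => val g r.1 = val g r.2)
      (fun r hr => hTv r hr.1) hSv
    obtain ⟨g₂, f₂⟩ := ih d₁ hSv₁
    refine ⟨(g₁.mono fun r hr => ⟨hr.1, hr.2.1⟩).trans g₂, .cons ⟨?_, ?_⟩ f₂⟩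
    · exact (val_eq_of_reflTransGen g hSv₁ r₁).symm
    · exact fun hi => (h.eq_of_isIrred hi).2

theorem mem_states {E : Finset (Arrow A)} {a : Arrow A} (ha : a ∈ E) :
    a.1 ∈ states E ∧ a.2.2 ∈ states E := by
  simp only [states, Finset.mem_insert, Finset.mem_union, Finset.mem_image]
  exact ⟨Or.inr (Or.inl ⟨a, ha, rfl⟩), Or.inr (Or.inr ⟨a, ha, rfl⟩)⟩

/-- The rules recorded while the labels of an automaton are reduced at the end of a pass: they
are minimal with respect to an automaton which reads everything that `M` reads. -/
def Late {G : Type*} [Group G] (g : A → G) (M : WDiff A) (r : Rule A) : Prop :=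
  ∃ E, NoDiag E ∧ (∀ a ∈ E, ValArrow g a) ∧ (∀ r', WRead M.needed r' → WRead E r') ∧
    r ∈ ruleSet E ∧ ProperIrr (ruleSet E) r.1

/-- Reducing labels preserves their values and fixes the empty label, so weak readings can be
renamed and then welded. The rules recorded in a round come from the whole automaton of that round,
which contains the needed arrows; this is the `E` of `Late`. -/
theorem relabel_spec [Finite A] {G : Type*} [Group G] (g : A → G) {S S' : Store A}
    {M M' : WDiff A} (hS : Decreasing (S.all : Set (Rule A)))
    (hSv : ∀ r ∈ S.all, val g r.1 = val g r.2) (hM : GoodAut g M)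
    (h : Relation.ReflTransGen RelabelRound (S, M) (S', M')) :
    Grow (Late g M) S S' ∧ GoodAut g M' ∧ ∀ r, WRead M.needed r → WRead M'.needed r := by
  have key : ∀ c, Relation.ReflTransGen RelabelRound (S, M) c →
      Grow (Late g M) S c.1 ∧ GoodAut g c.2 ∧ ∀ r, WRead M.needed r → WRead c.2.needed r := by
    intro c hc
    induction hc with
    | refl => exact ⟨Grow.refl _ _, hM, fun _ h => h⟩
    | @tail c c' _ h ih =>
      obtain ⟨gr, good, rd⟩ := ih
      have dec := gr.forall_mem (p := fun r => SLt r.2 r.1)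
        (fun r ⟨E, _, _, _, hr, _⟩ => decreasing_ruleSet E r hr) hS
      have hval := gr.forall_mem (p := fun r => val g r.1 = val g r.2)
        (fun r ⟨E, _, hE, _, hr, _⟩ => val_eq_of_mem_ruleSet g hE hr) hSv
      obtain ⟨-, l, f, -, hl, hred, hc'⟩ := h
      obtain ⟨gr', hf⟩ := hred.spec g (decreasing_ruleSet _)
        (fun r hr => val_eq_of_mem_ruleSet g good.val hr) dec hval
      rw [List.forall₂_map_right_iff, List.forall₂_same] at hf
      have hf' : ∀ s ∈ states c.2.arrows, val g (f s) = val g s ∧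
          (IsIrred (ruleSet c.2.arrows) s → f s = s) := by
        intro s hs
        rw [← hl, List.mem_toFinset] at hs
        exact hf s hs
      have hf0 : f [] = [] := (hf' [] (by simp [states])).2 (isIrred_nil (decreasing_ruleSet _))
      have hsub := renameArrows_subset (f := f) good.sub
      refine ⟨gr.trans (gr'.mono fun r hr => ⟨c.2.arrows, good.noDiag, good.val,
        fun r' hr' => (rd r' hr').subset good.sub, hr⟩), ?_, fun r hr => ?_⟩
      · rw [hc']
        refine goodAut_weld g hsub (valArrow_rename g good.val fun a ha => ?_) (by simp)
        exact ⟨(hf' _ (mem_states ha).1).1, (hf' _ (mem_states ha).2).1⟩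
      · rw [hc']
        exact ((rd r hr).map hf0 fun a ha => wArrow_mapArrow_rename hf0 ha).weld
          (M := ⟨renameArrows f c.2.arrows, renameArrows f c.2.needed⟩) hsub _
  exact key _ h

end Handling

section CriticalPairs

variable {A : Type*} {G : Type*} [Group G]

/-! ### Critical pairs -/

/-- Both strings are no longer than the four sides of the two rules together. Finiteness makes the
comparisons for one rule come to an end. -/
theorem finite_criticalPairs [Finite A] (r : Rule A) (C : Finset (Rule A)) :
    (criticalPairs r (C : Set (Rule A))).Finite := by
  have : criticalPairs r (C : Set (Rule A)) ⊆ ⋃ r' ∈ (C : Set (Rule A)),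
      {l : List A | l.length ≤ r.1.length + r.2.length + r'.1.length + r'.2.length} ×ˢ
      {l : List A | l.length ≤ r.1.length + r.2.length + r'.1.length + r'.2.length} := by
    rintro c ⟨r', hr', s₁, z, s₂, -, h⟩
    refine Set.mem_biUnion hr' ?_
    rcases h with ⟨h₁, h₂, rfl⟩ | ⟨h₁, h₂, rfl⟩ <;>
    · have h₁ := congrArg List.length h₁
      have h₂ := congrArg List.length h₂
      simp only [List.length_append] at h₁ h₂
      simp only [Set.mem_prod, Set.mem_ofPred_eq, List.length_append]
      omega
  refine Set.Finite.subset (Set.Finite.biUnion C.finite_toSet fun r' _ => ?_) this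
  exact (List.finite_length_le A _).prod (List.finite_length_le A _)

theorem val_criticalPairs {g : A → G} {r : Rule A} {C : Set (Rule A)}
    (hr : val g r.1 = val g r.2) (hC : ∀ r ∈ C, val g r.1 = val g r.2) :
    ∀ p ∈ criticalPairs r C, val g p.1 = val g p.2 := by
  rintro c ⟨r', hr', s₁, z, s₂, -, h⟩
  have hr' := hC r' hr'
  rcases h with ⟨h₁, h₂, rfl⟩ | ⟨h₁, h₂, rfl⟩ <;>
  · have e₁ := congrArg (val g) h₁
    have e₂ := congrArg (val g) h₂
    simp only [val_append] at *
    rw [← hr, ← hr', e₁, e₂, mul_assoc]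

end CriticalPairs

section Invariants

variable {A : Type*} [LinearOrder A] {G : Type*} [Group G]

/-! ### Invariants of the procedure -/

/-- Everything stored is a consequence of the defining equalities, rules are decreasing, and `New`
is disjoint from `Considered` and `This`. -/
structure Core (g : A → G) (E : Finset (Arrow A)) (M : WDiff A) (S : Store A) : Prop where
  dec : Decreasing (S.all : Set (Rule A))
  val : ∀ r ∈ S.all, val g r.1 = val g r.2
  aut : GoodAut g M
  rules : ∀ a ∈ E, ValArrow g a
  disj : ∀ r ∈ S.newRules, r ∉ S.considered ∧ r ∉ S.thisPass

/-- During a pass each rule in `Delete` has been replaced by a minimal rule. -/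
def DelPass (ι : A → A) (T : Set (Rule A)) (S : Store A) : Prop :=
  ∀ r ∈ S.toDelete, ¬ TMin ι T r ∧ ∃ r₁ ∈ S.all, TMin ι T r₁ ∧ r₁.1 <:+: r.1

/-- The part of the invariant that depends on the point reached in a pass. -/
def PhaseInv (g : A → G) (ι : A → A) (c : Config A) : Prop :=
  match c.phase with
  | .start => ∀ r ∈ c.store.toDelete, ∃ r₁ ∈ c.store.all, r₁ ∉ c.store.toDelete ∧ r₁.1 <:+: r.1
  | .minimizeConsidered todo =>
      DelPass ι (ruleSet c.rules) c.store ∧ ∀ r ∈ todo, r ∈ c.store.considered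
  | .minimizeNew => DelPass ι (ruleSet c.rules) c.store
  | .takeThis => DelPass ι (ruleSet c.rules) c.store
  | .compare todo => DelPass ι (ruleSet c.rules) c.store ∧ todo.Finite ∧
      ∀ p ∈ todo, val g p.1 = val g p.2

/-- The invariant. -/
def Inv (g : A → G) (ι : A → A) (c : Config A) : Prop :=
  Core g c.rules c.wdiff c.store ∧ PhaseInv g ι c

theorem Grow.core {Q : Rule A → Prop} {g : A → G} {E : Finset (Arrow A)} {M : WDiff A}
    {S S' : Store A} (h : Grow Q S S') (hQ : ∀ r, Q r → SLt r.2 r.1 ∧ val g r.1 = val g r.2)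
    (hc : Core g E M S) : Core g E M S' := by
  refine ⟨h.forall_mem (p := fun r => SLt r.2 r.1) (fun r hr => (hQ r hr).1) hc.dec,
    h.forall_mem (p := fun r => RapidKB.val g r.1 = RapidKB.val g r.2)
      (fun r hr => (hQ r hr).2) hc.val, hc.aut, hc.rules, fun r hr => ?_⟩
  rw [h.considered, h.thisPass]
  rcases h.fresh r hr with h' | ⟨h', -⟩
  · exact hc.disj r h'
  · have := h' r.2
    rw [Store.mem_all] at this
    tauto

theorem Grow.delPass {Q : Rule A → Prop} {ι : A → A} {T : Set (Rule A)}
    {S S' : Store A} (h : Grow Q S S') (hc : DelPass ι T S) : DelPass ι T S' := by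
  intro r hr
  rw [h.toDelete] at hr
  obtain ⟨h₁, r₁, h₂, h₃⟩ := hc r hr
  exact ⟨h₁, r₁, h.all_subset h₂, h₃⟩

theorem Fresh.sound {g : A → G} {E : Finset (Arrow A)} (hE : ∀ a ∈ E, ValArrow g a)
    {z : List A} (r : Rule A) (hr : Fresh (ruleSet E) z r) :
    SLt r.2 r.1 ∧ val g r.1 = val g r.2 :=
  ⟨decreasing_ruleSet E r hr.1, val_eq_of_mem_ruleSet g hE hr.1⟩

theorem Late.sound {g : A → G} {M : WDiff A} (r : Rule A) (hr : Late g M r) :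
    SLt r.2 r.1 ∧ val g r.1 = val g r.2 := by
  obtain ⟨E, -, hE, -, hr, -⟩ := hr
  exact ⟨decreasing_ruleSet E r hr, val_eq_of_mem_ruleSet g hE hr⟩

/-- The replacement is minimal, and no rule in `Delete` is. The conclusion no longer mentions `T`,
so it survives the change of `Rules` at the end of a pass. -/
theorem DelPass.toStart {ι : A → A} {T : Set (Rule A)} {S : Store A} (h : DelPass ι T S) :
    ∀ r ∈ S.toDelete, ∃ r₁ ∈ S.all, r₁ ∉ S.toDelete ∧ r₁.1 <:+: r.1 := by
  intro r hr
  obtain ⟨-, r₁, h₁, h₂, h₃⟩ := h r hr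
  exact ⟨r₁, h₁, fun h' => (h r₁ h').1 h₂, h₃⟩

theorem RReduce.grow [Finite A] {g : A → G} {E : Finset (Arrow A)} {M : WDiff A} {S S' : Store A}
    (hc : Core g E M S) {w w' : List A} (h : RReduce (ruleSet E) S w S' w') :
    Grow (Fresh (ruleSet E) w) S S' ∧ Core g E M S' ∧
      Relation.ReflTransGen (Rewrites (S'.all : Set (Rule A))) w w' ∧
      IsIrred (ruleSet E) w' ∧ val g w = val g w' := by
  obtain ⟨h₁, -, h₃, h₄⟩ := h.spec (decreasing_ruleSet E) hc.dec (SLe.refl w)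
  have hc' := h₁.core (Fresh.sound hc.rules) hc
  exact ⟨h₁, hc', h₃, h₄, val_eq_of_reflTransGen g hc'.val h₃⟩

theorem Store.record_spec (S : Store A) (r : Rule A) :
    (S.record r).considered = S.considered ∧ (S.record r).thisPass = S.thisPass ∧
      (S.record r).toDelete = S.toDelete ∧
      ∀ r', r' ∈ (S.record r).newRules ↔ r' ∈ S.newRules ∨ (r' = r ∧ r ∉ S.all) := by
  unfold Store.record
  split
  · refine ⟨rfl, rfl, rfl, ?_⟩
    tauto
  · refine ⟨rfl, rfl, rfl, fun r' => ?_⟩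
    simp only [Finset.mem_insert]
    tauto

theorem Core.record {g : A → G} {E : Finset (Arrow A)} {M : WDiff A} {S : Store A}
    (hc : Core g E M S) {r : Rule A} (h₁ : SLt r.2 r.1)
    (h₂ : RapidKB.val g r.1 = RapidKB.val g r.2) : Core g E M (S.record r) := by
  obtain ⟨e₁, e₂, -, e₄⟩ := S.record_spec r
  refine ⟨fun r' hr' => ?_, fun r' hr' => ?_, hc.aut, hc.rules, fun r' hr' => ?_⟩
  · rcases Store.mem_all_record.1 (Finset.mem_coe.1 hr') with rfl | h
    · exact h₁
    · exact hc.dec r' h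
  · rcases Store.mem_all_record.1 hr' with rfl | h
    · exact h₂
    · exact hc.val r' h
  · rw [e₁, e₂]
    rcases (e₄ r').1 hr' with h | ⟨rfl, h⟩
    · exact hc.disj r' h
    · rw [Store.mem_all] at h
      tauto

theorem DelPass.record {ι : A → A} {T : Set (Rule A)} {S : Store A} (h : DelPass ι T S)
    (r : Rule A) : DelPass ι T (S.record r) := by
  intro r' hr'
  rw [(S.record_spec r).2.2.1] at hr'
  obtain ⟨h₁, r₁, h₂, h₃⟩ := h r' hr'
  exact ⟨h₁, r₁, Store.mem_all_record.2 (Or.inr h₂), h₃⟩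

/-- The invariant is preserved when a rule is minimized; and all that is read by the needed part
of `WDiff` stays so. -/
theorem minimize_inv [Finite A] {g : A → G} {ι : A → A} (hι : Function.Involutive ι)
    (hg : ∀ x, g (ι x) = (g x)⁻¹) {E : Finset (Arrow A)} {M M' : WDiff A} {S S' : Store A}
    (hc : Core g E M S) (hd : DelPass ι (ruleSet E) S) {r : Rule A} (hr : r ∈ S.all)
    (h : MinimizeAndHandle ι (ruleSet E) S M r S' M') :
    Core g E M' S' ∧ DelPass ι (ruleSet E) S' ∧ ∃ S₂ out b,
      Outcome ι (ruleSet E) S S₂ r out b ∧ S' = handle S₂ r out b ∧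
      (out ≠ ([], []) → WRead M'.needed out) ∧
      (∀ r', WRead M.needed r' → WRead M'.needed r') := by
  obtain ⟨S₂, out, b, ho, rfl, hsew, hval⟩ :=
    h.outcome hι (decreasing_ruleSet E) hc.dec (hc.dec r hr)
  have hTv : ∀ r ∈ ruleSet E, val g r.1 = val g r.2 :=
    fun r hr => val_eq_of_mem_ruleSet g hc.rules hr
  have hov := hval g hg hTv hc.val (hc.val r hr)
  have hc₂ := ho.grow.core (Fresh.sound hc.rules) hc
  have hd₂ := ho.grow.delPass hd
  have hr₂ : r ∈ S₂.all := ho.grow.all_subset hr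
  have hlt : out ≠ ([], []) → SLt out.2 out.1 := fun h' => (ho.out_min.resolve_left h').lt
  have haut : GoodAut g M' ∧ (out ≠ ([], []) → WRead M'.needed out) ∧
      (∀ r', WRead M.needed r' → WRead M'.needed r') := by
    rcases hsew with ⟨h₁, rfl⟩ | ⟨h₁, h₂⟩
    · exact ⟨hc.aut, fun h => absurd h₁ h, fun _ h => h⟩
    · obtain ⟨s₁, s₂, s₃⟩ := sew_spec g hg (fun w S' t hred => (hred.grow hc₂).2.2.2.2) hc.aut hov
        (hlt h₁).length_le h₂
      exact ⟨s₁, fun _ => s₂, s₃⟩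
  refine ⟨⟨fun r' hr' => ?_, fun r' hr' => ?_, haut.1, hc.rules, fun r' hr' => ?_⟩, ?_,
    S₂, out, b, ho, rfl, haut.2⟩
  · rcases mem_of_mem_handle hr₂ (Finset.mem_coe.1 hr') with h | ⟨rfl, h, -⟩
    · exact hc₂.dec r' h
    · exact hlt h
  · rcases mem_of_mem_handle hr₂ hr' with h | ⟨rfl, h, -⟩
    · exact hc₂.val r' h
    · exact hov
  · rw [mem_newRules_handle] at hr'
    have hdis := hc₂.disj r' hr'.1
    rw [mem_considered_handle, mem_thisPass_handle]
    have hin : r' ∈ S₂.all := Store.mem_all.2 (by tauto)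
    refine ⟨fun h => hdis.1 h.1, ?_⟩
    rintro (h | ⟨h₁, h₂, h₃⟩ | ⟨h₁, -, -, h₄⟩)
    · exact hdis.2 h
    · exact h₃ (hr'.2 (h₁.trans h₂)).2
    · exact h₄ (h₁ ▸ hin)
  · intro r' hr'
    -- Minimization returns a minimal rule unchanged, so replacements found earlier in the pass
    -- remain stored.
    have keep : ∀ r₁ ∈ S₂.all, TMin ι (ruleSet E) r₁ → r₁ ∈ (handle S₂ r out b).all := by
      intro r₁ h₁ h₂
      rcases mem_handle (r := r) (out := out) (b := b) h₁ with h | ⟨rfl, h, -⟩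
      · exact h
      · exact absurd (ho.stable h₂) h
    rcases mem_toDelete_handle.1 hr' with h | ⟨rfl, h₁, h₂⟩
    · obtain ⟨h₁, r₁, h₂, h₃, h₄⟩ := hd₂ r' h
      exact ⟨h₁, r₁, keep r₁ h₂ h₃, h₃, h₄⟩
    · obtain ⟨-, hm, hi, -⟩ := ho.unaffected h₂
      refine ⟨fun h => h₁ (ho.stable h), out, ?_, hm, hi⟩
      refine out_mem_handle ?_ h₁
      rintro rfl
      exact sLt_irrefl _ hm.lt

theorem orient_spec {v w : List A} (h : v ≠ w) : SLt (orient v w).2 (orient v w).1 := by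
  rcases orient_cases v w with ⟨h₁, h₂⟩ | ⟨h₁, h₂⟩
  · rw [h₁]; exact h₂.resolve_left fun h' => h h'.symm
  · rw [h₁]; exact h₂

theorem Step.inv [Finite A] {g : A → G} {ι : A → A} (hι : Function.Involutive ι)
    (hg : ∀ x, g (ι x) = (g x)⁻¹) {c c' : Config A} (hs : Step ι c c') (h : Inv g ι c) :
    Inv g ι c' := by
  obtain ⟨hc, hp⟩ := h
  cases hs with
  | @start E M S =>
    have hsub : ∀ r ∈ ({ S with toDelete := ∅ } : Store A).all, r ∈ S.all := by
      intro r hr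
      rw [Store.mem_all] at *
      simp at hr
      tauto
    exact ⟨⟨fun r hr => hc.dec r (hsub r hr), fun r hr => hc.val r (hsub r hr), hc.aut, hc.rules,
      hc.disj⟩, fun r hr => absurd hr (by simp), fun r hr => hr⟩
  | @minimizeConsidered E M S todo r S' M' hr hm =>
    have hrS : r ∈ S.all := Store.mem_all.2 (Or.inl (hp.2 r hr))
    obtain ⟨h₁, h₂, S₂, out, b, ho, rfl, -⟩ := minimize_inv hι hg hc hp.1 hrS hm
    refine ⟨h₁, h₂, fun r' hr' => ?_⟩
    rw [Finset.mem_erase] at hr'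
    rw [mem_considered_handle, ho.grow.considered]
    exact ⟨hp.2 r' hr'.2, fun h => absurd h hr'.1⟩
  | consideredDone => exact ⟨hc, hp.1⟩
  | @minimizeNew E M S r S' M' hr hm =>
    obtain ⟨h₁, h₂, -⟩ := minimize_inv hι hg hc hp (Store.mem_all.2 (by tauto)) hm
    exact ⟨h₁, h₂⟩
  | newDone => exact ⟨hc, hp⟩
  | @takeThis E M S r hr =>
    have hall : ∀ r', r' ∈ (⟨insert r S.considered, S.thisPass.erase r, S.newRules,
        S.toDelete⟩ : Store A).all ↔ r' ∈ S.all := by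
      intro r'
      simp only [Store.mem_all, Finset.mem_insert, Finset.mem_erase]
      by_cases h : r' = r
      · subst h; tauto
      · tauto
    have hrS : r ∈ S.all := Store.mem_all.2 (by tauto)
    refine ⟨⟨fun r' hr' => hc.dec r' ((hall r').1 hr'), fun r' hr' => hc.val r' ((hall r').1 hr'),
      hc.aut, hc.rules, fun r' hr' => ?_⟩, fun r' hr' => ?_, finite_criticalPairs _ _,
      val_criticalPairs (hc.val r hrS) fun r' hr' => hc.val r' ?_⟩
    · have := hc.disj r' hr'
      simp only [Finset.mem_insert, Finset.mem_erase]
      refine ⟨?_, by tauto⟩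
      rintro (rfl | h)
      · exact this.2 hr
      · exact this.1 h
    · obtain ⟨h₁, r₁, h₂, h₃⟩ := hp r' hr'
      exact ⟨h₁, r₁, (hall r₁).2 h₂, h₃⟩
    · rw [Finset.mem_coe, Finset.mem_insert] at hr'
      rcases hr' with rfl | h
      · exact hrS
      · exact Store.mem_all.2 (Or.inl h)
  | @compare E M S todo p S₁ v S₂ w hp' h₁ h₂ =>
    obtain ⟨hd, hf, hv⟩ := hp
    obtain ⟨g₁, c₁, -, -, v₁⟩ := h₁.grow hc
    obtain ⟨g₂, c₂, -, -, v₂⟩ := h₂.grow c₁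
    have hd₂ := g₂.delPass (g₁.delPass hd)
    have hrest : (todo \ {p}).Finite ∧ ∀ q ∈ todo \ {p}, val g q.1 = val g q.2 :=
      ⟨hf.subset Set.sdiff_subset, fun q hq => hv q hq.1⟩
    dsimp only [Inv]
    by_cases hvw : v = w
    · rw [if_pos hvw]
      exact ⟨c₂, hd₂, hrest⟩
    · rw [if_neg hvw]
      refine ⟨c₂.record (orient_spec hvw) ?_, hd₂.record _, hrest⟩
      have : val g v = val g w := by rw [← v₁, ← v₂, hv p hp']
      rcases orient_cases v w with ⟨h, -⟩ | ⟨h, -⟩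
      · rw [h]; exact this
      · rw [h]; exact this.symm
  | compareDone => exact ⟨hc, hp.1⟩
  | @finish E M S S' M' hthis hrel hirr =>
    obtain ⟨h₁, h₂, h₃⟩ := relabel_spec g hc.dec hc.val hc.aut hrel
    have hc' := h₁.core Late.sound hc
    refine ⟨⟨hc'.dec, hc'.val, ⟨by simp, h₂.noDiag.subset h₂.sub, fun a ha => h₂.val a (h₂.sub ha)⟩,
      fun a ha => h₂.val a (h₂.sub ha), hc'.disj⟩, ?_⟩
    exact (h₁.delPass hp).toStart

/-- In the step from `c` to `c'` the rule `r` is minimized and its output is another rule. -/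
def Revised (ι : A → A) (c c' : Config A) (r : Rule A) : Prop :=
  r ∈ c.store.all ∧ ∃ S₂ out b, Outcome ι (ruleSet c.rules) c.store S₂ r out b ∧
    c'.store = handle S₂ r out b ∧ out ≠ r

/-- A rule is lost only by being revised, or from `Delete` at the start of a pass. -/
theorem Step.mem_or [Finite A] {g : A → G} {ι : A → A} (hι : Function.Involutive ι)
    (hg : ∀ x, g (ι x) = (g x)⁻¹) {c c' : Config A} (hs : Step ι c c') (h : Inv g ι c)
    {r : Rule A} (hr : r ∈ c.store.all) : r ∈ c'.store.all ∨ (c.phase = .start ∧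
      r ∈ c.store.toDelete ∧ c'.store = { c.store with toDelete := ∅ }) ∨ Revised ι c c' r := by
  obtain ⟨hc, hp⟩ := h
  have min : ∀ {r₀ E M S S' M'} {ph ph' : Phase A}, Core g E M S → DelPass ι (ruleSet E) S →
      r₀ ∈ S.all → MinimizeAndHandle ι (ruleSet E) S M r₀ S' M' → r ∈ S.all →
      r ∈ S'.all ∨ Revised ι ⟨E, M, S, ph⟩ ⟨E, M', S', ph'⟩ r := by
    intro r₀ E M S S' M' ph ph' hc hd hr₀ hm hr
    obtain ⟨-, -, S₂, out, b, ho, rfl, -⟩ := minimize_inv hι hg hc hd hr₀ hm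
    rcases mem_handle (r := r₀) (out := out) (b := b) (ho.grow.all_subset hr) with
      h | ⟨rfl, h, -⟩
    · exact Or.inl h
    · exact Or.inr ⟨hr, S₂, out, b, ho, rfl, h⟩
  cases hs with
  | @start E M S =>
    dsimp only at hr ⊢
    by_cases h : r ∈ S.toDelete
    · exact Or.inr (Or.inl ⟨rfl, h, rfl⟩)
    · left
      rw [Store.mem_all] at hr ⊢
      tauto
  | minimizeConsidered hr₀ hm =>
    exact (min hc hp.1 (Store.mem_all.2 (Or.inl (hp.2 _ hr₀))) hm hr).imp_right Or.inr
  | consideredDone => exact Or.inl hr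
  | minimizeNew hr₀ hm =>
    exact (min hc hp (Store.mem_all.2 (by tauto)) hm hr).imp_right Or.inr
  | newDone => exact Or.inl hr
  | @takeThis E M S r₀ hr₀ =>
    left
    simp only [Store.mem_all, Finset.mem_insert, Finset.mem_erase] at hr ⊢
    by_cases h : r = r₀
    · subst h; tauto
    · tauto
  | @compare E M S todo p S₁ v S₂ w hp' h₁ h₂ =>
    left
    obtain ⟨g₁, c₁, -⟩ := h₁.grow hc
    obtain ⟨g₂, -⟩ := h₂.grow c₁
    have := g₂.all_subset (g₁.all_subset hr)
    dsimp only
    split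
    · exact this
    · exact Store.mem_all_record.2 (Or.inr this)
  | compareDone => exact Or.inl hr
  | finish hthis hrel hirr =>
    exact Or.inl ((relabel_spec g hc.dec hc.val hc.aut hrel).1.all_subset hr)

theorem Step.toDelete [Finite A] {g : A → G} {ι : A → A} (hι : Function.Involutive ι)
    (hg : ∀ x, g (ι x) = (g x)⁻¹) {c c' : Config A} (hs : Step ι c c') (h : Inv g ι c)
    {r : Rule A} (hr : r ∈ c'.store.toDelete) : r ∈ c.store.toDelete ∨ Revised ι c c' r := by
  obtain ⟨hc, hp⟩ := h
  have min : ∀ {r₀ E M S S' M'} {ph ph' : Phase A}, Core g E M S → DelPass ι (ruleSet E) S →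
      r₀ ∈ S.all → MinimizeAndHandle ι (ruleSet E) S M r₀ S' M' → r ∈ S'.toDelete →
      r ∈ S.toDelete ∨ Revised ι ⟨E, M, S, ph⟩ ⟨E, M', S', ph'⟩ r := by
    intro r₀ E M S S' M' ph ph' hc hd hr₀ hm hr
    obtain ⟨-, -, S₂, out, b, ho, rfl, -⟩ := minimize_inv hι hg hc hd hr₀ hm
    rw [mem_toDelete_handle, ho.grow.toDelete] at hr
    rcases hr with h | ⟨rfl, h, -⟩
    · exact Or.inl h
    · exact Or.inr ⟨hr₀, S₂, out, b, ho, rfl, h⟩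
  cases hs with
  | start => simp at hr
  | minimizeConsidered hr₀ hm =>
    exact min hc hp.1 (Store.mem_all.2 (Or.inl (hp.2 _ hr₀))) hm hr
  | consideredDone => exact Or.inl hr
  | minimizeNew hr₀ hm => exact min hc hp (Store.mem_all.2 (by tauto)) hm hr
  | newDone => exact Or.inl hr
  | takeThis => exact Or.inl hr
  | @compare E M S todo p S₁ v S₂ w hp' h₁ h₂ =>
    left
    obtain ⟨g₁, c₁, -⟩ := h₁.grow hc
    obtain ⟨g₂, -⟩ := h₂.grow c₁
    rw [← g₁.toDelete, ← g₂.toDelete]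
    dsimp only at hr
    split at hr
    · exact hr
    · rwa [(S₂.record_spec _).2.2.1] at hr
  | compareDone => exact Or.inl hr
  | finish hthis hrel hirr =>
    left
    rwa [← (relabel_spec g hc.dec hc.val hc.aut hrel).1.toDelete]

theorem Step.considered [Finite A] {g : A → G} {ι : A → A} (hι : Function.Involutive ι)
    (hg : ∀ x, g (ι x) = (g x)⁻¹) {c c' : Config A} (hs : Step ι c c') (h : Inv g ι c)
    {r : Rule A} (hr : r ∈ c.store.considered) :
    r ∈ c'.store.considered ∨ Revised ι c c' r := by
  obtain ⟨hc, hp⟩ := h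
  have min : ∀ {r₀ E M S S' M'} {ph ph' : Phase A}, Core g E M S → DelPass ι (ruleSet E) S →
      r₀ ∈ S.all → MinimizeAndHandle ι (ruleSet E) S M r₀ S' M' → r ∈ S.considered →
      r ∈ S'.considered ∨ Revised ι ⟨E, M, S, ph⟩ ⟨E, M', S', ph'⟩ r := by
    intro r₀ E M S S' M' ph ph' hc hd hr₀ hm hr
    obtain ⟨-, -, S₂, out, b, ho, rfl, -⟩ := minimize_inv hι hg hc hd hr₀ hm
    rw [mem_considered_handle, ho.grow.considered]
    by_cases h : r = r₀
    · subst h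
      by_cases h' : out = r
      · exact Or.inl ⟨hr, fun _ => h'⟩
      · exact Or.inr ⟨hr₀, S₂, out, b, ho, rfl, h'⟩
    · exact Or.inl ⟨hr, fun h' => absurd h' h⟩
  cases hs with
  | start => exact Or.inl hr
  | minimizeConsidered hr₀ hm =>
    exact min hc hp.1 (Store.mem_all.2 (Or.inl (hp.2 _ hr₀))) hm hr
  | consideredDone => exact Or.inl hr
  | minimizeNew hr₀ hm => exact min hc hp (Store.mem_all.2 (by tauto)) hm hr
  | newDone => exact Or.inl hr
  | takeThis => exact Or.inl (Finset.mem_insert_of_mem hr)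
  | @compare E M S todo p S₁ v S₂ w hp' h₁ h₂ =>
    left
    obtain ⟨g₁, c₁, -⟩ := h₁.grow hc
    obtain ⟨g₂, -⟩ := h₂.grow c₁
    rw [← g₁.considered, ← g₂.considered] at hr
    dsimp only
    split
    · exact hr
    · rwa [(S₂.record_spec _).1]
  | compareDone => exact Or.inl hr
  | finish hthis hrel hirr =>
    left
    rwa [(relabel_spec g hc.dec hc.val hc.aut hrel).1.considered]

/-- Reducibility persists. -/
theorem Step.infix [Finite A] {g : A → G} {ι : A → A} (hι : Function.Involutive ι)
    (hg : ∀ x, g (ι x) = (g x)⁻¹) {c c' : Config A} (hs : Step ι c c') (h : Inv g ι c)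
    {r : Rule A} (hr : r ∈ c.store.all) : ∃ r' ∈ c'.store.all, r'.1 <:+: r.1 := by
  rcases hs.mem_or hι hg h hr with h' | ⟨h₁, h₂, h₃⟩ | ⟨-, S₂, out, b, ho, h₃, hne⟩
  · exact ⟨r, h', List.infix_refl _⟩
  · obtain ⟨E, M, S, ph⟩ := c
    subst h₁
    obtain ⟨r₁, h₄, h₅, h₆⟩ := h.2 r h₂
    refine ⟨r₁, ?_, h₆⟩
    rw [h₃]
    rw [Store.mem_all] at h₄ ⊢
    tauto
  · rw [h₃]
    cases b with
    | true =>
      -- The rule that reduced a proper substring has another left-hand side than `r`, so handling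
      -- `r` does not remove it.
      obtain ⟨-, -, r', h₁, h₂, h₄⟩ := ho.affected rfl
      refine ⟨r', ?_, h₂⟩
      rcases mem_handle (r := r) (out := out) (b := true) h₁ with h | ⟨rfl, -⟩
      · exact h
      · exact absurd rfl h₄
    | false =>
      refine ⟨r, ?_, List.infix_refl _⟩
      rcases mem_handle (r := r) (out := out) (b := false) (ho.grow.all_subset hr) with h | h
      · exact h
      · simp at h

/-- How a new rule can arise. -/
theorem Step.source [Finite A] {g : A → G} {ι : A → A} (hι : Function.Involutive ι)
    (hg : ∀ x, g (ι x) = (g x)⁻¹) {c c' : Config A} (hs : Step ι c c') (h : Inv g ι c)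
    {r : Rule A} (hr : r ∉ c.store.all) (hr' : r ∈ c'.store.all) :
    ((∀ σ, (r.1, σ) ∉ c.store.all) ∧ (ProperIrr (ruleSet c.rules) r.1 ∨
      (c.phase = .takeThis ∧ Late g c.wdiff r))) ∨
    (ProperIrr (ruleSet c.rules) r.1 ∧ IsIrred (ruleSet c.rules) r.2) := by
  obtain ⟨hc, hp⟩ := h
  have fresh : ∀ {E S S' z} , Grow (Fresh (ruleSet E) z) S S' → r ∉ S.all → r ∈ S'.all →
      (∀ σ, (r.1, σ) ∉ S.all) ∧ ProperIrr (ruleSet E) r.1 := by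
    intro E S S' z hgr h₁ h₂
    have := (hgr.mem_all h₂).resolve_left h₁
    exact ⟨this.1, this.2.2.1⟩
  have min : ∀ {r₀ E M S S' M'}, Core g E M S → DelPass ι (ruleSet E) S →
      r₀ ∈ S.all → MinimizeAndHandle ι (ruleSet E) S M r₀ S' M' → r ∉ S.all → r ∈ S'.all →
      ((∀ σ, (r.1, σ) ∉ S.all) ∧ ProperIrr (ruleSet E) r.1) ∨
      (ProperIrr (ruleSet E) r.1 ∧ IsIrred (ruleSet E) r.2) := by
    intro r₀ E M S S' M' hc hd hr₀ hm hr hr'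
    obtain ⟨-, -, S₂, out, b, ho, rfl, -⟩ := minimize_inv hι hg hc hd hr₀ hm
    rcases mem_of_mem_handle (ho.grow.all_subset hr₀) hr' with h | ⟨rfl, h, -⟩
    · exact Or.inl (fresh ho.grow hr h)
    · have := ho.out_min.resolve_left h
      exact Or.inr ⟨this.lhs, this.rhs⟩
  cases hs with
  | start =>
    exfalso
    rw [Store.mem_all] at hr hr'
    simp at hr'
    tauto
  | minimizeConsidered hr₀ hm =>
    exact (min hc hp.1 (Store.mem_all.2 (Or.inl (hp.2 _ hr₀))) hm hr hr').imp_left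
      (And.imp_right Or.inl)
  | consideredDone => exact absurd hr' hr
  | minimizeNew hr₀ hm =>
    exact (min hc hp (Store.mem_all.2 (by tauto)) hm hr hr').imp_left (And.imp_right Or.inl)
  | newDone => exact absurd hr' hr
  | @takeThis E M S r₀ hr₀ =>
    exfalso
    simp only [Store.mem_all, Finset.mem_insert, Finset.mem_erase] at hr hr'
    by_cases h : r = r₀
    · subst h; tauto
    · tauto
  | @compare E M S todo p S₁ v S₂ w hp' h₁ h₂ =>
    obtain ⟨g₁, c₁, -, i₁, -⟩ := h₁.grow hc
    obtain ⟨g₂, c₂, -, i₂, -⟩ := h₂.grow c₁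
    have hS₂ : r ∈ S₂.all → (∀ σ, (r.1, σ) ∉ S.all) ∧ ProperIrr (ruleSet E) r.1 := by
      intro h
      by_cases h' : r ∈ S₁.all
      · exact fresh g₁ hr h'
      · have := fresh g₂ h' h
        exact ⟨fun σ hσ => this.1 σ (g₁.all_subset hσ), this.2⟩
    dsimp only at hr'
    split at hr'
    · exact Or.inl ((hS₂ hr').imp_right Or.inl)
    · rcases Store.mem_all_record.1 hr' with rfl | h
      · right
        rcases orient_cases v w with ⟨h, -⟩ | ⟨h, -⟩
        · rw [h]; exact ⟨i₁.properIrr, i₂⟩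
        · rw [h]; exact ⟨i₂.properIrr, i₁⟩
      · exact Or.inl ((hS₂ h).imp_right Or.inl)
  | compareDone => exact absurd hr' hr
  | finish hthis hrel hirr =>
    have := ((relabel_spec g hc.dec hc.val hc.aut hrel).1.mem_all hr').resolve_left hr
    exact Or.inl ⟨this.1, Or.inr ⟨rfl, this.2⟩⟩

end Invariants

section Passes

variable {A : Type*} [LinearOrder A] {G : Type*} [Group G]

/-! ### What `WDiff` reads -/

/-- The needed part of `M` reads `r`, whose sides have lengths as in `SL2`. -/
def Knows (M : WDiff A) (r : Rule A) : Prop :=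
  WRead M.needed r ∧ r.1.length ≤ r.2.length + 2

/-- After the first pass, each rule that has been treated in a pass is read by `WDiff`. -/
def ReadInv (c : Config A) : Prop :=
  match c.phase with
  | .start => c.store.thisPass = ∅
  | .minimizeConsidered todo => (∀ r ∈ c.store.considered, r ∈ todo ∨ Knows c.wdiff r) ∧
      ∀ r ∈ c.store.thisPass, Knows c.wdiff r
  | _ => ∀ r, r ∈ c.store.considered ∨ r ∈ c.store.thisPass → Knows c.wdiff r

/-- A larger difference would permit `MoveLast`. This supplies the length condition of
`WRead.not_isIrred` for outputs of minimization. -/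
theorem TMin.length_le {ι : A → A} {T : Set (Rule A)} {r : Rule A} (h : TMin ι T r) :
    r.1.length ≤ r.2.length + 2 := by
  by_contra hl
  push Not at hl
  rcases List.eq_nil_or_concat r.1 with he | ⟨u, x, he⟩
  · rw [he] at hl; simp at hl
  · rw [List.concat_eq_append] at he
    exact h.noPre (u, r.2 ++ [ι x]) (Or.inl ⟨x, he, rfl, Or.inl hl⟩)

theorem Step.thisPass_eq_empty [Finite A] {g : A → G} {ι : A → A} {c c' : Config A}
    (hs : Step ι c c') (h : Inv g ι c) (hc' : c'.phase = .start) : c'.store.thisPass = ∅ := by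
  obtain ⟨hc, -⟩ := h
  cases hs with
  | finish hthis hrel hirr =>
    have := (relabel_spec g hc.dec hc.val hc.aut hrel).1.thisPass
    rw [← hthis]
    exact this
  | _ => simp at hc'

/-- A rule enters `This` only as an output of minimization, and a treated rule stays in `Considered`
only if it is its own output. Either way it has just been sewn. Results of critical pairs go to
`New`, about which nothing is asserted. -/
theorem Step.readInv [Finite A] {g : A → G} {ι : A → A} (hι : Function.Involutive ι)
    (hg : ∀ x, g (ι x) = (g x)⁻¹) {c c' : Config A} (hs : Step ι c c') (h : Inv g ι c)
    (hr : ReadInv c) : ReadInv c' := by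
  have hthis := hs.thisPass_eq_empty h
  obtain ⟨hc, hp⟩ := h
  have min : ∀ {r₀ E M S S' M'}, Core g E M S → DelPass ι (ruleSet E) S →
      r₀ ∈ S.all → MinimizeAndHandle ι (ruleSet E) S M r₀ S' M' →
      (∀ r, Knows M r → Knows M' r) ∧
      (∀ r ∈ S'.considered, r ∈ S.considered ∧ (r = r₀ → Knows M' r)) ∧
      ∀ r ∈ S'.thisPass, r ∈ S.thisPass ∨ Knows M' r := by
    intro r₀ E M S S' M' hc hd hr₀ hm
    obtain ⟨-, -, S₂, out, b, ho, rfl, hr₁, hr₂⟩ := minimize_inv hι hg hc hd hr₀ hm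
    have hout : out ≠ ([], []) → Knows M' out := fun h =>
      ⟨hr₁ h, (ho.out_min.resolve_left h).length_le⟩
    have hne : r₀ ≠ ([], []) := by
      rintro rfl
      exact sLt_irrefl _ (hc.dec _ hr₀)
    refine ⟨fun r hr => ⟨hr₂ r hr.1, hr.2⟩, fun r hr => ?_, fun r hr => ?_⟩
    · rw [mem_considered_handle, ho.grow.considered] at hr
      refine ⟨hr.1, fun h => ?_⟩
      rw [h, ← hr.2 h]
      exact hout (by rw [hr.2 h]; exact hne)
    · rw [mem_thisPass_handle, ho.grow.thisPass] at hr
      rcases hr with h | ⟨rfl, rfl, -⟩ | ⟨rfl, -, h, -⟩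
      · exact Or.inl h
      · exact Or.inr (hout hne)
      · exact Or.inr (hout h)
  cases hs with
  | @start E M S =>
    have hr' : S.thisPass = ∅ := hr
    exact ⟨fun r h => Or.inl h, fun r h => absurd h (by simp [hr'])⟩
  | @minimizeConsidered E M S todo r₀ S' M' hr₀ hm =>
    obtain ⟨m₁, m₂, m₃⟩ := min hc hp.1 (Store.mem_all.2 (Or.inl (hp.2 _ hr₀))) hm
    obtain ⟨h₁, h₂⟩ := hr
    refine ⟨fun r h => ?_, fun r h => ?_⟩
    · obtain ⟨h₃, h₄⟩ := m₂ r h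
      by_cases he : r = r₀
      · exact Or.inr (h₄ he)
      · rw [Finset.mem_erase]
        exact (h₁ r h₃).imp (fun h => ⟨he, h⟩) (m₁ r)
    · exact (m₃ r h).elim (fun h => m₁ r (h₂ r h)) id
  | consideredDone =>
    obtain ⟨h₁, h₂⟩ := hr
    intro r h
    rcases h with h | h
    · exact (h₁ r h).resolve_left (by simp)
    · exact h₂ r h
  | minimizeNew hr₀ hm =>
    obtain ⟨m₁, m₂, m₃⟩ := min hc hp (Store.mem_all.2 (by tauto)) hm
    intro r h
    rcases h with h | h
    · exact m₁ r (hr r (Or.inl (m₂ r h).1))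
    · exact (m₃ r h).elim (fun h => m₁ r (hr r (Or.inr h))) id
  | newDone => exact hr
  | @takeThis E M S r₀ hr₀ =>
    intro r h
    simp only [Finset.mem_insert, Finset.mem_erase] at h
    rcases h with (rfl | h) | h
    · exact hr r (Or.inr hr₀)
    · exact hr r (Or.inl h)
    · exact hr r (Or.inr h.2)
  | @compare E M S todo p S₁ v S₂ w hp' h₁ h₂ =>
    obtain ⟨g₁, c₁, -⟩ := h₁.grow hc
    obtain ⟨g₂, -⟩ := h₂.grow c₁
    intro r h
    refine hr r ?_
    dsimp only at h ⊢
    rw [← g₁.considered, ← g₂.considered, ← g₁.thisPass, ← g₂.thisPass]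
    split at h
    · exact h
    · rwa [(S₂.record_spec _).1, (S₂.record_spec _).2.1] at h
  | compareDone => exact hr
  | finish => exact hthis rfl

/-- The string `w` is reducible; in the last part of a pass it is reduced by a rule in `Considered`
or `This`. -/
def Covered (w : List A) (c : Config A) : Prop :=
  (∃ r ∈ c.store.all, r.1 <:+: w) ∧
  match c.phase with
  | .takeThis | .compare _ =>
      ∃ r, (r ∈ c.store.considered ∨ r ∈ c.store.thisPass) ∧ r.1 <:+: w
  | _ => True

theorem Step.covered [Finite A] {g : A → G} {ι : A → A} (hι : Function.Involutive ι)
    (hg : ∀ x, g (ι x) = (g x)⁻¹) {c c' : Config A} (hs : Step ι c c') (h : Inv g ι c)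
    {w : List A} (hw : Covered w c) : Covered w c' := by
  obtain ⟨⟨r, hr, hrw⟩, hw'⟩ := hw
  refine ⟨?_, ?_⟩
  · obtain ⟨r', hr', hi⟩ := hs.infix hι hg h hr
    exact ⟨r', hr', hi.trans hrw⟩
  obtain ⟨hc, hp⟩ := h
  cases hs with
  | start => trivial
  | minimizeConsidered => trivial
  | consideredDone => trivial
  | minimizeNew => trivial
  -- With `New` empty, a reducing rule outside `Considered` and `This` is in `Delete`. Its minimal
  -- replacement is not in `Delete`, so that one can be used.
  | @newDone E M S hnew =>
    dsimp only at hr ⊢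
    rw [Store.mem_all, hnew] at hr
    simp only [Finset.notMem_empty, false_or] at hr
    rcases hr with hr | hr | hr
    · exact ⟨r, Or.inl hr, hrw⟩
    · exact ⟨r, Or.inr hr, hrw⟩
    · obtain ⟨-, r₁, h₁, h₂, h₃⟩ := hp r hr
      have h₄ : r₁ ∉ S.toDelete := fun h' => (hp r₁ h').1 h₂
      refine ⟨r₁, ?_, h₃.trans hrw⟩
      dsimp only at h₁
      rw [Store.mem_all, hnew] at h₁
      simp only [Finset.notMem_empty, false_or] at h₁
      tauto
  | @takeThis E M S r₀ hr₀ =>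
    obtain ⟨r, hr, hrw⟩ := hw'
    refine ⟨r, ?_, hrw⟩
    simp only [Finset.mem_insert, Finset.mem_erase]
    by_cases h : r = r₀
    · exact Or.inl (Or.inl h)
    · tauto
  | @compare E M S todo p S₁ v S₂ w hp' h₁ h₂ =>
    obtain ⟨g₁, c₁, -⟩ := h₁.grow hc
    obtain ⟨g₂, -⟩ := h₂.grow c₁
    obtain ⟨r, hr, hrw⟩ := hw'
    refine ⟨r, ?_, hrw⟩
    dsimp only at hr ⊢
    rw [← g₁.considered, ← g₂.considered, ← g₁.thisPass, ← g₂.thisPass] at hr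
    split
    · exact hr
    · rwa [(S₂.record_spec _).1, (S₂.record_spec _).2.1]
  | compareDone => exact hw'
  | finish => trivial

/-- The automaton `E` is left free for two uses: the `Rules` of the next pass, and the automata by
which labels are reduced at the end of a pass. -/
theorem Covered.not_isIrred_of_late {g : A → G} {ι : A → A} {c : Config A} (h : Inv g ι c)
    (hr : ReadInv c) {w : List A} (hw : Covered w c) (hph : c.phase = .takeThis)
    {E : Finset (Arrow A)} (hE : NoDiag E)
    (hread : ∀ r, WRead c.wdiff.needed r → WRead E r) : ¬ IsIrred (ruleSet E) w := by
  obtain ⟨R, M, S, ph⟩ := c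
  subst hph
  obtain ⟨-, r, hrS, hrw⟩ := hw
  have hk := hr r hrS
  have hmem : r ∈ S.all := Store.mem_all.2 (by tauto)
  exact fun hirr => (hread r hk.1).not_isIrred hE (h.1.dec r hmem) hk.2 (hirr.of_isInfix hrw)

/-- At the end of a pass the reducible strings become reducible with respect to `Rules`. -/
theorem Step.not_isIrred_of_covered [Finite A] {g : A → G} {ι : A → A} {c c' : Config A}
    (hs : Step ι c c') (h : Inv g ι c) (hr : ReadInv c) {w : List A} (hw : Covered w c)
    (hc' : c'.phase = .start) : ¬ IsIrred (ruleSet c'.rules) w := by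
  have h' := h
  obtain ⟨hc, hp⟩ := h
  cases hs with
  | @finish E M S S' M' hthis hrel hirr =>
    obtain ⟨-, h₂, h₃⟩ := relabel_spec g hc.dec hc.val hc.aut hrel
    exact hw.not_isIrred_of_late h' hr rfl (h₂.noDiag.subset h₂.sub) h₃
  | _ => simp at hc'

theorem Step.rules_eq [Finite A] {ι : A → A} {c c' : Config A}
    (hs : Step ι c c') (hc' : c'.phase ≠ .start) : c'.rules = c.rules := by
  cases hs with
  | finish => simp at hc'
  | _ => rfl

/-! ### Rules that are not minimal leave the store -/

/-- The rule `r` has been treated or will be treated in the current pass. -/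
def Treated (r : Rule A) (c : Config A) : Prop :=
  r ∉ c.store.thisPass ∧
  match c.phase with
  | .minimizeConsidered todo => r ∈ c.store.considered → r ∈ todo
  | .minimizeNew => r ∉ c.store.considered
  | _ => r ∉ c.store.considered ∧ r ∉ c.store.newRules

/-- A rule that is not minimal is never an output of minimization. So it does not return to `This`,
and minimizing it removes it from `Considered`; as long as it is stored it is not recorded in `New`
again. -/
theorem Step.treated [Finite A] {g : A → G} {ι : A → A} (hι : Function.Involutive ι)
    (hg : ∀ x, g (ι x) = (g x)⁻¹) {c c' : Config A} (hs : Step ι c c') (h : Inv g ι c)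
    {r : Rule A} (hr : Treated r c) (hrS : r ∈ c.store.all)
    (hmin : ¬ TMin ι (ruleSet c.rules) r) : Treated r c' := by
  obtain ⟨hc, hp⟩ := h
  have hne : r ≠ ([], []) := by
    rintro rfl
    exact sLt_irrefl _ (hc.dec _ hrS)
  have min : ∀ {r₀ E M S S' M'}, Core g E M S → DelPass ι (ruleSet E) S →
      r₀ ∈ S.all → MinimizeAndHandle ι (ruleSet E) S M r₀ S' M' →
      ¬ TMin ι (ruleSet E) r → r ∉ S.thisPass → r ∉ S'.thisPass ∧
      (r ∈ S'.considered → r ∈ S.considered ∧ r ≠ r₀) := by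
    intro r₀ E M S S' M' hc hd hr₀ hm hmin hthis
    obtain ⟨-, -, S₂, out, b, ho, rfl, -⟩ := minimize_inv hι hg hc hd hr₀ hm
    have hro : r ≠ out := by
      rintro rfl
      exact hmin (ho.out_min.resolve_left hne)
    rw [mem_thisPass_handle, mem_considered_handle, ho.grow.thisPass, ho.grow.considered]
    refine ⟨by tauto, fun h => ⟨h.1, ?_⟩⟩
    rintro rfl
    exact hro (h.2 rfl).symm
  cases hs with
  | start => exact ⟨hr.1, fun h => h⟩
  | @minimizeConsidered E M S todo r₀ S' M' hr₀ hm =>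
    obtain ⟨m₁, m₂⟩ := min hc hp.1 (Store.mem_all.2 (Or.inl (hp.2 _ hr₀))) hm hmin hr.1
    refine ⟨m₁, fun h => ?_⟩
    rw [Finset.mem_erase]
    exact ⟨(m₂ h).2, hr.2 (m₂ h).1⟩
  | consideredDone => exact ⟨hr.1, fun h => absurd (hr.2 h) (by simp)⟩
  | @minimizeNew E M S r₀ S' M' hr₀ hm =>
    obtain ⟨m₁, m₂⟩ := min hc hp (Store.mem_all.2 (by tauto)) hm hmin hr.1
    exact ⟨m₁, fun h => hr.2 (m₂ h).1⟩
  | @newDone E M S hnew => exact ⟨hr.1, hr.2, by simp [hnew]⟩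
  | @takeThis E M S r₀ hr₀ =>
    obtain ⟨h₁, h₂, h₃⟩ := hr
    refine ⟨?_, ?_, h₃⟩
    · simp only [Finset.mem_erase]; tauto
    · simp only [Finset.mem_insert]
      rintro (rfl | h)
      · exact h₁ hr₀
      · exact h₂ h
  | @compare E M S todo p S₁ v S₂ w hp' h₁ h₂ =>
    obtain ⟨g₁, c₁, -⟩ := h₁.grow hc
    obtain ⟨g₂, -⟩ := h₂.grow c₁
    obtain ⟨h₃, h₄, h₅⟩ := hr
    dsimp only at h₃ h₄ h₅ hrS
    have hn₁ : r ∉ S₁.newRules := fun h =>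
      (g₁.fresh r h).elim h₅ fun h => h.1 r.2 hrS
    have hn₂ : r ∉ S₂.newRules := fun h =>
      (g₂.fresh r h).elim hn₁ fun h => h.1 r.2 (g₁.all_subset hrS)
    have hin : r ∈ S₂.all := g₂.all_subset (g₁.all_subset hrS)
    rw [← g₁.thisPass, ← g₂.thisPass] at h₃
    rw [← g₁.considered, ← g₂.considered] at h₄
    dsimp only [Treated]
    split
    · exact ⟨h₃, h₄, hn₂⟩
    · obtain ⟨e₁, e₂, -, e₄⟩ := S₂.record_spec (orient v w)
      rw [e₁, e₂, e₄]
      refine ⟨h₃, h₄, ?_⟩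
      rintro (h | ⟨rfl, h⟩)
      · exact hn₂ h
      · exact h hin
  | compareDone => exact hr
  | @finish E M S S' M' hthis hrel hirr =>
    obtain ⟨h₃, h₄, h₅⟩ := hr
    have gr := (relabel_spec g hc.dec hc.val hc.aut hrel).1
    dsimp only at h₃ h₄ h₅ hrS
    refine ⟨?_, ?_, fun h => (gr.fresh r h).elim h₅ fun h => h.1 r.2 hrS⟩
    · dsimp only; rwa [gr.thisPass]
    · dsimp only; rwa [gr.considered]

/-! ### Each pass ends -/

variable {ι : A → A} {run : ℕ → Config A}

theorem exists_phase_minimizeNew [Finite A] (hstep : ∀ t, Step ι (run t) (run (t + 1))) (n : ℕ) :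
    ∀ t todo, (run t).phase = .minimizeConsidered todo → todo.card = n →
      ∃ s, t ≤ s ∧ (run s).phase = .minimizeNew := by
  induction n with
  | zero =>
    intro t todo hph hn
    rw [Finset.card_eq_zero] at hn
    subst hn
    refine ⟨t + 1, by omega, ?_⟩
    have hs := hstep t
    generalize run (t + 1) = c' at hs
    generalize run t = c at hs hph
    cases hs with
    | minimizeConsidered hr =>
      dsimp only at hph
      cases hph
      simp at hr
    | consideredDone => rfl
    | _ => simp at hph
  | succ n ih =>
    intro t todo hph hn
    have hs : (run (t + 1)).phase = .minimizeNew ∨ ∃ todo',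
        (run (t + 1)).phase = .minimizeConsidered todo' ∧ todo'.card = n := by
      have hs := hstep t
      generalize run (t + 1) = c' at hs
      generalize run t = c at hs hph
      cases hs with
      | minimizeConsidered hr =>
        dsimp only at hph
        cases hph
        exact Or.inr ⟨_, rfl, by rw [Finset.card_erase_of_mem hr, hn]; rfl⟩
      | consideredDone => exact Or.inl rfl
      | _ => simp at hph
    rcases hs with hs | ⟨todo', hs, hn'⟩
    · exact ⟨t + 1, by omega, hs⟩
    · obtain ⟨s, hts, h⟩ := ih (t + 1) todo' hs hn'
      exact ⟨s, by omega, h⟩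

/-- The rules in `New`, and the rules of bounded length that may still be inserted into `New`. -/
def Pending (N : ℕ) (c : Config A) : Set (Rule A) :=
  {r | r.1.length ≤ N ∧ r.2.length ≤ N ∧ (r ∈ c.store.newRules ∨
    (ProperIrr (ruleSet c.rules) r.1 ∧ r ∉ c.store.all))}

theorem finite_pending [Finite A] (N : ℕ) (c : Config A) : (Pending N c).Finite := by
  have : Pending N c ⊆ {l : List A | l.length ≤ N} ×ˢ {l : List A | l.length ≤ N} :=
    fun r hr => ⟨hr.1, hr.2.1⟩
  exact ((List.finite_length_le A N).prod (List.finite_length_le A N)).subset this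

/-- Each minimization shrinks `Pending`. The input leaves `New` and cannot be recorded again: if
affected, its left-hand side has a reducible proper substring, and otherwise it is still stored.
Rules recorded meanwhile have left-hand sides not exceeding that of the input, so they were pending
already and `N` stays valid. -/
theorem exists_phase_takeThis [Finite A] {g : A → G} (hι : Function.Involutive ι)
    (hg : ∀ x, g (ι x) = (g x)⁻¹) (hstep : ∀ t, Step ι (run t) (run (t + 1)))
    (hinv : ∀ t, Inv g ι (run t)) (N n : ℕ) :
    ∀ t, (run t).phase = .minimizeNew → (∀ r ∈ (run t).store.newRules, r.1.length ≤ N) →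
      (Pending N (run t)).ncard ≤ n → ∃ s, t ≤ s ∧ (run s).phase = .takeThis := by
  induction n with
  | zero =>
    intro t hph hN hn
    refine ⟨t + 1, by omega, ?_⟩
    have hs := hstep t
    have hc := (hinv t).1
    have hfin := finite_pending N (run t)
    generalize run (t + 1) = c' at hs
    generalize run t = c at hs hph hN hn hc hfin
    cases hs with
    | @minimizeNew E M S r S' M' hr hm =>
      exfalso
      have hempty := (Set.ncard_eq_zero hfin).1 (Nat.le_zero.1 hn)
      have hdec := hc.dec r (Store.mem_all.2 (by tauto))
      have : r ∈ Pending N ⟨E, M, S, .minimizeNew⟩ :=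
        ⟨hN r hr, hdec.length_le.trans (hN r hr), Or.inl hr⟩
      rw [hempty] at this
      exact this
    | newDone => rfl
    | _ => simp at hph
  | succ n ih =>
    intro t hph hN hn
    have hs : (run (t + 1)).phase = .takeThis ∨ ((run (t + 1)).phase = .minimizeNew ∧
        (∀ r ∈ (run (t + 1)).store.newRules, r.1.length ≤ N) ∧
        (Pending N (run (t + 1))).ncard ≤ n) := by
      have hs := hstep t
      have hi := hinv t
      have hfin := finite_pending N (run t)
      generalize run (t + 1) = c' at hs
      generalize run t = c at hs hph hN hn hi hfin
      cases hs with
      | @minimizeNew E M S r S' M' hr hm =>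
        right
        obtain ⟨hc, hp⟩ := hi
        have hrS : r ∈ S.all := Store.mem_all.2 (by tauto)
        obtain ⟨hc', hd', S₂, out, b, ho, rfl, -⟩ := minimize_inv hι hg hc hp hrS hm
        have hnew : ∀ r' ∈ (handle S₂ r out b).newRules, r' ≠ r ∧ (r' ∈ S.newRules ∨
            (r'.1.length ≤ N ∧ ProperIrr (ruleSet E) r'.1 ∧ r' ∉ S.all)) := by
          intro r' hr'
          rw [mem_newRules_handle] at hr'
          refine ⟨fun h => ?_, (ho.grow.fresh r' hr'.1).imp_right fun h => ?_⟩
          · have := (hr'.2 h).2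
            rw [ho.grow.considered] at this
            exact (hc.disj r hr).1 this
          · exact ⟨h.2.2.2.length_le.trans (hN r hr), h.2.2.1, h.1 r'.2⟩
        refine ⟨rfl, fun r' hr' => ?_, ?_⟩
        · rcases (hnew r' hr').2 with h | h
          · exact hN r' h
          · exact h.1
        · have hsub : Pending N ⟨E, M', handle S₂ r out b, .minimizeNew⟩ ⊆
              Pending N ⟨E, M, S, .minimizeNew⟩ \ {r} := by
            rintro r' ⟨h₁, h₂, h₃⟩
            rcases h₃ with h₃ | ⟨h₃, h₄⟩
            · obtain ⟨h₅, h₆⟩ := hnew r' h₃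
              exact ⟨⟨h₁, h₂, h₆.imp_right And.right⟩, h₅⟩
            · have h₅ : r' ∉ S.all ∧ r' ≠ r := by
                constructor
                · intro h
                  rcases mem_handle (r := r) (out := out) (b := b)
                    (ho.grow.all_subset h) with h' | ⟨rfl, -, rfl⟩
                  · exact h₄ h'
                  · exact (ho.affected rfl).1 h₃
                · rintro rfl
                  rcases mem_handle (r := r') (out := out) (b := b)
                    (ho.grow.all_subset hrS) with h' | ⟨-, -, rfl⟩
                  · exact h₄ h'
                  · exact (ho.affected rfl).1 h₃
              exact ⟨⟨h₁, h₂, Or.inr ⟨h₃, h₅.1⟩⟩, h₅.2⟩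
          have hmem : r ∈ Pending N ⟨E, M, S, .minimizeNew⟩ :=
            ⟨hN r hr, (hc.dec r hrS).length_le.trans (hN r hr), Or.inl hr⟩
          have h₁ := Set.ncard_le_ncard hsub (hfin.subset Set.sdiff_subset)
          have h₂ := Set.ncard_sdiff_singleton_add_one hmem hfin
          omega
      | newDone => exact Or.inl rfl
      | _ => simp at hph
    rcases hs with hs | ⟨h₁, h₂, h₃⟩
    · exact ⟨t + 1, by omega, hs⟩
    · obtain ⟨s, hts, h⟩ := ih (t + 1) h₁ h₂ h₃
      exact ⟨s, by omega, h⟩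

/-- Every comparison uses up a pair and leaves `This` alone; the size `m` is carried along for the
outer induction on `This`. -/
theorem exists_phase_takeThis_of_compare [Finite A] {g : A → G}
    (hstep : ∀ t, Step ι (run t) (run (t + 1)))
    (hinv : ∀ t, Inv g ι (run t)) (m n : ℕ) :
    ∀ t todo, (run t).phase = .compare todo → (run t).store.thisPass.card = m → todo.ncard = n →
      ∃ s, t ≤ s ∧ (run s).phase = .takeThis ∧ (run s).store.thisPass.card = m := by
  induction n with
  | zero =>
    intro t todo hph hm hn
    refine ⟨t + 1, by omega, ?_⟩
    have hs := hstep t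
    have hi := hinv t
    generalize run (t + 1) = c' at hs
    generalize run t = c at hs hph hm hi
    cases hs with
    | @compare E M S todo' p S₁ v S₂ w hp' h₁ h₂ =>
      dsimp only at hph
      cases hph
      rw [(Set.ncard_eq_zero hi.2.2.1)] at hn
      rw [hn] at hp'
      exact absurd hp' (by simp)
    | compareDone => exact ⟨rfl, hm⟩
    | _ => simp at hph
  | succ n ih =>
    intro t todo hph hm hn
    have hs : ((run (t + 1)).phase = .takeThis ∧ (run (t + 1)).store.thisPass.card = m) ∨
        ∃ todo', (run (t + 1)).phase = .compare todo' ∧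
          (run (t + 1)).store.thisPass.card = m ∧ todo'.ncard = n := by
      have hs := hstep t
      have hi := hinv t
      generalize run (t + 1) = c' at hs
      generalize run t = c at hs hph hm hi
      cases hs with
      | @compare E M S todo' p S₁ v S₂ w hp' h₁ h₂ =>
        right
        dsimp only at hph
        cases hph
        obtain ⟨g₁, c₁, -⟩ := h₁.grow hi.1
        obtain ⟨g₂, -⟩ := h₂.grow c₁
        refine ⟨_, rfl, ?_, ?_⟩
        · dsimp only
          rw [← hm]
          dsimp only
          rw [← g₁.thisPass, ← g₂.thisPass]
          split
          · rfl
          · rw [(S₂.record_spec _).2.1]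
        · have := Set.ncard_sdiff_singleton_add_one hp' hi.2.2.1
          omega
      | compareDone => exact Or.inl ⟨rfl, hm⟩
      | _ => simp at hph
    rcases hs with ⟨h₁, h₂⟩ | ⟨todo', h₁, h₂, h₃⟩
    · exact ⟨t + 1, by omega, h₁, h₂⟩
    · obtain ⟨s, hts, h⟩ := ih (t + 1) todo' h₁ h₂ h₃
      exact ⟨s, by omega, h⟩

theorem exists_phase_start_of_takeThis [Finite A] {g : A → G}
    (hstep : ∀ t, Step ι (run t) (run (t + 1)))
    (hinv : ∀ t, Inv g ι (run t)) (m : ℕ) :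
    ∀ t, (run t).phase = .takeThis → (run t).store.thisPass.card = m →
      ∃ s, t ≤ s ∧ (run s).phase = .start := by
  induction m with
  | zero =>
    intro t hph hm
    refine ⟨t + 1, by omega, ?_⟩
    have hs := hstep t
    generalize run (t + 1) = c' at hs
    generalize run t = c at hs hph hm
    cases hs with
    | takeThis hr =>
      rw [Finset.card_eq_zero] at hm
      rw [hm] at hr
      simp at hr
    | finish => rfl
    | _ => simp at hph
  | succ m ih =>
    intro t hph hm
    have hs : (run (t + 1)).phase = .start ∨ ∃ todo, (run (t + 1)).phase = .compare todo ∧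
        (run (t + 1)).store.thisPass.card = m := by
      have hs := hstep t
      generalize run (t + 1) = c' at hs
      generalize run t = c at hs hph hm
      cases hs with
      | takeThis hr =>
        refine Or.inr ⟨_, rfl, ?_⟩
        dsimp only at hm ⊢
        rw [Finset.card_erase_of_mem hr, hm]
        rfl
      | finish => exact Or.inl rfl
      | _ => simp at hph
    rcases hs with hs | ⟨todo, h₁, h₂⟩
    · exact ⟨t + 1, by omega, hs⟩
    · obtain ⟨s, hts, h₃, h₄⟩ :=
        exists_phase_takeThis_of_compare hstep hinv m _ (t + 1) todo h₁ h₂ rfl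
      obtain ⟨s', hss', h⟩ := ih s h₃ h₄
      exact ⟨s', by omega, h⟩

/-- There are infinitely many passes. -/
theorem exists_phase_start [Finite A] {g : A → G} (hι : Function.Involutive ι)
    (hg : ∀ x, g (ι x) = (g x)⁻¹) (hstep : ∀ t, Step ι (run t) (run (t + 1)))
    (hinv : ∀ t, Inv g ι (run t)) (t : ℕ) : ∃ s, t ≤ s ∧ (run s).phase = .start := by
  have h₁ : ∀ t, (run t).phase = .takeThis → ∃ s, t ≤ s ∧ (run s).phase = .start :=
    fun t h => exists_phase_start_of_takeThis hstep hinv _ t h rfl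
  have h₂ : ∀ t, (run t).phase = .minimizeNew → ∃ s, t ≤ s ∧ (run s).phase = .start := by
    intro t h
    obtain ⟨s, hs, h'⟩ := exists_phase_takeThis hι hg hstep hinv
      ((run t).store.newRules.sup fun r => r.1.length) _ t h
      (fun r hr => Finset.le_sup (f := fun r : Rule A => r.1.length) hr) le_rfl
    obtain ⟨s', hs', h''⟩ := h₁ s h'
    exact ⟨s', by omega, h''⟩
  cases hph : (run t).phase with
  | start => exact ⟨t, le_rfl, hph⟩
  | minimizeConsidered todo =>
    obtain ⟨s, hs, h'⟩ := exists_phase_minimizeNew hstep _ t todo hph rfl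
    obtain ⟨s', hs', h''⟩ := h₂ s h'
    exact ⟨s', by omega, h''⟩
  | minimizeNew => exact h₂ t hph
  | takeThis => exact h₁ t hph
  | compare todo =>
    obtain ⟨s, hs, h', -⟩ := exists_phase_takeThis_of_compare hstep hinv _ _ t todo hph rfl rfl
    obtain ⟨s', hs', h''⟩ := h₁ s h'
    exact ⟨s', by omega, h''⟩

end Passes

section Runs

variable {A : Type*} [LinearOrder A] {G : Type*} [Group G]

/-! ### Single steps -/

theorem Step.of_phase_start [Finite A] {ι : A → A} {c c' : Config A} (hs : Step ι c c')
    (hc : c.phase = .start) : c'.store = { c.store with toDelete := ∅ } ∧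
      c'.phase = .minimizeConsidered c.store.considered := by
  cases hs with
  | start => exact ⟨rfl, rfl⟩
  | _ => simp at hc

/-- In the last part of a pass the rule `r` is in `Considered` or `This`, and at the end of the
pass it is in `Considered`. -/
def Placed (r : Rule A) (c : Config A) : Prop :=
  match c.phase with
  | .takeThis | .compare _ => r ∈ c.store.considered ∨ r ∈ c.store.thisPass
  | .start => r ∈ c.store.considered
  | _ => True

theorem Step.placed [Finite A] {g : A → G} {ι : A → A} {c c' : Config A} (hs : Step ι c c')
    (h : Inv g ι c) {r : Rule A} (hr : r ∈ c.store.all) (hd : r ∉ c.store.toDelete)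
    (hp : Placed r c) : Placed r c' := by
  obtain ⟨hc, -⟩ := h
  cases hs with
  | start => trivial
  | minimizeConsidered => trivial
  | consideredDone => trivial
  | minimizeNew => trivial
  | @newDone E M S hnew =>
    dsimp only [Placed] at *
    rw [Store.mem_all, hnew] at hr
    simp only [Finset.notMem_empty, false_or] at hr
    tauto
  | @takeThis E M S r₀ hr₀ =>
    dsimp only [Placed] at *
    simp only [Finset.mem_insert, Finset.mem_erase]
    by_cases h : r = r₀
    · exact Or.inl (Or.inl h)
    · tauto
  | @compare E M S todo p S₁ v S₂ w hp' h₁ h₂ =>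
    obtain ⟨g₁, c₁, -⟩ := h₁.grow hc
    obtain ⟨g₂, -⟩ := h₂.grow c₁
    dsimp only [Placed] at *
    rw [← g₁.considered, ← g₂.considered, ← g₁.thisPass, ← g₂.thisPass] at hp
    split
    · exact hp
    · rwa [(S₂.record_spec _).1, (S₂.record_spec _).2.1]
  | compareDone => exact hp
  | @finish E M S S' M' hthis hrel hirr =>
    have gr := (relabel_spec g hc.dec hc.val hc.aut hrel).1
    dsimp only [Placed] at *
    rw [gr.considered]
    rw [hthis] at hp
    simpa using hp

/-- A rule enters `Considered` only when it is taken from `This`. -/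
theorem Step.considered_source [Finite A] {g : A → G} {ι : A → A} (hι : Function.Involutive ι)
    (hg : ∀ x, g (ι x) = (g x)⁻¹) {c c' : Config A} (hs : Step ι c c') (h : Inv g ι c)
    {r : Rule A} (hr : r ∉ c.store.considered) (hr' : r ∈ c'.store.considered) :
    c'.phase = .compare (criticalPairs r (c'.store.considered : Set (Rule A))) := by
  obtain ⟨hc, hp⟩ := h
  cases hs with
  | start => exact absurd hr' hr
  | @minimizeConsidered E M S todo r₀ S' M' hr₀ hm =>
    obtain ⟨-, -, S₂, out, b, ho, rfl, -⟩ :=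
      minimize_inv hι hg hc hp.1 (Store.mem_all.2 (Or.inl (hp.2 _ hr₀))) hm
    dsimp only at hr'
    rw [mem_considered_handle, ho.grow.considered] at hr'
    exact absurd hr'.1 hr
  | consideredDone => exact absurd hr' hr
  | minimizeNew hr₀ hm =>
    obtain ⟨-, -, S₂, out, b, ho, rfl, -⟩ :=
      minimize_inv hι hg hc hp (Store.mem_all.2 (by tauto)) hm
    dsimp only at hr'
    rw [mem_considered_handle, ho.grow.considered] at hr'
    exact absurd hr'.1 hr
  | newDone => exact absurd hr' hr
  | @takeThis E M S r₀ hr₀ =>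
    dsimp only at hr hr'
    rw [Finset.mem_insert] at hr'
    obtain rfl : r = r₀ := hr'.resolve_right hr
    rfl
  | @compare E M S todo p S₁ v S₂ w hp' h₁ h₂ =>
    obtain ⟨g₁, c₁, -⟩ := h₁.grow hc
    obtain ⟨g₂, -⟩ := h₂.grow c₁
    dsimp only at hr hr'
    rw [← g₁.considered, ← g₂.considered] at hr
    split at hr'
    · exact absurd hr' hr
    · rw [(S₂.record_spec _).1] at hr'
      exact absurd hr' hr
  | compareDone => exact absurd hr' hr
  | finish hthis hrel hirr =>
    have gr := (relabel_spec g hc.dec hc.val hc.aut hrel).1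
    dsimp only at hr hr'
    rw [gr.considered] at hr'
    exact absurd hr' hr

theorem Step.compare_or [Finite A] {ι : A → A} {c c' : Config A} (hs : Step ι c c')
    {todo : Set (List A × List A)} (hc : c.phase = .compare todo) {p : List A × List A}
    (hp : p ∈ todo) : (∃ todo', c'.phase = .compare todo' ∧ p ∈ todo') ∨
      ∃ S₁ v S₂ w, RReduce (ruleSet c.rules) c.store p.1 S₁ v ∧
        RReduce (ruleSet c.rules) S₁ p.2 S₂ w ∧
        c'.store = if v = w then S₂ else S₂.record (orient v w) := by
  cases hs with
  | @compare E M S todo' p' S₁ v S₂ w hp' h₁ h₂ =>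
    dsimp only at hc
    cases hc
    by_cases h : p = p'
    · subst h
      exact Or.inr ⟨S₁, v, S₂, w, h₁, h₂, rfl⟩
    · exact Or.inl ⟨_, rfl, hp, h⟩
  | compareDone =>
    dsimp only at hc
    cases hc
    exact absurd hp (by simp)
  | _ => simp at hc

/-! ### Infinite runs -/

/-- A run, with an interpretation of the letters in a group in which the rules hold. -/
structure GoodRun [Finite A] (g : A → G) (ι : A → A) (run : ℕ → Config A) : Prop where
  invol : Function.Involutive ι
  hom : ∀ x, g (ι x) = (g x)⁻¹
  step : ∀ t, Step ι (run t) (run (t + 1))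
  inv : ∀ t, Inv g ι (run t)
  considered : (run 0).store.considered = ∅
  toDelete : (run 0).store.toDelete = ∅
  special : ∀ x, ([x, ι x], []) ∈ rulesAt run 0

/-- The rules that are stored at some time. -/
def everStored (run : ℕ → Config A) : Set (Rule A) := {r | ∃ t, r ∈ rulesAt run t}

variable {ι : A → A} {run : ℕ → Config A}

/-- The store between minimization and handling is none of the `S(t)`. But handling loses at most
`r`, which was stored at time `t`. -/
theorem subset_everStored {t : ℕ} {r : Rule A} {S₂ : Store A} {out : Rule A} {b : Bool}
    (hr : r ∈ (run t).store.all) (hS : (run (t + 1)).store = handle S₂ r out b) :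
    (S₂.all : Set (Rule A)) ⊆ everStored run := by
  intro r' hr'
  rcases mem_handle (r := r) (out := out) (b := b) hr' with h' | ⟨rfl, -⟩
  · exact ⟨t + 1, by rw [rulesAt, hS]; exact h'⟩
  · exact ⟨t, hr⟩

/-- When a rule is revised whose left-hand side has no reducible proper substring, its right-hand
side is reduced. -/
theorem exists_of_revised {r : Rule A}
    (hr : ProperIrr (everStored run) r.1) {t : ℕ} (hrev : Revised ι (run t) (run (t + 1)) r) :
    ∃ σ, (r.1, σ) ∈ everStored run ∧ SLt σ r.2 ∧ ¬ IsIrred (everStored run) r.2 := by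
  obtain ⟨hrS, S₂, out, b, ho, hS, hne⟩ := hrev
  have hsub := subset_everStored hrS hS
  cases b with
  | true =>
    obtain ⟨-, -, r', hr', h₁, h₂⟩ := ho.affected rfl
    exact absurd (List.infix_refl _) (isIrred_iff.1 (hr _ h₁ h₂) r' (hsub hr'))
  | false =>
    obtain ⟨-, hmin, h₁, h₂⟩ := ho.unaffected rfl
    have hout : out ∈ everStored run := by
      refine ⟨t + 1, ?_⟩
      rw [rulesAt, hS]
      refine out_mem_handle ?_ hne
      rintro rfl
      exact sLt_irrefl _ hmin.lt
    -- A different left-hand side would be a reducible proper substring of `r.1`. So only the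
    -- right-hand side has changed, and it has been reduced.
    by_cases he : out.1 = r.1
    · have hne' : out.2 ≠ r.2 := fun h => hne (Prod.ext he h)
      exact ⟨out.2, he ▸ hout, (sLe_of_reflTransGen ho.dec (h₂ he)).resolve_left hne',
        fun hirr => not_isIrred_of_reflTransGen (h₂ he) hne' (hirr.mono hsub)⟩
    · exact absurd (List.infix_refl _) (isIrred_iff.1 (hr _ h₁ he) out hout)

variable [Finite A] {g : A → G}

theorem GoodRun.not_isIrred_mono (h : GoodRun g ι run) {w : List A} {s t : ℕ} (hst : s ≤ t)
    (hw : ¬ IsIrred (rulesAt run s) w) : ¬ IsIrred (rulesAt run t) w := by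
  induction hst with
  | refl => exact hw
  | step _ ih =>
    obtain ⟨r, hr, hrw⟩ := not_isIrred_iff.1 ih
    obtain ⟨r', hr', hi⟩ := (h.step _).infix h.invol h.hom (h.inv _) hr
    exact not_isIrred_iff.2 ⟨r', hr', hi.trans hrw⟩

/-- Since reducibility persists, irreducibility at arbitrarily large times is irreducibility at all
times. Permanence thereby becomes a statement about one fixed rewriting system. -/
theorem GoodRun.permanentlyIrreducible_iff (h : GoodRun g ι run) {w : List A} :
    PermanentlyIrreducible run w ↔ IsIrred (everStored run) w := by
  constructor
  · intro hw
    rw [isIrred_iff]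
    rintro r ⟨t, hr⟩ hrw
    obtain ⟨s, hts, hs⟩ := hw t
    exact h.not_isIrred_mono hts (not_isIrred_iff.2 ⟨r, hr, hrw⟩) hs
  · exact fun hw t => ⟨t, le_rfl, hw.mono (R := rulesAt run t) fun _ hr => Exists.intro t hr⟩

theorem GoodRun.mem_permanentRules (h : GoodRun g ι run) {r : Rule A} :
    r ∈ permanentRules run ↔ r ∈ everStored run ∧ IsIrred (everStored run) r.2 ∧
      ProperIrr (everStored run) r.1 := by
  simp only [permanentRules, h.permanentlyIrreducible_iff]
  rfl

theorem GoodRun.decreasing (h : GoodRun g ι run) : Decreasing (everStored run) :=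
  fun r ⟨t, hr⟩ => (h.inv t).1.dec r hr

theorem GoodRun.exists_start (h : GoodRun g ι run) (t : ℕ) :
    ∃ s, t ≤ s ∧ (run s).phase = .start ∧ (run s).store.thisPass = ∅ := by
  obtain ⟨s, hs, hph⟩ := exists_phase_start h.invol h.hom h.step h.inv (t + 1)
  obtain ⟨s, rfl⟩ : ∃ k, s = k + 1 := ⟨s - 1, by omega⟩
  exact ⟨s + 1, by omega, hph, (h.step s).thisPass_eq_empty (h.inv s) hph⟩

/-- The invariant may fail during the first pass, where `This` holds initial rules that have not
been minimized. When the next pass starts `This` is empty. -/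
theorem GoodRun.exists_readInv (h : GoodRun g ι run) : ∃ t₀, ∀ t, t₀ ≤ t → ReadInv (run t) := by
  obtain ⟨s, -, hph, hthis⟩ := h.exists_start 0
  refine ⟨s, fun t hst => ?_⟩
  induction hst with
  | refl =>
    unfold ReadInv
    rw [hph]
    exact hthis
  | step _ ih => exact (h.step _).readInv h.invol h.hom (h.inv _) ih

/-- A string that becomes reducible is eventually reduced by the rules of the automata. -/
theorem GoodRun.exists_covered (h : GoodRun g ι run) {w : List A}
    (hw : ¬ IsIrred (everStored run) w) : ∃ t₁, ∀ t, t₁ ≤ t → ReadInv (run t) ∧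
      Covered w (run t) ∧ ¬ IsIrred (ruleSet (run t).rules) w := by
  obtain ⟨r, ⟨t, hr⟩, hrw⟩ := not_isIrred_iff.1 hw
  obtain ⟨t₀, ht₀⟩ := h.exists_readInv
  obtain ⟨s, hs, hph, -⟩ := h.exists_start (max t t₀)
  have hcov : ∀ t', s ≤ t' → Covered w (run t') := by
    intro t' hst
    induction hst with
    | refl =>
      refine ⟨not_isIrred_iff.1 (h.not_isIrred_mono (s := t) (by omega)
        (not_isIrred_iff.2 ⟨r, hr, hrw⟩)), ?_⟩
      rw [hph]
      trivial
    | step _ ih => exact (h.step _).covered h.invol h.hom (h.inv _) ih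
  -- Within one further pass a covering rule is read by the needed part of `WDiff`, which becomes
  -- the next `Rules`.
  obtain ⟨s₁, hs₁, hph₁, -⟩ := h.exists_start (s + 1)
  refine ⟨s₁, fun t' ht' => ⟨ht₀ t' (by omega), hcov t' (by omega), ?_⟩⟩
  induction ht' with
  | refl =>
    obtain ⟨k, rfl⟩ : ∃ k, s₁ = k + 1 := ⟨s₁ - 1, by omega⟩
    exact (h.step k).not_isIrred_of_covered (h.inv k) (ht₀ k (by omega)) (hcov k (by omega)) hph₁
  | @step k hk ih =>
    have hk : s₁ ≤ k := hk
    by_cases hc : (run (k + 1)).phase = .start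
    · exact (h.step k).not_isIrred_of_covered (h.inv k) (ht₀ k (by omega)) (hcov k (by omega)) hc
    · rw [Nat.succ_eq_add_one, (h.step k).rules_eq hc]
      exact ih

/-- If the rule stayed stored, a whole pass would treat it without its ever being minimal. At the
end of the pass it could only be in `Delete`, which is emptied next. -/
theorem GoodRun.exists_notMem (h : GoodRun g ι run) {r : Rule A} {s : ℕ}
    (hr : ∀ t, s ≤ t → ¬ TMin ι (ruleSet (run t).rules) r) :
    ∃ t, s ≤ t ∧ r ∉ rulesAt run t := by
  by_contra hcon
  push Not at hcon
  obtain ⟨a, ha, hph, hthis⟩ := h.exists_start s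
  obtain ⟨h₁, h₂⟩ := (h.step a).of_phase_start hph
  have htr : ∀ t, a + 1 ≤ t → Treated r (run t) := by
    intro t ht
    induction ht with
    | refl =>
      unfold Treated
      rw [h₂, h₁]
      exact ⟨by simp [hthis], fun h => h⟩
    | @step k hk ih =>
      have hk : a + 1 ≤ k := hk
      exact (h.step k).treated h.invol h.hom (h.inv k) ih (hcon k (by omega)) (hr k (by omega))
  obtain ⟨b, hb, hphb, -⟩ := h.exists_start (a + 1)
  have h₃ := htr b hb
  unfold Treated at h₃
  rw [hphb] at h₃
  have h₄ := hcon (b + 1) (by omega)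
  rw [rulesAt, Finset.mem_coe, ((h.step b).of_phase_start hphb).1, Store.mem_all] at h₄
  simp only [Finset.notMem_empty, or_false] at h₄
  tauto

/-- If the right-hand side or a proper substring of the left-hand side is ever reducible, then from
some time on it is reducible by `Rules`. The rule is then never minimal and drops out, and each way
in which rules arise is closed to it. -/
theorem GoodRun.mem_permanentRules_of_frequently (h : GoodRun g ι run) {r : Rule A}
    (hr : ∀ t, ∃ s, t ≤ s ∧ r ∈ rulesAt run s) : r ∈ permanentRules run := by
  have out : ∀ t₁, (∀ t, t₁ ≤ t → ¬ TMin ι (ruleSet (run t).rules) r) →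
      (∀ t, t₁ ≤ t → r ∉ rulesAt run t → r ∉ rulesAt run (t + 1)) → False := by
    intro t₁ h₁ h₂
    obtain ⟨t, ht, hrt⟩ := h.exists_notMem h₁
    obtain ⟨s, hs, hrs⟩ := hr t
    have : ∀ s, t ≤ s → r ∉ rulesAt run s := by
      intro s hs
      induction hs with
      | refl => exact hrt
      | @step k hk ih =>
        have hk : t ≤ k := hk
        exact h₂ k (by omega) ih
    exact this s hs hrs
  obtain ⟨t₀, -, ht₀⟩ := hr 0
  have hlhs : ProperIrr (everStored run) r.1 := by
    intro w hw hne
    by_contra hred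
    obtain ⟨t₁, ht₁⟩ := h.exists_covered hred
    refine out t₁ (fun t ht hmin => (ht₁ t ht).2.2 (hmin.lhs w hw hne)) fun t ht hrt hrt' => ?_
    obtain ⟨h₁, h₂, h₃⟩ := ht₁ t ht
    rcases (h.step t).source h.invol h.hom (h.inv t) hrt hrt' with
      ⟨-, h₄ | ⟨hph, E, hE, -, hread, -, h₄⟩⟩ | ⟨h₄, -⟩
    · exact h₃ (h₄ w hw hne)
    · exact h₂.not_isIrred_of_late (h.inv t) h₁ hph hE hread (h₄ w hw hne)
    · exact h₃ (h₄ w hw hne)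
  refine h.mem_permanentRules.2 ⟨⟨t₀, ht₀⟩, ?_, hlhs⟩
  by_contra hred
  obtain ⟨t₁, ht₁⟩ := h.exists_covered hred
  refine out (max t₀ t₁) (fun t ht hmin => (ht₁ t (by omega)).2.2 hmin.rhs)
    fun t ht hrt hrt' => ?_
  rcases (h.step t).source h.invol h.hom (h.inv t) hrt hrt' with ⟨h₄, -⟩ | ⟨-, h₄⟩
  -- Recording requires a left-hand side with no stored rule. But `r.1` stays reducible while its
  -- proper substrings are irreducible, so some stored rule always has exactly this left-hand side.
  · have := h.not_isIrred_mono (s := t₀) (t := t) (by omega)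
      (not_isIrred_iff.2 ⟨r, ht₀, List.infix_refl _⟩)
    obtain ⟨⟨l, σ⟩, h₅, h₆⟩ := not_isIrred_iff.1 this
    by_cases he : l = r.1
    · exact h₄ σ (he ▸ h₅)
    · exact isIrred_iff.1 (hlhs l h₆ he) (l, σ) ⟨t, h₅⟩ (List.infix_refl _)
  · exact (ht₁ t (by omega)).2.2 h₄

/-! ### Rules that are never revised -/

/-- The rule `r` is always left unchanged by minimization. -/
def NeverRevised (ι : A → A) (run : ℕ → Config A) (r : Rule A) : Prop :=
  ∀ t, ¬ Revised ι (run t) (run (t + 1)) r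

theorem GoodRun.notMem_toDelete (h : GoodRun g ι run) {r : Rule A} (hr : NeverRevised ι run r)
    (t : ℕ) : r ∉ (run t).store.toDelete := by
  induction t with
  | zero => simp [h.toDelete]
  | succ t ih =>
    exact fun h' => ((h.step t).toDelete h.invol h.hom (h.inv t) h').elim ih (hr t)

theorem GoodRun.mem_of_neverRevised (h : GoodRun g ι run) {r : Rule A}
    (hr : NeverRevised ι run r) {s t : ℕ} (hst : s ≤ t) (hs : r ∈ rulesAt run s) :
    r ∈ rulesAt run t := by
  induction hst with
  | refl => exact hs
  | @step k _ ih =>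
    rcases (h.step k).mem_or h.invol h.hom (h.inv k) ih with h' | ⟨-, h', -⟩ | h'
    · exact h'
    · exact absurd h' (h.notMem_toDelete hr k)
    · exact absurd h' (hr k)

/-- Revising a permanent rule would reduce its right-hand side, which is irreducible. Conversely, an
unrevised rule never leaves the store. -/
theorem GoodRun.mem_permanentRules_iff_neverRevised (h : GoodRun g ι run) {r : Rule A} :
    r ∈ permanentRules run ↔ r ∈ everStored run ∧ NeverRevised ι run r := by
  constructor
  · intro hr
    obtain ⟨h₁, h₂, h₃⟩ := h.mem_permanentRules.1 hr
    refine ⟨h₁, fun t hrev => ?_⟩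
    obtain ⟨σ, -, -, h₄⟩ := exists_of_revised h₃ hrev
    exact h₄ h₂
  · rintro ⟨⟨s, hs⟩, hr⟩
    exact h.mem_permanentRules_of_frequently fun t =>
      ⟨max s t, le_max_right _ _, h.mem_of_neverRevised hr (le_max_left _ _) hs⟩

theorem GoodRun.permanentRules_eq (h : GoodRun g ι run) :
    permanentRules run = ⋂ t : ℕ, ⋃ s ≥ t, rulesAt run s := by
  ext r
  simp only [Set.mem_iInter, Set.mem_iUnion, exists_prop]
  refine ⟨fun hr t => ?_, h.mem_permanentRules_of_frequently⟩
  obtain ⟨⟨s, hs⟩, hr'⟩ := h.mem_permanentRules_iff_neverRevised.1 hr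
  exact ⟨max s t, le_max_right _ _, h.mem_of_neverRevised hr' (le_max_left _ _) hs⟩

/-- Take a minimal reducible substring of `w` and the least right-hand side ever stored for it. A
revision would provide a smaller right-hand side, so this rule is never revised and hence permanent.
-/
theorem GoodRun.isIrred_permanentRules_iff (h : GoodRun g ι run) {w : List A} :
    IsIrred (permanentRules run) w ↔ PermanentlyIrreducible run w := by
  rw [h.permanentlyIrreducible_iff]
  refine ⟨fun hw => ?_, fun hw => hw.mono fun r hr => hr.1⟩
  by_contra hred
  obtain ⟨l, ⟨hlw, hl⟩, hleast⟩ := (sLt_wf A).has_min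
    {l | l <:+: w ∧ ¬ IsIrred (everStored run) l} ⟨w, List.infix_refl _, hred⟩
  have hprop : ProperIrr (everStored run) l := by
    intro v hv hne
    by_contra hv'
    exact hleast v ⟨hv.trans hlw, hv'⟩ (sLt_of_isInfix hv hne)
  obtain ⟨⟨l', σ⟩, hr, hi⟩ := not_isIrred_iff.1 hl
  have he : l' = l := by
    by_contra he
    exact isIrred_iff.1 (hprop l' hi he) (l', σ) hr (List.infix_refl _)
  subst he
  obtain ⟨ρ, hρ, hmin⟩ := (sLt_wf A).has_min {ρ | (l', ρ) ∈ everStored run} ⟨σ, hr⟩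
  refine isIrred_iff.1 hw (l', ρ) (h.mem_permanentRules_iff_neverRevised.2 ⟨hρ, fun t hrev => ?_⟩)
    hlw
  obtain ⟨τ, h₁, h₂, -⟩ := exists_of_revised hprop hrev
  exact hmin τ h₁ h₂

/-- Each stored rule follows from the permanent rules, without use of larger strings. -/
theorem GoodRun.follows (h : GoodRun g ι run) {r : Rule A} (hr : r ∈ everStored run) :
    Follows (permanentRules run) r := by
  obtain ⟨u, v⟩ := r
  -- Induction on the left-hand side, then on the right-hand side. A nonempty output of a revision
  -- has a smaller left-hand side, or the same one and a smaller right-hand side.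
  induction u using (sLt_wf A).induction generalizing v with
  | _ u ihu =>
  induction v using (sLt_wf A).induction with
  | _ v ihv =>
  by_cases hp : (u, v) ∈ permanentRules run
  · exact .rel _ _ ⟨rewrites_of_mem hp, SLe.refl _⟩
  have hrev : ¬ NeverRevised ι run (u, v) :=
    fun h' => hp (h.mem_permanentRules_iff_neverRevised.2 ⟨hr, h'⟩)
  unfold NeverRevised at hrev
  push Not at hrev
  obtain ⟨t, hrS, S₂, out, b, ho, hS, hne⟩ := hrev
  refine ho.follows _ (everStored run) (fun r' hr' hlt => ihu r'.1 hlt r'.2 hr')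
    (fun x => ⟨0, h.special x⟩) (subset_everStored hrS hS) ?_
  by_cases hout : out = ([], [])
  · subst hout
    exact fun _ _ _ => .refl _
  have hmem : out ∈ everStored run :=
    ⟨t + 1, by rw [rulesAt, hS]; exact out_mem_handle hout hne⟩
  refine Follows.bounded ?_
  cases b with
  | true => exact ihu out.1 (ho.affected rfl).2.1 out.2 hmem
  | false =>
    obtain ⟨-, -, h₁, h₂⟩ := ho.unaffected rfl
    by_cases he : out.1 = u
    · have hne' : out.2 ≠ v := fun h => hne (Prod.ext he h)
      have := ihv out.2 ((sLe_of_reflTransGen ho.dec (h₂ he)).resolve_left hne') (he ▸ hmem)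
      rwa [← he] at this
    · exact ihu out.1 (sLt_of_isInfix h₁ he) out.2 hmem

/-! ### Confluence of the permanent rules -/

/-- A permanent rule is never in `Delete`, so once `New` is empty it is in `Considered` or `This`,
and `This` is emptied before the pass ends. From `Considered` only a revision could remove it. -/
theorem GoodRun.exists_considered (h : GoodRun g ι run) {r : Rule A}
    (hr : r ∈ permanentRules run) : ∃ t₁, ∀ t, t₁ ≤ t → r ∈ (run t).store.considered := by
  obtain ⟨⟨t₀, ht₀⟩, hr⟩ := h.mem_permanentRules_iff_neverRevised.1 hr
  obtain ⟨a, ha, hph, -⟩ := h.exists_start t₀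
  have hpl : ∀ t, a + 1 ≤ t → Placed r (run t) := by
    intro t ht
    induction ht with
    | refl =>
      unfold Placed
      rw [((h.step a).of_phase_start hph).2]
      trivial
    | @step k hk ih =>
      have hk : a + 1 ≤ k := hk
      exact (h.step k).placed (h.inv k) (h.mem_of_neverRevised hr (by omega) ht₀)
        (h.notMem_toDelete hr k) ih
  obtain ⟨b, hb, hphb, -⟩ := h.exists_start (a + 1)
  refine ⟨b, fun t ht => ?_⟩
  induction ht with
  | refl =>
    have := hpl b hb
    unfold Placed at this
    rwa [hphb] at this
  | @step k _ ih =>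
    exact ((h.step k).considered h.invol h.hom (h.inv k) ih).resolve_right (hr k)

/-- Each critical pair of permanent rules is treated at some time. -/
theorem GoodRun.exists_reduce (h : GoodRun g ι run) {r₁ r₂ : Rule A}
    (hr₁ : r₁ ∈ permanentRules run) (hr₂ : r₂ ∈ permanentRules run) {s₁ z s₂ : List A}
    (hz : z ≠ []) (h₁ : r₁.1 = s₁ ++ z) (h₂ : r₂.1 = z ++ s₂) :
    ∃ t S₁ v S₂ w, RReduce (ruleSet (run t).rules) (run t).store (r₁.2 ++ s₂) S₁ v ∧
      RReduce (ruleSet (run t).rules) S₁ (s₁ ++ r₂.2) S₂ w ∧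
      (run (t + 1)).store = if v = w then S₂ else S₂.record (orient v w) := by
  classical
  -- At the first such time one of the two has just been taken from `This`, so its overlaps with the
  -- other are on the list. Time zero is excluded, because `Considered` starts empty.
  have hex : ∃ t, r₁ ∈ (run t).store.considered ∧ r₂ ∈ (run t).store.considered := by
    obtain ⟨a, ha⟩ := h.exists_considered hr₁
    obtain ⟨b, hb⟩ := h.exists_considered hr₂
    exact ⟨max a b, ha _ (le_max_left _ _), hb _ (le_max_right _ _)⟩
  obtain ⟨m, hm⟩ : ∃ m, Nat.find hex = m + 1 := by
    refine Nat.exists_eq_succ_of_ne_zero fun h0 => ?_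
    have := (Nat.find_spec hex).1
    rw [h0, h.considered] at this
    simp at this
  obtain ⟨hc₁, hc₂⟩ := Nat.find_spec hex
  have hnot := Nat.find_min hex (m := m) (by omega)
  rw [hm] at hc₁ hc₂
  have htodo : ∃ todo, (run (m + 1)).phase = .compare todo ∧ (r₁.2 ++ s₂, s₁ ++ r₂.2) ∈ todo := by
    rw [not_and_or] at hnot
    rcases hnot with hn | hn
    · exact ⟨_, (h.step m).considered_source h.invol h.hom (h.inv m) hn hc₁, r₂, hc₂, s₁, z, s₂, hz,
        Or.inl ⟨h₁, h₂, rfl⟩⟩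
    · exact ⟨_, (h.step m).considered_source h.invol h.hom (h.inv m) hn hc₂, r₁, hc₁, s₁, z, s₂, hz,
        Or.inr ⟨h₁, h₂, rfl⟩⟩
  -- An untreated pair would hold up the comparison phase for ever, but another pass does start.
  by_contra hcon
  have hall : ∀ t, m + 1 ≤ t →
      ∃ todo, (run t).phase = .compare todo ∧ (r₁.2 ++ s₂, s₁ ++ r₂.2) ∈ todo := by
    intro t ht
    induction ht with
    | refl => exact htodo
    | @step k _ ih =>
      obtain ⟨todo, h₃, h₄⟩ := ih
      exact ((h.step k).compare_or h₃ h₄).resolve_right fun ⟨S₁, v, S₂, w, h'⟩ =>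
        hcon ⟨k, S₁, v, S₂, w, h'⟩
  obtain ⟨s, hs, hph, -⟩ := h.exists_start (m + 1)
  obtain ⟨todo, h₃, -⟩ := hall s hs
  rw [hph] at h₃
  simp at h₃

/-- Reducing a critical pair connects its members to `v` and `w` below the overlap. If `v` and `w`
differ, the rule between them is stored and follows from permanent rules without exceeding the
larger of the two, again below the overlap. -/
theorem GoodRun.confluent (h : GoodRun g ι run) : Confluent (permanentRules run) := by
  have hdec : Decreasing (permanentRules run) := fun r hr => h.decreasing r hr.1
  refine confluent_of_peaks hdec (conn_of_peak hdec (fun r hr w hw hne =>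
    h.isIrred_permanentRules_iff.2 (hr.2.2 w hw hne)) ?_)
  intro r₁ hr₁ r₂ hr₂ s₁ z s₂ hz h₁ h₂
  obtain ⟨t, S₁, v, S₂, w, hv, hw, hS⟩ := h.exists_reduce hr₁ hr₂ hz h₁ h₂
  obtain ⟨g₁, c₁, e₁, -⟩ := hv.grow (h.inv t).1
  obtain ⟨g₂, c₂, e₂, -⟩ := hw.grow c₁
  have hsub₂ : (S₂.all : Set (Rule A)) ⊆ everStored run := by
    intro r hr
    refine ⟨t + 1, ?_⟩
    rw [rulesAt, hS]
    split
    · exact hr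
    · exact Store.mem_all_record.2 (Or.inr hr)
  have hsub₁ : (S₁.all : Set (Rule A)) ⊆ everStored run :=
    fun r hr => hsub₂ (g₂.all_subset hr)
  have lt₁ : SLt (r₁.2 ++ s₂) (s₁ ++ z ++ s₂) := by
    rw [← h₁]
    exact (hdec r₁ hr₁).append_right s₂
  have lt₂ : SLt (s₁ ++ r₂.2) (s₁ ++ z ++ s₂) := by
    rw [List.append_assoc, ← h₂, sLt_append_left_iff]
    exact hdec r₂ hr₂
  have j₁ : Conn (permanentRules run) (SLt · (s₁ ++ z ++ s₂)) (r₁.2 ++ s₂) v :=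
    conn_of_reflTransGen h.decreasing (fun r hr _ => h.follows hr)
      (reflTransGen_imp (fun _ _ h' => h'.mono hsub₁) e₁) (SLe.refl _)
      fun _ hw => hw.trans_lt lt₁
  have j₂ : Conn (permanentRules run) (SLt · (s₁ ++ z ++ s₂)) (s₁ ++ r₂.2) w :=
    conn_of_reflTransGen h.decreasing (fun r hr _ => h.follows hr)
      (reflTransGen_imp (fun _ _ h' => h'.mono hsub₂) e₂) (SLe.refl _)
      fun _ hw => hw.trans_lt lt₂
  refine j₁.trans _ _ _ (Relation.EqvGen.trans _ _ _ ?_ j₂.symm)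
  by_cases hvw : v = w
  · subst hvw
    exact .refl _
  have hvlt := (sLe_of_reflTransGen c₁.dec e₁).trans_lt lt₁
  have hwlt := (sLe_of_reflTransGen c₂.dec e₂).trans_lt lt₂
  have hb : Bounded (permanentRules run) (orient v w) := by
    refine (h.follows ⟨t + 1, ?_⟩).bounded
    rw [rulesAt, hS, if_neg hvw]
    exact Store.mem_all_record.2 (Or.inl rfl)
  have hb' : Bounded (permanentRules run) (v, w) := by
    rcases orient_cases v w with ⟨ho, -⟩ | ⟨ho, -⟩
    · rwa [ho] at hb
    · rw [ho] at hb
      exact hb.swap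
  obtain ⟨m, hm₁, hm₂, hm⟩ := exists_max v w
  refine Conn.mono (fun a ha => SLe.trans_lt ha ?_) (hb' m hm₁ hm₂)
  rcases hm with rfl | rfl
  · exact hvlt
  · exact hwlt

end Runs

section Initial

/-! ### The initial configuration -/

variable {A : Type*} {G : Type*} [Group G] {g : A → G} {ι : A → A}

/-- Cyclic cancellation conjugates the value, so only its triviality is preserved. -/
theorem val_eq_one_of_cyclicCancel (hg : ∀ x, g (ι x) = (g x)⁻¹) {w w' : List A}
    (h : Relation.ReflTransGen (CyclicCancel ι) w w') : val g w = 1 ↔ val g w' = 1 := by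
  induction h with
  | refl => rfl
  | tail _ h' ih =>
    rw [ih]
    rcases h' with ⟨x, y, a, rfl, rfl⟩ | ⟨a, rfl⟩
    · simp [hg]
    · simp [hg, ← mul_assoc]

/-- Forwards, this makes the initial rules hold in the group of `R`. Backwards, it recovers the
defining equalities in any group in which the initial rules hold. -/
theorem Normalizes.val_eq_iff [LinearOrder A] (hg : ∀ x, g (ι x) = (g x)⁻¹) {e : Rule A}
    {o : Option (Rule A)} (h : Normalizes ι e o) :
    val g e.1 = val g e.2 ↔ ∀ r ∈ o, val g r.1 = val g r.2 := by
  have key : ∀ r : Rule A, val g r.1 = val g r.2 ↔ val g (r.1 ++ inv ι r.2) = 1 := by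
    intro r
    rw [val_append, val_inv g hg, mul_inv_eq_one]
  cases o with
  | none =>
    rw [key, val_eq_one_of_cyclicCancel hg h.1]
    simp
  | some r =>
    rw [key, val_eq_one_of_cyclicCancel hg h.2.2.1, ← key]
    simp

variable [LinearOrder A] [Fintype A] {R : Finset (Rule A)} {run : ℕ → Config A}

theorem IsRun.goodRun (hι : Function.Involutive ι) (hg : ∀ x, g (ι x) = (g x)⁻¹)
    (hgR : ∀ u v, val g u = val g v ↔ Thue (R : Set (Rule A)) u v) (h : IsRun ι R run) :
    GoodRun g ι run := by
  obtain ⟨⟨o, p, R₀, E, ho, rfl, hp, hE, h₀⟩, hstep⟩ := h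
  have hR₀ : ∀ r ∈ specialRules ι ∪ R.biUnion (fun e => (o e).toFinset),
      SLt r.2 r.1 ∧ val g r.1 = val g r.2 := by
    intro r hr
    rw [Finset.mem_union] at hr
    rcases hr with hr | hr
    · obtain ⟨x, -, rfl⟩ := Finset.mem_image.1 hr
      exact ⟨sLt_of_length_lt (by simp), by simp [hg]⟩
    · obtain ⟨e, he, hr⟩ := Finset.mem_biUnion.1 hr
      rw [Option.mem_toFinset] at hr
      have hn := ho e he
      refine ⟨?_, (hn.val_eq_iff hg).1 ((hgR _ _).2 (.rel _ _ (rewrites_of_mem he))) r hr⟩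
      rw [Option.mem_def.1 hr] at hn
      exact hn.2.1.2.1
  have harr : ∀ a ∈ E, ValArrow g a := by
    rw [hE]
    refine valArrow_weld g (fun a ha => ?_) (fun _ _ h => h.elim)
    obtain ⟨r, hr, ha⟩ := Finset.mem_biUnion.1 ha
    have := (hgR _ _).2 ((hp r hr).2.2 a (List.mem_toFinset.1 ha))
    rw [ValArrow, ← this]
    simp [hg, mul_assoc]
  have hinv : Inv g ι (run 0) := by
    rw [h₀]
    refine ⟨⟨fun r hr => (hR₀ r ?_).1, fun r hr => (hR₀ r ?_).2,
      ⟨Finset.Subset.refl _, ?_, harr⟩, harr, by simp⟩, by simp [PhaseInv]⟩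
    · simpa [Store.all] using hr
    · simpa [Store.all] using hr
    · rw [hE]
      exact noDiag_dropLoops _
  refine ⟨hι, hg, hstep, fun t => ?_, by rw [h₀], by rw [h₀], fun x => ?_⟩
  · induction t with
    | zero => exact hinv
    | succ t ih => exact (hstep t).inv hι hg ih
  · rw [rulesAt, h₀, Finset.mem_coe, Store.mem_all]
    simp [specialRules]

/-- The permanent rules generate the Thue congruence. -/
theorem IsRun.thue_permanentRules (hι : Function.Involutive ι) (hg : GoodRun g ι run)
    (h : IsRun ι R run) {u v : List A} (huv : Thue (R : Set (Rule A)) u v) :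
    Thue (permanentRules run) u v := by
  have hstored : ∀ r ∈ everStored run, Thue (permanentRules run) r.1 r.2 :=
    fun r hr => (hg.follows hr).thue
  -- A second group, belonging to the permanent rules. In it the free and cyclic cancellations that
  -- turned equalities into rules can be undone.
  obtain ⟨G', _, g', hg', hiff⟩ :=
    exists_group hι (R := permanentRules run) fun x => hstored _ ⟨0, hg.special x⟩
  obtain ⟨⟨o, p, R₀, E, ho, rfl, hp, hE, h₀⟩, -⟩ := h
  refine huv.of_subset fun e he => (hiff _ _).1 (((ho e he).val_eq_iff hg').2 fun r hr =>
    (hiff _ _).2 (hstored r ⟨0, ?_⟩))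
  rw [rulesAt, h₀, Finset.mem_coe, Store.mem_all]
  refine Or.inr (Or.inl (Finset.mem_union_right _ (Finset.mem_biUnion.2 ⟨e, he, ?_⟩)))
  exact Option.mem_toFinset.2 hr

/-- Permanent rules preserve values and decrease strings, so a least string is irreducible.
Conversely, congruent strings have a common reduct by confluence, and for irreducible `u` this
reduct is `u` itself. -/
theorem IsRun.least_iff (hι : Function.Involutive ι)
    (hgR : ∀ u v, val g u = val g v ↔ Thue (R : Set (Rule A)) u v) (hg : GoodRun g ι run)
    (h : IsRun ι R run) (u : List A) :
    (∀ v, Thue (R : Set (Rule A)) u v → ¬ SLt v u) ↔ PermanentlyIrreducible run u := by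
  have hdec : Decreasing (permanentRules run) := fun r hr => hg.decreasing r hr.1
  rw [← hg.isIrred_permanentRules_iff]
  constructor
  · intro hu v huv
    refine hu v ((hgR _ _).1 ?_) (huv.sLt hdec)
    refine val_eq_of_reflTransGen g (fun r hr => ?_) (.single huv)
    obtain ⟨t, ht⟩ := hr.1
    exact (hg.inv t).1.val r ht
  · intro hu v huv
    obtain ⟨z, h₁, h₂⟩ := exists_join_of_thue hg.confluent (h.thue_permanentRules hι hg huv)
    rw [hu.eq_of_reflTransGen h₁] at h₂
    exact not_sLt.2 (sLe_of_reflTransGen hdec h₂)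

end Initial

end RapidKB

theorem mainTheorem3 {A : Type*} [LinearOrder A] [Fintype A] (ι : A → A)
    (hι : Function.Involutive ι) (R : Finset (RapidKB.Rule A))
    (hR : ∀ x : A, ([x, ι x], []) ∈ R ∧ ([ι x, x], []) ∈ R)
    (run : ℕ → RapidKB.Config A) (hrun : RapidKB.IsRun ι R run) :
    RapidKB.Confluent (RapidKB.permanentRules run) ∧
    RapidKB.permanentRules run = ⋂ t : ℕ, ⋃ s ≥ t, RapidKB.rulesAt run s ∧
    ∀ u : List A,
      (∀ v, RapidKB.Thue (R : Set (RapidKB.Rule A)) u v → ¬ RapidKB.SLt v u) ↔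
        RapidKB.PermanentlyIrreducible run u := by
  have hinv : ∀ x, RapidKB.Thue (R : Set (RapidKB.Rule A)) [x, ι x] [] := fun x =>
    .rel _ _ (RapidKB.rewrites_of_mem (hR x).1)
  obtain ⟨G, _, g, hg, hgR⟩ := RapidKB.exists_group hι hinv
  have h := hrun.goodRun hι hg hgR
  exact ⟨h.confluent, h.permanentRules_eq, hrun.least_iff hι hgR h⟩
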